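/- **Setting.** Let $P_n(z)=\sum_{k=0}^n \xi_k a_{k;n}z^k$ and, for $t\in\mathbb C$, $P_n(z;t)=\exp\{-\frac t{2n}\partial_z^2\}P_n(z)=\sum_{j\ge 0}\frac1{j!}\left(-\frac t{2n}\right)^j\partial_z^{2j}P_n(z)$. Assume: (A1) $\xi_0,\xi_1,\dots$ are i.i.d. complex-valued non-degenerate (not almost surely constant) random variables with $\mathbb E\log(1+|\xi_0|)<\infty$. (A2) $a_{k;n}$ are deterministic complex coefficients such that $\lim_{n\to\infty}\sup_{0\le k\le n}\left|\frac1n\log|a_{k;n}|-g(k/n)\right|=0$ (with $\log 0=-\infty$) for some continuous concave function $g:[0,1]\to\mathbb R$ whose left derivative at $1$ is not $-\infty$. (A3) $g$ is infinitely differentiable on $(0,1)$ with $g''<0$ there, and if $g'(0):=\lim_{\alpha\downarrow0}g'(\alpha)=+\infty$, then $\lim_{\alpha\downarrow0}\alpha e^{g'(\alpha)}=0$. For $t\in\mathbb C$ let $\nu_t$ be the deterministic probability measure on $\mathbb C$ that is the limit in probability, with respect to weak convergence, of the empirical measures of zeros of $P_n(\cdot\,;t)$ (each zero, counted with multiplicity,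 has weight $1/\deg P_n(\cdot\,;t)$; the empirical measure of a constant polynomial is $0$). Let $\Psi(z)=\frac14\operatorname{Re}\left(z^2-z\sqrt{z^2-4}\right)+\log\left|\frac{z+\sqrt{z^2-4}}2\right|-\frac12$, and for $\alpha\in[0,1]$, $z,t\in\mathbb C$ let $$f_t(\alpha,z)=g(\alpha)+\alpha\log\sqrt{|t|\alpha}+\alpha\Psi\left(\frac z{\sqrt{t\alpha}}\right)\quad(t\ne0,\ \alpha\neq0),$$ $f_t(0,z)=g(0)$, and $f_0(\alpha,z)=g(\alpha)+\alpha\log|z|$ for $\alpha\ne 0$ (equal to $-\infty$ if $z=0$). Here and below, $\sqrt{z^2-4\beta}$ is holomorphic in $z$ off the segment $\sqrt\beta\,[-2,2]$ and asymptotic to $z$ as $|z|\to\infty$. A *domain of regular points* is a connected open set $\mathcal D\subset\mathbb C\times\mathbb C$ with a smooth function $(z,t)\mapsto\alpha_t(z)\in[0,1]$ on $\mathcal D$ such that for every $(z,t)\in\mathcal D$ the supremum of $f_t(\cdot,z)$ over $[0,1]$ is attained at $\alpha_t(z)$ only; $z/\sqrt{t\alpha_t(z)}\notin[-2,2]$ (for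 $t\alpha_t(z)=0\neq z$ the quotient is $\infty$ and this holds; it is not required where $\alpha_t(z)=0$); and either $\alpha_t(z)=0$ on all of $\mathcal D$, or $\alpha_t(z)=1$ on all of $\mathcal D$, or $\alpha_t(z)\in(0,1)$ on all of $\mathcal D$. For $w\in\mathbb C$ let $\alpha_0(w)$ be the unique maximizer of $f_0(\cdot,w)$ on $[0,1]$. For $t\in\mathbb C$ let $T_t(w)=w+t\,\alpha_0(w)/w$ for $w\ne0$ and $T_t(0)=0$. Given a domain of regular points $\mathcal D$, let $\mathcal D_t=\{z\in\mathbb C:(z,t)\in\mathcal D\}$, for $z\in\mathcal D_t$ let $$T_t^{-1}(z)=\frac{z+\sqrt{z^2-4t\alpha_t(z)}}2,$$ and let $T_t^{-1}(\mathcal D_t)=\{T_t^{-1}(z):z\in\mathcal D_t\}$ be the image of $\mathcal D_t$ under this branch (not the full preimage of $\mathcal D_t$ under $T_t$). **Theorem.** Under (A1)–(A3), for every domain of regular points $\mathcal D$ and every $t\in\mathbb C$, $$\nu_t\big|_{\mathcal D_t}=(T_t)_\#\left(\nu_0\big|_{T_t^{-1}(\mathcal D_t)}\right).$$ -/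

import Mathlib

open MeasureTheory ProbabilityTheory Filter Topology Set
open scoped ENNReal BoundedContinuousFunction

namespace HeatZeros

noncomputable section

/-! ### Random polynomials, heat flow, empirical measures of zeros -/

/-- The heat flow operator `exp(-(s/2) ∂_z²)` on polynomials. The series is cut off at a point after
which all its terms vanish. -/
def heatFlow (s : ℂ) (p : Polynomial ℂ) : Polynomial ℂ :=
  ∑ j ∈ Finset.range (p.natDegree + 1),
    Polynomial.C ((j.factorial : ℂ)⁻¹ * (-(s / 2)) ^ j) * (Polynomial.derivative^[2 * j] p)

/-- The polynomial `P_n(z) = ∑_{k=0}^n ξ_k a_{k;n} z^k`, with `a n k` standing for `a_{k;n}` and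
`x k` for the value of `ξ_k`. -/
def poly (a : ℕ → ℕ → ℂ) (x : ℕ → ℂ) (n : ℕ) : Polynomial ℂ :=
  ∑ k ∈ Finset.range (n + 1), Polynomial.C (x k * a n k) * Polynomial.X ^ k

/-- The heat-evolved polynomial `P_n(z;t) = exp(-(t/(2n)) ∂_z²) P_n(z)`. -/
def heatPoly (a : ℕ → ℕ → ℂ) (x : ℕ → ℂ) (t : ℂ) (n : ℕ) : Polynomial ℂ :=
  heatFlow (t / n) (poly a x n)

/-- The empirical distribution of the zeros, counted with multiplicity, each with weight
`1 / degree`; it is the zero measure for a constant polynomial (which has no roots in Mathlib's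
sense, including the polynomial `0`). -/
def zeroMeasure (p : Polynomial ℂ) : Measure ℂ :=
  (p.natDegree : ℝ≥0∞)⁻¹ • (p.roots.map (fun z => Measure.dirac z)).sum

/-- The random measures `μ n` converge weakly in probability to the deterministic measure `ν`:
`∫ f dμ_n → ∫ f dν` in probability for every bounded continuous `f : ℂ → ℝ`. -/
def WeakLimitInProbability {Ω : Type*} [MeasurableSpace Ω] (P : Measure Ω)
    (μ : ℕ → Ω → Measure ℂ) (ν : Measure ℂ) : Prop :=
  ∀ f : ℂ →ᵇ ℝ,
    TendstoInMeasure P (fun n ω => ∫ z, f z ∂(μ n ω)) atTop (fun _ => ∫ z, f z ∂ν)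

/-- `ν` is the limiting zero distribution `ν_t` at time `t`: the deterministic probability measure
to which the empirical measures of zeros of `P_n(·;t)` converge weakly in probability. -/
structure IsLimitZeroDistribution {Ω : Type*} [MeasurableSpace Ω] (P : Measure Ω)
    (ξ : ℕ → Ω → ℂ) (a : ℕ → ℕ → ℂ) (t : ℂ) (ν : Measure ℂ) : Prop where
  isProbabilityMeasure : IsProbabilityMeasure ν
  tendsto : WeakLimitInProbability P
    (fun n ω => zeroMeasure (heatPoly a (fun k => ξ k ω) t n)) ν

/-! ### The standing conditions -/

/-- `ξ_0, ξ_1, …` are i.i.d. non-degenerate complex random variables with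
`E log(1 + |ξ_0|) < ∞`. -/
structure CondA1 {Ω : Type*} [MeasurableSpace Ω] (P : Measure Ω) (ξ : ℕ → Ω → ℂ) : Prop where
  measurable : ∀ k, Measurable (ξ k)
  indep : iIndepFun ξ P
  identDistrib : ∀ k, IdentDistrib (ξ k) (ξ 0) P P
  nondegenerate : ¬ ∃ c : ℂ, ∀ᵐ ω ∂P, ξ 0 ω = c
  integrable_log : Integrable (fun ω => Real.log (1 + ‖ξ 0 ω‖)) P

/-- The deterministic coefficients `a_{k;n}` have the exponential profile `g : [0,1] → ℝ`
(only the values of `g` on `[0,1]` matter), uniformly in `k`; `g` is continuous, concave, and its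
left derivative at `1` is finite.

The clause `a n k ≠ 0` is needed since `log 0 = -∞` in the mathematics, but `Real.log 0 = 0`.
For concave `g` the left difference quotients at `1` decrease, hence have a limit in `[-∞, ∞)`;
differentiability at `1` within `[0,1]` says precisely that this limit is not `-∞`. -/
structure CondA2 (a : ℕ → ℕ → ℂ) (g : ℝ → ℝ) : Prop where
  continuousOn : ContinuousOn g (Icc 0 1)
  profile : ∀ ε : ℝ, 0 < ε → ∀ᶠ n : ℕ in atTop, ∀ k : ℕ, k ≤ n →
    a n k ≠ 0 ∧ |1 / (n : ℝ) * Real.log ‖a n k‖ - g ((k : ℝ) / n)| ≤ ε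
  concaveOn : ConcaveOn ℝ (Icc 0 1) g
  leftDeriv_one_finite : DifferentiableWithinAt ℝ g (Icc 0 1) 1

/-- `g` is smooth on `(0,1)` with `g'' < 0`, and `α e^{g'(α)} → 0` as `α ↓ 0` in case
`g'(0) = lim_{α ↓ 0} g'(α) = +∞`. -/
structure CondA3 (g : ℝ → ℝ) : Prop where
  contDiffOn : ContDiffOn ℝ (⊤ : ℕ∞) g (Ioo 0 1)
  deriv2_neg : ∀ α ∈ Ioo (0 : ℝ) 1, deriv (deriv g) α < 0
  limit_of_infinite_slope : Tendsto (deriv g) (𝓝[>] 0) atTop →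
    Tendsto (fun α => α * Real.exp (deriv g α)) (𝓝[>] 0) (𝓝 0)

/-! ### The function whose supremum is the logarithmic potential -/

/-- The branch of `√(z² - 4β)` which is holomorphic in `z` off the segment
`[-2√β, 2√β]` and asymptotic to `z` at infinity: `z √(1 - 4β/z²)` with the principal root.
On the segment it is some square root of `z² - 4β`. -/
def branchSqrt (β z : ℂ) : ℂ :=
  if z = 0 then (-4 * β) ^ (1 / 2 : ℂ) else z * (1 - 4 * β / z ^ 2) ^ (1 / 2 : ℂ)

/-- `Ψ(z) = ¼ Re(z² - z√(z²-4)) + log|(z + √(z²-4))/2| - ½`. -/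
def Psi (z : ℂ) : ℝ :=
  1 / 4 * (z ^ 2 - z * branchSqrt 1 z).re + Real.log ‖(z + branchSqrt 1 z) / 2‖ - 1 / 2

/-- `f_t(α,z) = g(α) + α log √(|t|α) + α Ψ(z/√(tα))` for `t ≠ 0`, `α ≠ 0`, extended by its limits
`f_t(0,z) = g(0)` and `f_0(α,z) = g(α) + α log|z|`; the latter is `-∞` for `z = 0`, `α > 0`. -/
def fFun (g : ℝ → ℝ) (t : ℂ) (α : ℝ) (z : ℂ) : EReal :=
  if α = 0 then ((g 0 : ℝ) : EReal)
  else if t = 0 then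
    if z = 0 then ⊥ else ((g α + α * Real.log ‖z‖ : ℝ) : EReal)
  else ((g α + α * Real.log (Real.sqrt (‖t‖ * α))
      + α * Psi (z / (t * α) ^ (1 / 2 : ℂ)) : ℝ) : EReal)

/-- The supremum of `f_t(·,z)` over `[0,1]` is attained at `α` and only there. -/
def IsUniqueMaximizer (g : ℝ → ℝ) (t z : ℂ) (α : ℝ) : Prop :=
  α ∈ Icc (0 : ℝ) 1 ∧ ∀ b ∈ Icc (0 : ℝ) 1, b ≠ α → fFun g t b z < fFun g t α z

/-! ### Transport map and regular points -/

/-- `α_0(z)`, the unique maximizer of `α ↦ g(α) + α log|z|` on `[0,1]`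
(it is unique under the standing conditions; it is written as the supremum of the set of unique
maximizers, a singleton). -/
def alphaZero (g : ℝ → ℝ) (z : ℂ) : ℝ := sSup {α | IsUniqueMaximizer g 0 z α}

/-- The transport map `T_t(w) = w + t α_0(w)/w`, with `T_t(0) = 0`. -/
def transport (g : ℝ → ℝ) (t w : ℂ) : ℂ := w + t * alphaZero g w / w

/-- The set `D ⊆ ℂ × ℂ` of pairs `(z,t)`, with the function `α`, `α (z,t) = α_t(z)`, is a domain
of regular points.

`off_slit` is `z/√(tα_t(z)) ∉ [-2,2]`; if `tα_t(z) = 0` and `z ≠ 0`, the quotient is `∞` and the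
condition holds. If `α_t(z) = 0` nothing is required, so that `z = 0` is allowed in that case. -/
structure IsRegularDomain (g : ℝ → ℝ) (D : Set (ℂ × ℂ)) (α : ℂ × ℂ → ℝ) : Prop where
  isOpen : IsOpen D
  isConnected : IsConnected D
  smooth : ContDiffOn ℝ (⊤ : ℕ∞) α D
  off_slit : ∀ p ∈ D, α p = 0 ∨
    ∀ x ∈ Icc (-2 : ℝ) 2, p.1 ≠ (x : ℂ) * (p.2 * α p) ^ (1 / 2 : ℂ)
  maximizer : ∀ p ∈ D, IsUniqueMaximizer g p.2 p.1 (α p)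
  cases : (∀ p ∈ D, α p = 0) ∨ (∀ p ∈ D, α p = 1) ∨ (∀ p ∈ D, α p ∈ Ioo (0 : ℝ) 1)

/-- The slice `D_t = {z : (z,t) ∈ D}`. -/
def slice (D : Set (ℂ × ℂ)) (t : ℂ) : Set ℂ := {z | (z, t) ∈ D}

/-- The branch `T_t⁻¹(z) = (z + √(z² - 4tα_t(z)))/2` of the inverse at regular points. -/
def transportInv (α : ℂ × ℂ → ℝ) (t z : ℂ) : ℂ :=
  (z + branchSqrt (t * α (z, t)) z) / 2

end

end HeatZeros

namespace HeatZeros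

/-! The heat flow turns the monomials into rescaled Hermite polynomials, which satisfy a three-term
recursion. Off the slits, the ratio of consecutive ones follows the dominant root `w` of `w² - z w +
t β = 0`, that is `z = w + t β / w`. Hence the monomial of relative degree `β` has exponential
growth rate `growth t β z`, whose derivative in `β` is `log |w|`, and `f_t(β,z) = g(β) + growth t β
z` (`hermite_asymptotics`, `fFun_eq_growth`).

The supremum `U(z)` of `f_t(·,z)` should be the logarithmic potential of `ν_t` up to a constant. The
upper bound holds with high probability, locally uniformly off the slits (`norm_eval_heatPoly_le`).
The lower bound at a given point holds with probability bounded away from `0`, because one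
non-degenerate coefficient cannot be cancelled systematically (`exists_pos_le_measure_norm_sum`). As
`ν_t` is deterministic, a single outcome satisfying all bounds suffices
(`sub_le_integral_logKernelDiff`). The slits lie on one line, which circles meet in a null set of
angles, so the circle averages of `U` determine those of the potential even across this line
(`circleAverage_sub_circleAverage_eq`). Masses of small discs then show that `ν_t` has density `ΔU /
2π` wherever `U` is regular (`limit_measure_eq_lintegral`).

For the transport, put `w = T_t⁻¹(z)`, with `α = α_t(z)`. Since the derivative of `growth` at `α` is
`log |w|`, strict concavity of `g` makes `α` the unique maximizer at time `0` at the point `w`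
(`lt_of_isMax_growth`). By the envelope principle `dU = Re(m dz)` with `m = α / w`, so `m_t(z) =
m_0(w)` and `z = w + t m_0(w)`: `m` is constant along characteristics, as for Burgers' equation.
Therefore `dm_t ∧ dz = dm_0 ∧ dw`, the term with `t` being `dm_0 ∧ dm_0 = 0`. This is the equality
of densities up to the Jacobian (`reDbar_comp`), and the change of variables concludes. -/

/-! ### Heat flow on monomials: Hermite recursion and degrees -/

open Polynomial in
theorem heatFlow_eq_sum (s : ℂ) (p : ℂ[X]) {N : ℕ} (hN : p.natDegree + 1 ≤ N) :
    heatFlow s p = ∑ j ∈ Finset.range N,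
      C ((j.factorial : ℂ)⁻¹ * (-(s / 2)) ^ j) * (derivative^[2 * j] p) := by
  unfold heatFlow
  refine Finset.sum_subset (by simpa using hN) fun j _ hj => ?_
  rw [iterate_derivative_eq_zero, mul_zero]
  simp only [Finset.mem_range, not_lt] at hj
  omega

-- This is the commutation of multiplication by `X` with `exp(-(s/2)∂²)`, which produces `-s∂`.
-- Termwise: in the Leibniz rule for `X ^ (k + 1) * X` only one extra term survives, and its factor
-- `2(j + 1)` cancels against `(j + 1)!` and one factor `-s/2`.
open Polynomial in
theorem heatFlow_X_pow_succ_succ (s : ℂ) (k : ℕ) :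
    heatFlow s (X ^ (k + 2)) =
      X * heatFlow s (X ^ (k + 1)) - C (s * (k + 1 : ℕ)) * heatFlow s (X ^ k) := by
  have hd : ∀ m : ℕ, (X ^ m : ℂ[X]).natDegree = m := natDegree_X_pow
  rw [heatFlow_eq_sum s (X ^ (k + 2)) (N := k + 4) (by rw [hd]; omega),
    heatFlow_eq_sum s (X ^ (k + 1)) (N := k + 4) (by rw [hd]; omega),
    heatFlow_eq_sum s (X ^ k) (N := k + 3) (by rw [hd]; omega)]
  rw [Finset.sum_range_succ' _ (k + 3), Finset.sum_range_succ' _ (k + 3), mul_add, Finset.mul_sum,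
    Finset.mul_sum]
  have key : ∀ j : ℕ, C (((j + 1).factorial : ℂ)⁻¹ * (-(s / 2)) ^ (j + 1)) *
        (derivative^[2 * (j + 1)] (X ^ (k + 2) : ℂ[X])) =
      X * (C (((j + 1).factorial : ℂ)⁻¹ * (-(s / 2)) ^ (j + 1)) *
        (derivative^[2 * (j + 1)] (X ^ (k + 1) : ℂ[X]))) -
      C (s * (k + 1 : ℕ)) * (C ((j.factorial : ℂ)⁻¹ * (-(s / 2)) ^ j) *
        (derivative^[2 * j] (X ^ k : ℂ[X]))) := by
    intro j
    have e1 : (X ^ (k + 2) : ℂ[X]) = X ^ (k + 1) * X := by ring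
    have e2 : derivative^[2 * (j + 1) - 1] (X ^ (k + 1) : ℂ[X]) =
        C ((k + 1 : ℕ) : ℂ) * derivative^[2 * j] (X ^ k) := by
      rw [show 2 * (j + 1) - 1 = 2 * j + 1 by omega, Function.iterate_succ_apply,
        derivative_X_pow, iterate_derivative_C_mul]
      simp
    rw [e1, iterate_derivative_mul_X, e2, nsmul_eq_mul, ← C_eq_natCast]
    have hf : ((j + 1).factorial : ℂ)⁻¹ * (-(s / 2)) ^ (j + 1) * (2 * (j + 1) : ℕ) =
        -s * ((j.factorial : ℂ)⁻¹ * (-(s / 2)) ^ j) := by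
      have h0 : (j.factorial : ℂ) ≠ 0 := by exact_mod_cast j.factorial_ne_zero
      have h1 : (j : ℂ) + 1 ≠ 0 := by exact_mod_cast j.succ_ne_zero
      rw [Nat.factorial_succ]
      push_cast
      field_simp
      ring
    have hf' : C (((j + 1).factorial : ℂ)⁻¹ * (-(s / 2)) ^ (j + 1)) *
        C ((2 * (j + 1) : ℕ) : ℂ) = -C s * C ((j.factorial : ℂ)⁻¹ * (-(s / 2)) ^ j) := by
      rw [← C_mul, hf, C_mul, C_neg]
    rw [mul_add, ← mul_assoc, ← mul_assoc _ (C ((2 * (j + 1) : ℕ) : ℂ)), hf', C_mul (a := s)]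
    ring
  rw [Finset.sum_congr rfl fun j _ => key j, Finset.sum_sub_distrib]
  simp
  ring

open Polynomial in
theorem heatFlow_X_pow_zero (s : ℂ) : heatFlow s (X ^ 0) = 1 := by simp [heatFlow]

open Polynomial in
theorem heatFlow_X_pow_one (s : ℂ) : heatFlow s (X ^ 1) = X := by
  simp [heatFlow, Finset.sum_range_succ]

open Polynomial in
theorem natDegree_poly_le (a : ℕ → ℕ → ℂ) (x : ℕ → ℂ) (n : ℕ) : (poly a x n).natDegree ≤ n := by
  unfold poly
  refine natDegree_sum_le_of_forall_le _ _ fun k hk => ?_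
  exact (natDegree_C_mul_X_pow_le _ _).trans (by simpa [Nat.lt_succ_iff] using hk)

open Polynomial in
theorem heatPoly_eq_sum (a : ℕ → ℕ → ℂ) (x : ℕ → ℂ) (t : ℂ) (n : ℕ) :
    heatPoly a x t n = ∑ k ∈ Finset.range (n + 1),
      C (x k * a n k) * heatFlow (t / n) (X ^ k) := by
  unfold heatPoly
  rw [heatFlow_eq_sum _ _ (Nat.succ_le_succ (natDegree_poly_le a x n))]
  have h : ∀ k ∈ Finset.range (n + 1), heatFlow (t / n) (X ^ k) =
      ∑ j ∈ Finset.range n.succ, C ((j.factorial : ℂ)⁻¹ * (-(t / n / 2)) ^ j) *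
        (derivative^[2 * j] (X ^ k)) := fun k hk => by
    rw [heatFlow_eq_sum]
    simpa [Nat.lt_succ_iff] using hk
  have h' : ∀ k ∈ Finset.range (n + 1), C (x k * a n k) * heatFlow (t / n) (X ^ k) =
      ∑ j ∈ Finset.range n.succ, C (x k * a n k) *
        (C ((j.factorial : ℂ)⁻¹ * (-(t / n / 2)) ^ j) * (derivative^[2 * j] (X ^ k))) :=
    fun k hk => by rw [h k hk, Finset.mul_sum]
  rw [Finset.sum_congr rfl h', Finset.sum_comm]
  refine Finset.sum_congr rfl fun j _ => ?_
  rw [poly, iterate_derivative_sum, Finset.mul_sum]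
  refine Finset.sum_congr rfl fun k _ => ?_
  rw [iterate_derivative_C_mul]
  ring

open Polynomial in
theorem natDegree_heatFlow (s : ℂ) (p : ℂ[X]) : (heatFlow s p).natDegree = p.natDegree := by
  by_cases hp0 : p.natDegree = 0
  · rw [eq_C_of_natDegree_eq_zero hp0]
    simp [heatFlow]
  unfold heatFlow
  rw [Finset.sum_range_succ']
  simp only [mul_zero, Function.iterate_zero, id_eq, Nat.factorial_zero, Nat.cast_one, inv_one,
    pow_zero, mul_one, C_1, one_mul]
  apply natDegree_add_eq_right_of_natDegree_lt
  refine lt_of_le_of_lt (natDegree_sum_le_of_forall_le (n := p.natDegree - 1) _ _ fun j _ => ?_) (by omega)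
  refine (natDegree_C_mul_le _ _).trans ((natDegree_iterate_derivative _ _).trans ?_)
  omega

open Polynomial in
theorem natDegree_heatPoly {a : ℕ → ℕ → ℂ} {x : ℕ → ℂ} (t : ℂ) {n : ℕ} (hx : x n ≠ 0)
    (ha : a n n ≠ 0) : (heatPoly a x t n).natDegree = n := by
  rw [heatPoly, natDegree_heatFlow]
  refine le_antisymm (natDegree_poly_le a x n) (le_natDegree_of_ne_zero ?_)
  rw [poly, finsetSum_coeff]
  simp_rw [coeff_C_mul_X_pow]
  simp [hx, ha]

theorem eval_heatPoly (a : ℕ → ℕ → ℂ) (x : ℕ → ℂ) (t : ℂ) (n : ℕ) (z : ℂ) :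
    (heatPoly a x t n).eval z = ∑ k ∈ Finset.range (n + 1),
      x k * (a n k * (heatFlow (t / n) (Polynomial.X ^ k)).eval z) := by
  rw [heatPoly_eq_sum, Polynomial.eval_finsetSum]
  refine Finset.sum_congr rfl fun k _ => ?_
  rw [Polynomial.eval_mul, Polynomial.eval_C, mul_assoc]

/-! ### The branch `w` and the growth exponent -/

theorem sq_cpow_half (x : ℂ) : (x ^ (1 / 2 : ℂ)) ^ 2 = x := by
  simp

theorem re_cpow_half_nonneg (x : ℂ) : 0 ≤ (x ^ (1 / 2 : ℂ)).re := by
  by_cases hx : x = 0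
  · simp [hx]
  rw [Complex.cpow_def_of_ne_zero hx, Complex.exp_re]
  refine mul_nonneg (Real.exp_pos _).le (Real.cos_nonneg_of_mem_Icc ?_)
  have h : (Complex.log x * (1 / 2)).im = x.arg / 2 := by
    rw [show (1 / 2 : ℂ) = ((1 / 2 : ℝ) : ℂ) by push_cast; rfl, Complex.im_mul_ofReal,
      Complex.log_im]; ring
  rw [h]
  constructor <;> linarith [Complex.neg_pi_lt_arg x, Complex.arg_le_pi x]

theorem re_cpow_half_pos {x : ℂ} (hx : x ∈ Complex.slitPlane) : 0 < (x ^ (1 / 2 : ℂ)).re := by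
  have h0 := Complex.slitPlane_ne_zero hx
  rw [Complex.cpow_def_of_ne_zero h0, Complex.exp_re]
  refine mul_pos (Real.exp_pos _) (Real.cos_pos_of_mem_Ioo ?_)
  have h : (Complex.log x * (1 / 2)).im = x.arg / 2 := by
    rw [show (1 / 2 : ℂ) = ((1 / 2 : ℝ) : ℂ) by push_cast; rfl, Complex.im_mul_ofReal,
      Complex.log_im]; ring
  rw [h]
  have := (Complex.mem_slitPlane_iff_arg.1 hx).1
  have h2 := Complex.arg_le_pi x
  constructor
  · linarith [Complex.neg_pi_lt_arg x]
  · have := lt_of_le_of_ne h2 this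
    linarith

/-- The branch of the solution of `w + t β / w = z` with `w ∼ z` at infinity. -/
noncomputable def wFun (t : ℂ) (β : ℝ) (z : ℂ) : ℂ := (z + branchSqrt (t * β) z) / 2

/-- The exponential growth rate at `z` of the heat-evolved monomial of relative degree `β`. -/
noncomputable def growth (t : ℂ) (β : ℝ) (z : ℂ) : ℝ :=
  β * Real.log ‖wFun t β z‖ + 1 / 2 * (t * β ^ 2 / wFun t β z ^ 2).re

theorem wFun_eq (t : ℂ) (β : ℝ) {z : ℂ} (hz : z ≠ 0) :
    wFun t β z = z * (1 + (1 - 4 * (t * β) / z ^ 2) ^ (1 / 2 : ℂ)) / 2 := by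
  rw [wFun, branchSqrt, if_neg hz]; ring

theorem one_add_cpow_half_ne_zero (x : ℂ) : 1 + x ^ (1 / 2 : ℂ) ≠ 0 := fun h => by
  have := congrArg Complex.re h
  have h2 := re_cpow_half_nonneg x
  simp only [Complex.add_re, Complex.one_re, Complex.zero_re] at this
  linarith

theorem wFun_ne_zero (t : ℂ) (β : ℝ) {z : ℂ} (hz : z ≠ 0) : wFun t β z ≠ 0 := by
  rw [wFun_eq t β hz]
  exact div_ne_zero (mul_ne_zero hz (one_add_cpow_half_ne_zero _)) two_ne_zero

theorem wFun_mul_sub (t : ℂ) (β : ℝ) {z : ℂ} (hz : z ≠ 0) :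
    wFun t β z * (z - wFun t β z) = t * β := by
  rw [wFun_eq t β hz]
  have h := sq_cpow_half (1 - 4 * (t * β) / z ^ 2)
  set S := (1 - 4 * (t * β) / z ^ 2) ^ (1 / 2 : ℂ)
  calc z * (1 + S) / 2 * (z - z * (1 + S) / 2) = z ^ 2 * (1 - S ^ 2) / 4 := by ring
    _ = t * β := by rw [h]; field_simp; ring

theorem wFun_add_div (t : ℂ) (β : ℝ) {z : ℂ} (hz : z ≠ 0) :
    wFun t β z + t * β / wFun t β z = z := by
  rw [← wFun_mul_sub t β hz, mul_div_cancel_left₀ _ (wFun_ne_zero t β hz)]; ring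

theorem wFun_zero_right (t z : ℂ) : wFun t 0 z = z := by
  by_cases hz : z = 0
  · subst hz
    simp [wFun, branchSqrt]
  · rw [wFun_eq t 0 hz]; simp; ring

theorem wFun_zero_left (β : ℝ) (z : ℂ) : wFun 0 β z = z := by
  have := wFun_zero_right 0 z
  rw [wFun] at *
  simpa using this

/-- The two roots of `w² - z w + tβ = 0` are `z(1 ± S)/2` with product `tβ`, and `|1 - S| < |1 + S|`
exactly when `Re S > 0`. Off the slit `wFun` is thus the strictly dominant root, which makes the
Hermite recursion contracting. -/
theorem norm_mul_lt_norm_wFun_sq {t : ℂ} {β : ℝ} {z : ℂ} (hz : z ≠ 0)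
    (h : 1 - 4 * (t * β) / z ^ 2 ∈ Complex.slitPlane) : ‖t * β‖ < ‖wFun t β z‖ ^ 2 := by
  have hS := re_cpow_half_pos h
  have hlt : ‖z - wFun t β z‖ < ‖wFun t β z‖ := by
    rw [wFun_eq t β hz]
    set S := (1 - 4 * (t * β) / z ^ 2) ^ (1 / 2 : ℂ)
    rw [show z - z * (1 + S) / 2 = z / 2 * (1 - S) by ring,
      show z * (1 + S) / 2 = z / 2 * (1 + S) by ring, norm_mul, norm_mul]
    refine mul_lt_mul_of_pos_left ?_ (norm_pos_iff.2 (div_ne_zero hz two_ne_zero))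
    rw [← sq_lt_sq₀ (norm_nonneg _) (norm_nonneg _), ← Complex.normSq_eq_norm_sq,
      ← Complex.normSq_eq_norm_sq, Complex.normSq_apply, Complex.normSq_apply]
    simp only [Complex.sub_re, Complex.add_re, Complex.one_re, Complex.sub_im, Complex.add_im,
      Complex.one_im]
    nlinarith
  rw [← wFun_mul_sub t β hz, norm_mul, sq]
  exact mul_lt_mul_of_pos_left hlt (norm_pos_iff.2 (wFun_ne_zero t β hz))

/-- Put `ρ² = tβ`. The branch scales as `branchSqrt 1 (z/ρ) = branchSqrt (tβ) z / ρ`. The terms in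
`log |ρ|` cancel, and the algebraic part of `Psi` contributes `β/2 + ½ Re(tβ²/w²)`, whose `β/2` is
removed by the `-½`. -/
theorem fFun_eq_growth (g : ℝ → ℝ) (t : ℂ) {β : ℝ} (hβ : 0 ≤ β) {z : ℂ} (hz : z ≠ 0) :
    fFun g t β z = ((g β + growth t β z : ℝ) : EReal) := by
  unfold fFun
  split_ifs with h0 ht
  · subst h0; simp [growth]
  · subst ht; simp [growth, wFun_zero_left]
  · congr 1
    have hβ0 : 0 < β := lt_of_le_of_ne hβ (Ne.symm h0)
    have hβc : (β : ℂ) ≠ 0 := by exact_mod_cast h0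
    have hρ2 := sq_cpow_half (t * β)
    set ρ := (t * (β : ℂ)) ^ (1 / 2 : ℂ)
    have hρ : ρ ≠ 0 := fun h => by
      rw [h] at hρ2
      exact mul_ne_zero ht hβc (by rw [← hρ2]; ring)
    have hw0 := wFun_ne_zero t β hz
    have hbr : branchSqrt 1 (z / ρ) = branchSqrt (t * β) z / ρ := by
      rw [branchSqrt, branchSqrt, if_neg (div_ne_zero hz hρ), if_neg hz]
      rw [show 4 * 1 / (z / ρ) ^ 2 = 4 * (t * β) / z ^ 2 by rw [← hρ2]; field_simp]
      ring
    have hnorm : Real.log (Real.sqrt (‖t‖ * β)) = Real.log ‖ρ‖ := by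
      congr 1
      rw [Real.sqrt_eq_iff_mul_self_eq (by positivity) (norm_nonneg _), ← norm_mul, ← sq, hρ2,
        norm_mul, Complex.norm_real, Real.norm_of_nonneg hβ]
    have hlog : Real.log ‖(z / ρ + branchSqrt 1 (z / ρ)) / 2‖ =
        Real.log ‖wFun t β z‖ - Real.log ‖ρ‖ := by
      rw [hbr, ← Real.log_div (norm_ne_zero_iff.2 hw0) (norm_ne_zero_iff.2 hρ), ← norm_div, wFun]
      congr 2
      field_simp
    have hre : β * (1 / 4 * ((z / ρ) ^ 2 - z / ρ * branchSqrt 1 (z / ρ)).re) =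
        β / 2 + 1 / 2 * (t * β ^ 2 / wFun t β z ^ 2).re := by
      have e : (β : ℂ) * (1 / 4 * ((z / ρ) ^ 2 - z / ρ * branchSqrt 1 (z / ρ))) =
          ((β / 2 : ℝ) : ℂ) + ((1 / 2 : ℝ) : ℂ) * (t * β ^ 2 / wFun t β z ^ 2) := by
        have hm := wFun_mul_sub t β hz
        have hS : branchSqrt (t * β) z = 2 * wFun t β z - z := by rw [wFun]; ring
        rw [hbr, hS]
        set w := wFun t β z
        have hzw : z = w + t * β / w := (wFun_add_div t β hz).symm
        have e1 : (z / ρ) ^ 2 - z / ρ * ((2 * w - z) / ρ) = 2 * (z * (z - w)) / (t * β) := by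
          rw [← hρ2]; field_simp; ring
        rw [e1, show z - w = t * β / w by rw [hzw]; ring, hzw]
        push_cast
        field_simp
        ring
      have := congrArg Complex.re e
      rw [Complex.re_ofReal_mul, Complex.add_re, Complex.ofReal_re, Complex.re_ofReal_mul] at this
      rw [← this, show (1 / 4 : ℂ) = ((1 / 4 : ℝ) : ℂ) by push_cast; rfl, Complex.re_ofReal_mul]
    rw [Psi, hnorm, hlog, growth]
    linear_combination hre

theorem hasFDerivAt_log_norm {E : Type*} [NormedAddCommGroup E] [NormedSpace ℝ E] {w : E → ℂ}
    {w' : E →L[ℝ] ℂ} {x : E} (hw : HasFDerivAt w w' x) (h0 : w x ≠ 0) :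
    HasFDerivAt (fun y => Real.log ‖w y‖) (Complex.reCLM.comp ((w x)⁻¹ • w')) x := by
  have h1 := (hw.norm_sq.log (by positivity)).const_mul (1 / 2)
  refine (h1.congr_of_eventuallyEq (Eventually.of_forall fun y => ?_)).congr_fderiv ?_
  · simp only [Real.log_pow]; push_cast; ring
  · ext v
    have hn : ‖w x‖ ^ 2 ≠ 0 := by positivity
    simp only [_root_.smul_apply, ContinuousLinearMap.comp_apply, innerSL_apply_apply,
      Complex.inner, smul_eq_mul, Complex.reCLM_apply, Complex.inv_def, nsmul_eq_mul]
    rw [Complex.normSq_eq_norm_sq, mul_right_comm, Complex.re_mul_ofReal,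
      mul_comm (w' v)]
    push_cast
    field_simp

/-- The differential is `log|w| dA + Re((A/w)(dw + t d(A/w)))`, and the last bracket is `dZ` by the
relation `Z = w + tA/w`. No derivative of `w` survives. With `Z` fixed this gives the derivative in
`β`, with a critical `A` the gradient of the maximal value. -/
theorem hasFDerivAt_growth {E : Type*} [NormedAddCommGroup E] [NormedSpace ℝ E] {t : ℂ}
    {A : E → ℝ} {w Z : E → ℂ} {A' : E →L[ℝ] ℝ} {w' Z' : E →L[ℝ] ℂ} {x : E}
    (hA : HasFDerivAt A A' x) (hw : HasFDerivAt w w' x) (hZ : HasFDerivAt Z Z' x) (h0 : w x ≠ 0)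
    (hrel : ∀ᶠ y in 𝓝 x, Z y = w y + t * A y / w y) :
    HasFDerivAt (fun y => A y * Real.log ‖w y‖ + 1 / 2 * (t * A y ^ 2 / w y ^ 2).re)
      (Real.log ‖w x‖ • A' + Complex.reCLM.comp ((A x / w x : ℂ) • Z')) x := by
  have hinv : HasFDerivAt (fun y => (w y)⁻¹) ((-((w x) ^ 2)⁻¹ : ℂ) • w') x := by
    have := (hasDerivAt_inv h0).complexToReal_fderiv.comp x hw
    refine this.congr_fderiv ?_
    ext v; simp
  have hAc : HasFDerivAt (fun y => (A y : ℂ)) (Complex.ofRealCLM.comp A') x :=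
    Complex.ofRealCLM.hasFDerivAt.comp x hA
  have hq := hAc.mul hinv
  have hZ2 : HasFDerivAt Z _ x :=
    (hw.add (hq.const_mul t)).congr_of_eventuallyEq (hrel.mono fun y hy => by
      simp only [hy, Pi.add_apply, Pi.mul_apply]; ring)
  have hZeq := hZ.unique hZ2
  have hsq := (hq.mul hq).const_mul t
  have hre := (Complex.reCLM.hasFDerivAt.comp x hsq).const_mul (1 / 2)
  have hmain := (hA.mul (hasFDerivAt_log_norm hw h0)).add hre
  refine (hmain.congr_of_eventuallyEq (Eventually.of_forall fun y => ?_)).congr_fderiv ?_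
  · simp only [Pi.add_apply, Pi.mul_apply, Function.comp, Complex.reCLM_apply]
    congr 3
    ring
  · ext v
    rw [hZeq]
    simp only [_root_.add_apply, _root_.smul_apply, smul_eq_mul,
      ContinuousLinearMap.comp_apply, Complex.reCLM_apply, Complex.ofRealCLM_apply, Pi.mul_apply]
    set z := A x * (-(w x ^ 2)⁻¹ * w' v) + (w x)⁻¹ * (A' v : ℂ)
    rw [show t * (A x * (w x)⁻¹ * z + A x * (w x)⁻¹ * z) =
      ((2 : ℝ) : ℂ) * (t * ((A x * (w x)⁻¹) * z)) by push_cast; ring, Complex.re_ofReal_mul,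
      show (A x / w x : ℂ) * (w' v + t * z) = A x * ((w x)⁻¹ * w' v) + t * ((A x * (w x)⁻¹) * z) by
        rw [div_eq_mul_inv]; ring, Complex.add_re, Complex.re_ofReal_mul]
    ring

theorem contDiffAt_cpow_half {x : ℂ} (hx : x ∈ Complex.slitPlane) :
    ContDiffAt ℝ (⊤ : ℕ∞) (fun y : ℂ => y ^ (1 / 2 : ℂ)) x := by
  have h : AnalyticAt ℂ (fun y : ℂ => y ^ (1 / 2 : ℂ)) x :=
    analyticAt_id.cpow analyticAt_const hx
  exact (h.contDiffAt (n := ((⊤ : ℕ∞) : WithTop ℕ∞))).restrict_scalars ℝ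

theorem contDiffAt_wFun {E : Type*} [NormedAddCommGroup E] [NormedSpace ℝ E] {t : ℂ} {x : E}
    {A : E → ℝ} {Z : E → ℂ} {n : ℕ∞} (hA : ContDiffAt ℝ n A x) (hZ : ContDiffAt ℝ n Z x)
    (h0 : Z x ≠ 0) (h : 1 - 4 * (t * A x) / Z x ^ 2 ∈ Complex.slitPlane) :
    ContDiffAt ℝ n (fun y => wFun t (A y) (Z y)) x := by
  have hAc : ContDiffAt ℝ n (fun y => (A y : ℂ)) x := Complex.ofRealCLM.contDiff.contDiffAt.comp x hA
  have hin : ContDiffAt ℝ n (fun y => 1 - 4 * (t * A y) / Z y ^ 2) x := by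
    simp_rw [div_eq_mul_inv]
    exact contDiffAt_const.sub ((contDiffAt_const.mul (contDiffAt_const.mul hAc)).mul
      ((hZ.pow 2).inv (pow_ne_zero 2 h0)))
  have hS : ContDiffAt ℝ n (fun y => (1 - 4 * (t * A y) / Z y ^ 2) ^ (1 / 2 : ℂ)) x :=
    ContDiffAt.comp (g := fun y : ℂ => y ^ (1 / 2 : ℂ)) x
      ((contDiffAt_cpow_half h).of_le (by exact_mod_cast le_top)) hin
  have hmain : ContDiffAt ℝ n
      (fun y => Z y * (1 + (1 - 4 * (t * A y) / Z y ^ 2) ^ (1 / 2 : ℂ)) / 2) x := by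
    simp_rw [div_eq_mul_inv] at hS ⊢
    exact (hZ.mul (contDiffAt_const.add hS)).mul contDiffAt_const
  refine hmain.congr_of_eventuallyEq ?_
  filter_upwards [hZ.continuousAt.eventually_ne h0] with y hy
  exact wFun_eq t (A y) hy

theorem hasDerivAt_growth {t : ℂ} {β : ℝ} {z : ℂ} (hz : z ≠ 0)
    (h : 1 - 4 * (t * β) / z ^ 2 ∈ Complex.slitPlane) :
    HasDerivAt (fun b : ℝ => growth t b z) (Real.log ‖wFun t β z‖) β := by
  have hw : ContDiffAt ℝ 1 (fun b : ℝ => wFun t b z) β :=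
    contDiffAt_wFun (n := 1) contDiffAt_id contDiffAt_const hz h
  have := hasFDerivAt_growth (t := t) (hasFDerivAt_id β)
    (hw.differentiableAt one_ne_zero).hasFDerivAt (hasFDerivAt_const z β)
    (wFun_ne_zero t β hz) (Eventually.of_forall fun b => (wFun_add_div t b hz).symm)
  have h2 := this.hasDerivAt
  simpa [growth] using h2

/-! ### Exponential asymptotics of the heat-evolved monomials -/

/-- Points at which all the relative degrees in `[0,1]` are off the slit. -/
def offSlit (t : ℂ) : Set ℂ :=
  {z | z ≠ 0 ∧ ∀ β ∈ Icc (0 : ℝ) 1, 1 - 4 * (t * β) / z ^ 2 ∈ Complex.slitPlane}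

theorem continuousOn_wFun_offSlit (t : ℂ) :
    ContinuousOn (fun p : ℝ × ℂ => wFun t p.1 p.2) (Icc (0 : ℝ) 1 ×ˢ offSlit t) := by
  rintro ⟨β, z⟩ ⟨hβ, hz⟩
  have : ContDiffAt ℝ 0 (fun p : ℝ × ℂ => wFun t p.1 p.2) (β, z) :=
    contDiffAt_wFun (n := 0) contDiffAt_fst contDiffAt_snd hz.1 (hz.2 β hβ)
  exact this.continuousAt.continuousWithinAt

/-- Uniform control of `wFun` on compact sets off the slits. -/
theorem exists_wFun_bounds {t : ℂ} {K : Set ℂ} (hK : IsCompact K) (hKt : K ⊆ offSlit t) :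
    ∃ q c : ℝ, 0 < q ∧ q < 1 ∧ 0 < c ∧ ∀ z ∈ K, ∀ β ∈ Icc (0 : ℝ) 1,
      ‖t * β‖ ≤ q * ‖wFun t β z‖ ^ 2 ∧ c ≤ ‖wFun t β z‖ := by
  rcases K.eq_empty_or_nonempty with rfl | hne
  · exact ⟨1 / 2, 1, by norm_num, by norm_num, by norm_num, by simp⟩
  have hS : IsCompact (Icc (0 : ℝ) 1 ×ˢ K) := isCompact_Icc.prod hK
  have hSne : (Icc (0 : ℝ) 1 ×ˢ K).Nonempty := (nonempty_Icc.2 zero_le_one).prod hne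
  have hcont := (continuousOn_wFun_offSlit t).mono (prod_mono_right hKt)
  have hne0 : ∀ p ∈ Icc (0 : ℝ) 1 ×ˢ K, ‖wFun t p.1 p.2‖ ≠ 0 := fun p hp =>
    norm_ne_zero_iff.2 (wFun_ne_zero _ _ (hKt hp.2).1)
  obtain ⟨p, hp, hpm⟩ := hS.exists_isMinOn hSne hcont.norm
  have hq : ContinuousOn (fun p : ℝ × ℂ => ‖t * p.1‖ / ‖wFun t p.1 p.2‖ ^ 2)
      (Icc (0 : ℝ) 1 ×ˢ K) :=
    ContinuousOn.div (by fun_prop) (hcont.norm.pow 2) fun p hp => pow_ne_zero 2 (hne0 p hp)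
  obtain ⟨r, hr, hrm⟩ := hS.exists_isMaxOn hSne hq
  have hr1 : ‖t * r.1‖ / ‖wFun t r.1 r.2‖ ^ 2 < 1 := by
    rw [div_lt_one (by have := hne0 r hr; positivity)]
    exact norm_mul_lt_norm_wFun_sq (hKt hr.2).1 ((hKt hr.2).2 _ hr.1)
  have hr0 : 0 ≤ ‖t * r.1‖ / ‖wFun t r.1 r.2‖ ^ 2 := by positivity
  refine ⟨(1 + ‖t * r.1‖ / ‖wFun t r.1 r.2‖ ^ 2) / 2, ‖wFun t p.1 p.2‖, by linarith, by linarith,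
    lt_of_le_of_ne (norm_nonneg _) (hne0 p hp).symm, fun z hz β hβ => ⟨?_, hpm (show (β, z) ∈ Icc (0 : ℝ) 1 ×ˢ K from ⟨hβ, hz⟩)⟩⟩
  have h1 : ‖t * β‖ / ‖wFun t β z‖ ^ 2 ≤ ‖t * r.1‖ / ‖wFun t r.1 r.2‖ ^ 2 :=
    hrm (show (β, z) ∈ Icc (0 : ℝ) 1 ×ˢ K from ⟨hβ, hz⟩)
  have h2 : 0 < ‖wFun t β z‖ ^ 2 := by
    have := hne0 (β, z) ⟨hβ, hz⟩
    positivity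
  rw [← div_le_iff₀ h2]
  linarith

theorem exists_wFun_modulus {t : ℂ} {K : Set ℂ} (hK : IsCompact K) (hKt : K ⊆ offSlit t)
    {δ : ℝ} (hδ : 0 < δ) : ∃ η > 0, ∀ z ∈ K, ∀ β ∈ Icc (0 : ℝ) 1, ∀ γ ∈ Icc (0 : ℝ) 1,
      |β - γ| < η → ‖wFun t β z - wFun t γ z‖ ≤ δ := by
  have hS : IsCompact (Icc (0 : ℝ) 1 ×ˢ K) := isCompact_Icc.prod hK
  have hcont := (continuousOn_wFun_offSlit t).mono (prod_mono_right hKt)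
  obtain ⟨η, hη, h⟩ := Metric.uniformContinuousOn_iff.1
    (hS.uniformContinuousOn_of_continuous hcont) δ hδ
  refine ⟨η, hη, fun z hz β hβ γ hγ hd => ?_⟩
  have := h (β, z) ⟨hβ, hz⟩ (γ, z) ⟨hγ, hz⟩ (by simpa [Prod.dist_eq, Real.dist_eq] using hd)
  rw [dist_eq_norm] at this
  exact this.le

/-- The heat-evolved monomials at scale `t / n`. -/
noncomputable def hermite (t : ℂ) (n k : ℕ) (z : ℂ) : ℂ :=
  (heatFlow (t / n) (Polynomial.X ^ k)).eval z

theorem hermite_zero (t : ℂ) (n : ℕ) (z : ℂ) : hermite t n 0 z = 1 := by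
  rw [hermite, heatFlow_X_pow_zero]; simp

theorem hermite_one (t : ℂ) (n : ℕ) (z : ℂ) : hermite t n 1 z = z := by
  rw [hermite, heatFlow_X_pow_one]; simp

theorem hermite_succ_succ (t : ℂ) (n k : ℕ) (z : ℂ) :
    hermite t n (k + 2) z = z * hermite t n (k + 1) z -
      t * (((k + 1 : ℕ) / n : ℝ) : ℂ) * hermite t n k z := by
  rw [hermite, heatFlow_X_pow_succ_succ]
  simp only [hermite, Polynomial.eval_sub, Polynomial.eval_mul, Polynomial.eval_X,
    Polynomial.eval_C]
  push_cast
  ring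

theorem abs_log_sub_log_le {a b c : ℝ} (hc : 0 < c) (ha : c ≤ a) (hb : c ≤ b) :
    |Real.log a - Real.log b| ≤ |a - b| / c := by
  have key : ∀ x y : ℝ, c ≤ x → c ≤ y → Real.log x - Real.log y ≤ |x - y| / c := by
    intro x y hx hy
    have hy0 : 0 < y := hc.trans_le hy
    rw [← Real.log_div (hc.trans_le hx).ne' hy0.ne']
    calc Real.log (x / y) ≤ x / y - 1 := Real.log_le_sub_one_of_pos (div_pos (hc.trans_le hx) hy0)
      _ = (x - y) / y := by field_simp
      _ ≤ |x - y| / y := by gcongr; exact le_abs_self _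
      _ ≤ |x - y| / c := by gcongr
  rw [abs_le]
  refine ⟨?_, key a b ha hb⟩
  have := key b a hb ha
  rw [abs_sub_comm] at this
  linarith

/-- The ratio of consecutive heat-evolved monomials follows the branch `wFun`. -/
theorem norm_hermite_succ_sub_le {t : ℂ} {n : ℕ} {z : ℂ} {q c e δ : ℝ} (hz : z ≠ 0) (hn : 0 < n)
    (hq0 : 0 < q) (hq1 : q < 1) (hc : 0 < c) (he : 0 < e) (hec : e ≤ c * (1 - q) / 4)
    (hδ : δ ≤ e * (1 - q) / 4)
    (hb : ∀ β ∈ Icc (0 : ℝ) 1, ‖t * β‖ ≤ q * ‖wFun t β z‖ ^ 2 ∧ c ≤ ‖wFun t β z‖)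
    (hm : ∀ k < n, ‖wFun t ((k + 1 : ℕ) / n : ℝ) z - wFun t (k / n : ℝ) z‖ ≤ δ) {k : ℕ} (hk : k ≤ n) :
    hermite t n k z ≠ 0 ∧
      ‖hermite t n (k + 1) z - wFun t (k / n : ℝ) z * hermite t n k z‖ ≤ e * ‖hermite t n k z‖ := by
  have hnr : (0 : ℝ) < n := by exact_mod_cast hn
  induction k with
  | zero =>
    refine ⟨by rw [hermite_zero]; exact one_ne_zero, ?_⟩
    rw [hermite_one, hermite_zero]
    simp [wFun_zero_right, he.le]
  | succ k ih =>
    obtain ⟨h0, h1⟩ := ih (by omega)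
    have hβ : ((k + 1 : ℕ) / n : ℝ) ∈ Icc (0 : ℝ) 1 :=
      ⟨by positivity, (div_le_one hnr).2 (by exact_mod_cast hk)⟩
    have hβ' : (k / n : ℝ) ∈ Icc (0 : ℝ) 1 :=
      ⟨by positivity, (div_le_one hnr).2 (by exact_mod_cast (by omega : k ≤ n))⟩
    obtain ⟨hq, hcw⟩ := hb _ hβ
    set w := wFun t ((k + 1 : ℕ) / n : ℝ) z with hw
    set H := hermite t n k z
    set H1 := hermite t n (k + 1) z
    have hw0 : w ≠ 0 := wFun_ne_zero _ _ hz
    have hH : 0 < ‖H‖ := norm_pos_iff.2 h0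
    have hd : ‖H1 - w * H‖ ≤ (e + δ) * ‖H‖ := by
      calc ‖H1 - w * H‖ = ‖(H1 - wFun t (k / n : ℝ) z * H) - (w - wFun t (k / n : ℝ) z) * H‖ := by
            ring_nf
        _ ≤ e * ‖H‖ + δ * ‖H‖ := by
            refine (norm_sub_le _ _).trans (add_le_add h1 ?_)
            rw [norm_mul]
            exact mul_le_mul_of_nonneg_right (hm k (by omega)) hH.le
        _ = _ := by ring
    have hlow : (‖w‖ - (e + δ)) * ‖H‖ ≤ ‖H1‖ := by
      have := norm_sub_le (w * H) (w * H - H1)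
      rw [sub_sub_cancel] at this
      have h3 : ‖w * H‖ ≤ ‖H1‖ + ‖H1 - w * H‖ := by
        calc ‖w * H‖ = ‖H1 - (H1 - w * H)‖ := by ring_nf
          _ ≤ _ := norm_sub_le _ _
      rw [norm_mul] at h3
      nlinarith
    have h1q : 0 < 1 - q := by linarith
    have hed : e + δ ≤ c * (1 - q) / 2 := by
      have : e * (1 - q) ≤ e * 1 := mul_le_mul_of_nonneg_left (by linarith) he.le
      linarith
    have hpos : 0 < ‖w‖ - (e + δ) := by
      have : c * (1 - q) ≤ c * 1 := mul_le_mul_of_nonneg_left (by linarith) hc.le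
      linarith
    have hH1 : 0 < ‖H1‖ := lt_of_lt_of_le (mul_pos hpos hH) hlow
    refine ⟨norm_pos_iff.1 hH1, ?_⟩
    -- Since `z - w = tβ/w`, one step of the recursion multiplies the deviation from `w` by `tβ/w`,
    -- of modulus at most `q|w|`, while the polynomial itself grows by about `|w|`. The relative
    -- deviation contracts by about `q`.
    have hrel : hermite t n (k + 1 + 1) z - w * H1 =
        t * (((k + 1 : ℕ) / n : ℝ) : ℂ) / w * (H1 - w * H) := by
      rw [hermite_succ_succ]
      have := wFun_add_div t ((k + 1 : ℕ) / n : ℝ) hz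
      rw [← hw] at this
      nth_rewrite 1 [← this]
      field_simp
      ring
    rw [hrel, norm_mul, norm_div]
    have hwpos : 0 < ‖w‖ := norm_pos_iff.2 hw0
    -- The contraction absorbs both the displacement `δ` of `w` between consecutive degrees and the
    -- loss `e + δ` in the lower bound for the growth factor.
    have hstep : q * ‖w‖ * (e + δ) ≤ e * (‖w‖ - (e + δ)) := by
      have a1 : q * ‖w‖ * (e + δ) ≤ q * ‖w‖ * (e + e * (1 - q) / 4) := by gcongr
      have a2 : e * (‖w‖ - ‖w‖ * (1 - q) / 2) ≤ e * (‖w‖ - (e + δ)) := by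
        have : c * (1 - q) ≤ ‖w‖ * (1 - q) := by gcongr
        gcongr
        linarith
      have a3 : 0 ≤ e * ‖w‖ * ((1 - q) * (2 - q)) := by
        have : 0 < 2 - q := by linarith
        positivity
      nlinarith
    calc ‖t * (((k + 1 : ℕ) / n : ℝ) : ℂ)‖ / ‖w‖ * ‖H1 - w * H‖
        ≤ (q * ‖w‖ ^ 2) / ‖w‖ * ((e + δ) * ‖H‖) := by gcongr
      _ = q * ‖w‖ * (e + δ) * ‖H‖ := by field_simp
      _ ≤ e * (‖w‖ - (e + δ)) * ‖H‖ := by gcongr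
      _ ≤ e * ‖H1‖ := by rw [mul_assoc]; gcongr

/-- Locally uniform exponential asymptotics of the heat-evolved monomials off the slits. -/
theorem hermite_asymptotics {t : ℂ} {K : Set ℂ} (hK : IsCompact K) (hKt : K ⊆ offSlit t)
    {ε : ℝ} (hε : 0 < ε) : ∃ N : ℕ, ∀ n : ℕ, N ≤ n → ∀ k ≤ n, ∀ z ∈ K,
      hermite t n k z ≠ 0 ∧ |Real.log ‖hermite t n k z‖ - n * growth t (k / n) z| ≤ ε * n := by
  obtain ⟨q, c, hq0, hq1, hc, hb⟩ := exists_wFun_bounds hK hKt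
  have h1q : 0 < 1 - q := by linarith
  -- The first bound keeps the recursion contracting. The second makes the logarithmic error per
  -- step `2e/(c/2)` at most `ε`.
  obtain ⟨e, he, hec, heε⟩ : ∃ e : ℝ, 0 < e ∧ e ≤ c * (1 - q) / 4 ∧ e ≤ c * ε / 4 :=
    ⟨min (c * (1 - q) / 4) (c * ε / 4), by positivity, min_le_left _ _, min_le_right _ _⟩
  have hδ0 : 0 < e * (1 - q) / 4 := by positivity
  obtain ⟨η, hη, hmod⟩ := exists_wFun_modulus hK hKt hδ0
  obtain ⟨N, hN⟩ := exists_nat_gt (1 / η)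
  refine ⟨N + 1, fun n hn k hk z hz => ?_⟩
  have hn0 : 0 < n := by omega
  have hnr : (0 : ℝ) < n := by exact_mod_cast hn0
  have hz0 := (hKt hz).1
  have hinv : 1 / (n : ℝ) < η := by
    rw [div_lt_iff₀ hnr]
    rw [div_lt_iff₀ hη] at hN
    have : (N : ℝ) ≤ n := by exact_mod_cast (by omega : N ≤ n)
    nlinarith
  have hmem : ∀ j ≤ n, (j / n : ℝ) ∈ Icc (0 : ℝ) 1 := fun j hj =>
    ⟨by positivity, (div_le_one hnr).2 (by exact_mod_cast hj)⟩
  have hsub : ∀ j : ℕ, ((j + 1 : ℕ) / n : ℝ) - j / n = 1 / n := fun j => by push_cast; ring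
  have hm : ∀ j < n, ‖wFun t ((j + 1 : ℕ) / n : ℝ) z - wFun t (j / n : ℝ) z‖ ≤ e * (1 - q) / 4 :=
    fun j hj => hmod z hz _ (hmem _ hj) _ (hmem _ hj.le) (by
      rw [hsub, abs_of_pos (by positivity)]; exact hinv)
  have hrat := fun {j : ℕ} (hj : j ≤ n) => norm_hermite_succ_sub_le hz0 hn0 hq0 hq1 hc he hec le_rfl
    (hb z hz) hm hj
  refine ⟨(hrat hk).1, ?_⟩
  have hec2 : e ≤ c / 4 := by nlinarith
  have hstep : ∀ j < n, |Real.log ‖hermite t n (j + 1) z‖ - Real.log ‖hermite t n j z‖ -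
      n * (growth t ((j + 1 : ℕ) / n) z - growth t (j / n) z)| ≤ ε := by
    intro j hj
    obtain ⟨h0, h1⟩ := hrat hj.le
    have h2 := (hrat hj).1
    have hlt : (j / n : ℝ) < ((j + 1 : ℕ) / n : ℝ) := by
      have := hsub j
      have : 0 < 1 / (n : ℝ) := by positivity
      linarith
    have hsubI : Icc (j / n : ℝ) ((j + 1 : ℕ) / n : ℝ) ⊆ Icc 0 1 :=
      Icc_subset_Icc (hmem j hj.le).1 (hmem (j + 1) hj).2
    have hder : ∀ x ∈ Icc (j / n : ℝ) ((j + 1 : ℕ) / n : ℝ),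
        HasDerivAt (fun b : ℝ => growth t b z) (Real.log ‖wFun t x z‖) x := fun x hx =>
      hasDerivAt_growth hz0 ((hKt hz).2 x (hsubI hx))
    -- By the mean value theorem, `n` times the increment of `growth` over a step `1/n` is `log |w|`
    -- at an intermediate degree, so the logarithms of the ratios telescope to `n * growth`.
    obtain ⟨x, hx, hxs⟩ := exists_hasDerivAt_eq_slope (fun b : ℝ => growth t b z)
      (fun x => Real.log ‖wFun t x z‖) hlt
      (fun x hx => (hder x hx).continuousAt.continuousWithinAt)
      (fun x hx => hder x (Ioo_subset_Icc_self hx))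
    rw [hsub] at hxs
    have hxs' : n * (growth t ((j + 1 : ℕ) / n) z - growth t (j / n) z) =
        Real.log ‖wFun t x z‖ := by
      rw [hxs]; field_simp
    rw [hxs', ← Real.log_div (norm_ne_zero_iff.2 h2) (norm_ne_zero_iff.2 h0), ← norm_div]
    have hr : ‖hermite t n (j + 1) z / hermite t n j z - wFun t (j / n : ℝ) z‖ ≤ e := by
      rw [div_sub' h0, norm_div, div_le_iff₀ (norm_pos_iff.2 h0), mul_comm (hermite t n j z)]
      exact h1
    have hcx := (hb z hz x (hsubI (Ioo_subset_Icc_self hx))).2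
    have hcj := (hb z hz _ (hmem j hj.le)).2
    have hxw : ‖wFun t (j / n : ℝ) z - wFun t x z‖ ≤ e := by
      refine (hmod z hz _ (hmem j hj.le) x (hsubI (Ioo_subset_Icc_self hx)) ?_).trans ?_
      · rw [abs_sub_comm, abs_of_pos (by linarith [hx.1])]
        have := hsub j
        linarith [hx.2]
      · nlinarith
    set r := hermite t n (j + 1) z / hermite t n j z
    have htot : |‖r‖ - ‖wFun t x z‖| ≤ 2 * e := by
      refine (abs_norm_sub_norm_le _ _).trans ?_
      calc ‖r - wFun t x z‖ = ‖(r - wFun t (j / n : ℝ) z) + (wFun t (j / n : ℝ) z - wFun t x z)‖ := by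
            ring_nf
        _ ≤ e + e := (norm_add_le _ _).trans (add_le_add hr hxw)
        _ = 2 * e := by ring
    have hrl : c / 2 ≤ ‖r‖ := by
      have := (abs_le.1 htot).1
      linarith
    calc |Real.log ‖r‖ - Real.log ‖wFun t x z‖| ≤ |‖r‖ - ‖wFun t x z‖| / (c / 2) :=
          abs_log_sub_log_le (by positivity) hrl (by linarith)
      _ ≤ 2 * e / (c / 2) := by gcongr
      _ ≤ ε := by
          rw [div_le_iff₀ (by positivity)]
          linarith
  have hind : ∀ j ≤ n, |Real.log ‖hermite t n j z‖ - n * growth t (j / n) z| ≤ ε * j := by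
    intro j
    induction j with
    | zero => intro _; simp [hermite_zero, growth]
    | succ j ih =>
      intro hj
      have h1 := ih (by omega)
      have h2 := hstep j (by omega)
      have h3 := abs_add_le (Real.log ‖hermite t n j z‖ - n * growth t (j / n) z)
        (Real.log ‖hermite t n (j + 1) z‖ - Real.log ‖hermite t n j z‖ -
          n * (growth t ((j + 1 : ℕ) / n) z - growth t (j / n) z))
      have h4 : (ε * (j + 1 : ℕ) : ℝ) = ε * j + ε := by push_cast; ring
      rw [h4]
      refine le_trans (le_of_eq ?_) (h3.trans (add_le_add h1 h2))
      congr 1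
      ring
  refine (hind k hk).trans ?_
  gcongr

/-! ### Tails and anti-concentration of the random coefficients -/

section Probability

variable {Ω : Type*} [MeasurableSpace Ω] {P : Measure Ω}

/-- The union bound gives `(n + 1) P(X > εn)` with `X = log(1 + |ξ_0|)`. This is the expectation of
`(n + 1) 1_{X > εn}`, which tends to `0` pointwise and is dominated by the integrable `X/ε + 1`. -/
theorem tendsto_measure_exists_exp_lt [IsProbabilityMeasure P] {ξ : ℕ → Ω → ℂ} (h : CondA1 P ξ)
    {ε : ℝ} (hε : 0 < ε) :
    Tendsto (fun n : ℕ => P {ω | ∃ k ≤ n, Real.exp (ε * n) < ‖ξ k ω‖}) atTop (𝓝 0) := by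
  set X : Ω → ℝ := fun ω => Real.log (1 + ‖ξ 0 ω‖) with hX
  have hXm : Measurable X := Real.measurable_log.comp ((h.measurable 0).norm.const_add 1)
  have hX0 : ∀ ω, 0 ≤ X ω := fun ω => Real.log_nonneg (by linarith [norm_nonneg (ξ 0 ω)])
  have hset : ∀ n : ℕ, MeasurableSet {ω | ε * n < X ω} := fun n =>
    measurableSet_lt measurable_const hXm
  have hlim : Tendsto (fun n : ℕ => ∫⁻ ω, {ω | ε * n < X ω}.indicator
      (fun _ => ((n + 1 : ℕ) : ℝ≥0∞)) ω ∂P) atTop (𝓝 (∫⁻ _, 0 ∂P)) := by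
    refine tendsto_lintegral_of_dominated_convergence
      (fun ω => ENNReal.ofReal (X ω / ε + 1)) (fun n => measurable_const.indicator (hset n))
      (fun n => Eventually.of_forall fun ω => ?_) ?_ (Eventually.of_forall fun ω => ?_)
    · by_cases hω : ω ∈ {ω | ε * n < X ω}
      · simp only [indicator_of_mem hω]
        rw [← ENNReal.ofReal_natCast]
        refine ENNReal.ofReal_le_ofReal ?_
        push_cast
        have : (n : ℝ) ≤ X ω / ε := by
          rw [le_div_iff₀ hε, mul_comm]; exact (show ε * n < X ω from hω).le
        linarith
      · simp [indicator_of_notMem hω]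
    · have hi : Integrable (fun ω => X ω / ε + 1) P :=
        (h.integrable_log.div_const ε).add (integrable_const 1)
      exact hi.lintegral_lt_top.ne
    · refine tendsto_const_nhds.congr' ?_
      obtain ⟨N, hN⟩ := exists_nat_gt (X ω / ε)
      filter_upwards [eventually_ge_atTop N] with n hn
      rw [indicator_of_notMem]
      simp only [mem_ofPred_eq, not_lt]
      rw [div_lt_iff₀ hε] at hN
      have : (N : ℝ) ≤ n := by exact_mod_cast hn
      nlinarith
  rw [lintegral_zero] at hlim
  refine tendsto_of_tendsto_of_tendsto_of_le_of_le tendsto_const_nhds hlim (fun _ => zero_le)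
    fun n => ?_
  have hk : ∀ k, P {ω | Real.exp (ε * n) < ‖ξ k ω‖} ≤ P {ω | ε * n < X ω} := by
    intro k
    have hm : MeasurableSet {x : ℂ | Real.exp (ε * n) < ‖x‖} :=
      measurableSet_lt measurable_const measurable_norm
    have := (h.identDistrib k).measure_mem_eq hm
    simp only [preimage_ofPred_eq] at this
    rw [this]
    refine measure_mono fun ω hω => ?_
    simp only [mem_ofPred_eq] at hω ⊢
    rw [hX, Real.lt_log_iff_exp_lt (by positivity)]
    linarith
  rw [lintegral_indicator_const (hset n)]
  calc P {ω | ∃ k ≤ n, Real.exp (ε * n) < ‖ξ k ω‖}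
      ≤ P (⋃ k ∈ Finset.range (n + 1), {ω | Real.exp (ε * n) < ‖ξ k ω‖}) := by
        refine measure_mono fun ω hω => ?_
        obtain ⟨k, hk, h⟩ := hω
        simp only [mem_iUnion, Finset.mem_range]
        exact ⟨k, by omega, h⟩
    _ ≤ ∑ k ∈ Finset.range (n + 1), P {ω | Real.exp (ε * n) < ‖ξ k ω‖} :=
        measure_biUnion_finset_le _ _
    _ ≤ ∑ k ∈ Finset.range (n + 1), P {ω | ε * n < X ω} := Finset.sum_le_sum fun k _ => hk k
    _ = _ := by simp

/-- A law that is not a Dirac mass leaves some mass outside every small disc. -/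
theorem exists_anticoncentration [IsProbabilityMeasure P] {X : Ω → ℂ} (hX : Measurable X)
    (hnd : ¬ ∃ c : ℂ, ∀ᵐ ω ∂P, X ω = c) :
    ∃ ρ : ℝ, 0 < ρ ∧ ∃ p : ℝ≥0∞, 0 < p ∧ ∀ x : ℂ, p ≤ P.map X {y | ρ ≤ ‖y - x‖} := by
  have hprob : IsProbabilityMeasure (P.map X) := Measure.isProbabilityMeasure_map hX.aemeasurable
  -- Two distinct points of the support suffice: every `x` is at distance at least `|a - b|/2` from
  -- one of them, hence far from a small disc around it, and that disc has positive mass.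
  obtain ⟨a, b, hab, ha, hb⟩ : ∃ a b : ℂ, a ≠ b ∧ (∀ s ∈ 𝓝 a, 0 < P.map X s) ∧
      ∀ s ∈ 𝓝 b, 0 < P.map X s := by
    obtain ⟨a, -, ha⟩ := exists_mem_forall_mem_nhdsWithin_pos_measure (μ := P.map X) (s := univ)
      (by simp)
    have hne : P.map X {a}ᶜ ≠ 0 := fun h0 => hnd ⟨a, by
      rw [Measure.map_apply hX (measurableSet_singleton a).compl] at h0
      exact h0⟩
    obtain ⟨b, hba, hb⟩ := exists_mem_forall_mem_nhdsWithin_pos_measure hne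
    rw [isOpen_compl_singleton.nhdsWithin_eq hba] at hb
    rw [nhdsWithin_univ] at ha
    exact ⟨a, b, Ne.symm hba, ha, hb⟩
  have hd : 0 < dist a b := dist_pos.2 hab
  refine ⟨dist a b / 4, by positivity, min (P.map X (Metric.ball a (dist a b / 4)))
    (P.map X (Metric.ball b (dist a b / 4))), lt_min (ha _ (Metric.ball_mem_nhds _ (by positivity)))
      (hb _ (Metric.ball_mem_nhds _ (by positivity))), fun x => ?_⟩
  by_cases hx : dist a b / 2 ≤ dist x a
  · refine (min_le_left _ _).trans (measure_mono fun y hy => ?_)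
    rw [Metric.mem_ball] at hy
    rw [mem_ofPred_eq, ← dist_eq_norm]
    have := dist_triangle_left x a y
    linarith
  · refine (min_le_right _ _).trans (measure_mono fun y hy => ?_)
    rw [Metric.mem_ball] at hy
    rw [mem_ofPred_eq, ← dist_eq_norm]
    have h1 := dist_triangle_left a b x
    have h2 := dist_triangle_left x b y
    linarith

/-- A random linear combination is rarely much smaller than one of its terms, even jointly with
the non-vanishing of another coefficient. -/
theorem exists_pos_le_measure_norm_sum [IsProbabilityMeasure P] {ξ : ℕ → Ω → ℂ} (h : CondA1 P ξ) :
    ∃ ρ : ℝ, 0 < ρ ∧ ∃ p : ℝ≥0∞, 0 < p ∧ ∀ (n k : ℕ), k < n → ∀ c : ℕ → ℂ,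
      p ≤ P {ω | ξ n ω ≠ 0 ∧ ρ * ‖c k‖ ≤ ‖∑ j ∈ Finset.range (n + 1), ξ j ω * c j‖} := by
  obtain ⟨ρ, hρ, p, hp, hanti⟩ := exists_anticoncentration (h.measurable 0) h.nondegenerate
  have hp' : 0 < P {ω | ξ 0 ω ≠ 0} := by
    rw [pos_iff_ne_zero]
    exact fun h0 => h.nondegenerate ⟨0, h0⟩
  refine ⟨ρ, hρ, p * P {ω | ξ 0 ω ≠ 0}, ENNReal.mul_pos hp.ne' hp'.ne', fun n k hk c => ?_⟩
  -- All coefficients except `ξ_k` are frozen. As `k < n`, the event `ξ_n ≠ 0` is among the frozen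
  -- data, and anti-concentration of `ξ_k` applies conditionally with centre `-R/c_k`.
  set S : Finset ℕ := (Finset.range (n + 1)).erase k with hS
  have hnS : n ∈ S := by simp [hS]; omega
  set Y : Ω → S → ℂ := fun ω i => ξ i ω
  have hY : Measurable Y := measurable_pi_lambda _ fun i => h.measurable i
  have hind : IndepFun Y (ξ k) P := by
    have := (h.indep.indepFun_finset S {k} (by simp [hS]) h.measurable).comp measurable_id
      (measurable_pi_apply (⟨k, Finset.mem_singleton_self k⟩ : ({k} : Finset ℕ)))
    exact this
  have hprob : IsProbabilityMeasure (P.map (ξ k)) :=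
    Measure.isProbabilityMeasure_map (h.measurable k).aemeasurable
  have hprob2 : IsProbabilityMeasure (P.map Y) := Measure.isProbabilityMeasure_map hY.aemeasurable
  rw [indepFun_iff_map_prod_eq_prod_map_map hY.aemeasurable (h.measurable k).aemeasurable] at hind
  set R : (S → ℂ) → ℂ := fun y => ∑ j : S, y j * c j
  have hR : Measurable R := Finset.measurable_sum _ fun j _ => (measurable_pi_apply j).mul_const _
  set B : Set ((S → ℂ) × ℂ) :=
    {q | q.1 ⟨n, hnS⟩ ≠ 0 ∧ ρ * ‖c k‖ ≤ ‖q.2 * c k + R q.1‖}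
  have hB : MeasurableSet B := by
    have h1 : MeasurableSet {q : (S → ℂ) × ℂ | q.1 ⟨n, hnS⟩ ≠ 0} :=
      ((measurable_pi_apply _).comp measurable_fst) (measurableSet_singleton 0).compl
    have h2 : MeasurableSet {q : (S → ℂ) × ℂ | ρ * ‖c k‖ ≤ ‖q.2 * c k + R q.1‖} :=
      measurableSet_le measurable_const
        ((measurable_snd.mul_const _).add (hR.comp measurable_fst)).norm
    exact h1.inter h2
  have hev : {ω | ξ n ω ≠ 0 ∧ ρ * ‖c k‖ ≤ ‖∑ j ∈ Finset.range (n + 1), ξ j ω * c j‖} =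
      (fun ω => (Y ω, ξ k ω)) ⁻¹' B := by
    ext ω
    have : ∑ j ∈ Finset.range (n + 1), ξ j ω * c j = ξ k ω * c k + R (Y ω) := by
      rw [← Finset.add_sum_erase _ _ (Finset.mem_range.2 (by omega : k < n + 1))]
      congr 1
      exact (Finset.sum_coe_sort S fun j => ξ j ω * c j).symm
    simp only [mem_ofPred_eq, this, mem_preimage, B, Y]
  rw [hev, ← Measure.map_apply (hY.prodMk (h.measurable k)) hB, hind, Measure.prod_apply hB]
  have hN : MeasurableSet {y : S → ℂ | y ⟨n, hnS⟩ ≠ 0} :=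
    (measurable_pi_apply _) (measurableSet_singleton 0).compl
  have hlaw : P.map (ξ k) = P.map (ξ 0) := (h.identDistrib k).map_eq
  calc p * P {ω | ξ 0 ω ≠ 0} = p * P.map Y {y : S → ℂ | y ⟨n, hnS⟩ ≠ 0} := by
        rw [Measure.map_apply hY hN]
        congr 1
        exact ((h.identDistrib n).measure_mem_eq (measurableSet_singleton 0).compl).symm
    _ = ∫⁻ y in {y : S → ℂ | y ⟨n, hnS⟩ ≠ 0}, p ∂(P.map Y) := (setLIntegral_const _ _).symm
    _ ≤ ∫⁻ y in {y : S → ℂ | y ⟨n, hnS⟩ ≠ 0}, P.map (ξ k) (Prod.mk y ⁻¹' B) ∂(P.map Y) := by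
        refine setLIntegral_mono' hN fun y hy => ?_
        by_cases hc : c k = 0
        · have : Prod.mk y ⁻¹' B = univ := by
            ext x
            simp only [mem_preimage, B, mem_ofPred_eq, hc, norm_zero, mul_zero, norm_nonneg,
              and_true, mem_univ, iff_true]
            exact hy
          rw [this, measure_univ]
          exact (hanti 0).trans (by rw [← hlaw]; exact prob_le_one)
        · rw [hlaw]
          refine (hanti (-(R y) / c k)).trans (measure_mono fun x hx => ⟨hy, ?_⟩)
          have e : x * c k + R y = (x - -(R y) / c k) * c k := by field_simp; ring
          rw [e, norm_mul]
          exact mul_le_mul_of_nonneg_right hx (norm_nonneg _)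
    _ ≤ _ := setLIntegral_le_lintegral _ _

end Probability

/-! ### Exponential bounds for the heat-evolved polynomial -/

theorem abs_log_norm_coeff_sub_le {a : ℕ → ℕ → ℂ} {g : ℝ → ℝ} (h : CondA2 a g) {ε : ℝ}
    (hε : 0 < ε) : ∀ᶠ n : ℕ in atTop, ∀ k ≤ n, a n k ≠ 0 ∧
      |Real.log ‖a n k‖ - n * g (k / n)| ≤ ε * n := by
  filter_upwards [h.profile ε hε, eventually_gt_atTop 0] with n hn hn0 k hk
  have hnr : (0 : ℝ) < n := by exact_mod_cast hn0
  refine ⟨(hn k hk).1, ?_⟩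
  have h2 := (hn k hk).2
  have e : Real.log ‖a n k‖ - n * g (k / n) = (1 / n * Real.log ‖a n k‖ - g (k / n)) * n := by
    field_simp
  rw [e, abs_mul, abs_of_pos hnr]
  gcongr

theorem tendsto_nat_exp {ε : ℝ} (hε : 0 < ε) :
    ∀ᶠ n : ℕ in atTop, ((n : ℝ) + 1) ≤ Real.exp (ε * n) := by
  have h := (tendsto_pow_const_div_const_pow_of_one_lt 1 (Real.one_lt_exp_iff.2 hε))
  filter_upwards [h.eventually (gt_mem_nhds (by norm_num : (0 : ℝ) < 1 / 2)),
    eventually_ge_atTop 1] with n hn h1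
  rw [pow_one, div_lt_iff₀ (by positivity), ← Real.exp_nat_mul, mul_comm (n : ℝ) ε] at hn
  have : (1 : ℝ) ≤ n := by exact_mod_cast h1
  linarith

/-- Locally uniform exponential upper bound for the heat-evolved polynomial. -/
theorem norm_eval_heatPoly_le {a : ℕ → ℕ → ℂ} {g : ℝ → ℝ} (h : CondA2 a g) {t : ℂ} {K : Set ℂ}
    (hK : IsCompact K) (hKt : K ⊆ offSlit t) {B : ℝ}
    (hB : ∀ z ∈ K, ∀ β ∈ Icc (0 : ℝ) 1, g β + growth t β z ≤ B) {ε : ℝ} (hε : 0 < ε) :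
    ∀ᶠ n : ℕ in atTop, ∀ x : ℕ → ℂ, (∀ k ≤ n, ‖x k‖ ≤ Real.exp (ε * n)) → ∀ z ∈ K,
      ‖(heatPoly a x t n).eval z‖ ≤ Real.exp (n * (B + 4 * ε)) := by
  obtain ⟨N, hN⟩ := hermite_asymptotics hK hKt hε
  filter_upwards [abs_log_norm_coeff_sub_le h hε, tendsto_nat_exp hε, eventually_ge_atTop N,
    eventually_gt_atTop 0] with n ha hexp hnN hn0 x hx z hz
  have hnr : (0 : ℝ) < n := by exact_mod_cast hn0
  rw [eval_heatPoly]
  have hterm : ∀ k ∈ Finset.range (n + 1), ‖x k * (a n k *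
      (heatFlow (t / n) (Polynomial.X ^ k)).eval z)‖ ≤ Real.exp (n * (B + 3 * ε)) := by
    intro k hk
    have hk' : k ≤ n := by simpa [Nat.lt_succ_iff] using hk
    obtain ⟨ha0, ha1⟩ := ha k hk'
    obtain ⟨hh0, hh1⟩ := hN n hnN k hk' z hz
    have hβ : (k / n : ℝ) ∈ Icc (0 : ℝ) 1 :=
      ⟨by positivity, (div_le_one hnr).2 (by exact_mod_cast hk')⟩
    have e1 : ‖a n k‖ ≤ Real.exp (n * g (k / n) + ε * n) := by
      rw [← Real.log_le_iff_le_exp (norm_pos_iff.2 ha0)]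
      linarith [(abs_le.1 ha1).2]
    have e2 : ‖hermite t n k z‖ ≤ Real.exp (n * growth t (k / n) z + ε * n) := by
      rw [← Real.log_le_iff_le_exp (norm_pos_iff.2 hh0)]
      linarith [(abs_le.1 hh1).2]
    have e3 := hB z hz _ hβ
    rw [norm_mul, norm_mul]
    calc ‖x k‖ * (‖a n k‖ * ‖hermite t n k z‖) ≤ Real.exp (ε * n) *
          (Real.exp (n * g (k / n) + ε * n) * Real.exp (n * growth t (k / n) z + ε * n)) := by
          gcongr
          exact hx k hk'
      _ = Real.exp (n * (g (k / n) + growth t (k / n) z) + 3 * ε * n) := by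
          rw [← Real.exp_add, ← Real.exp_add]; congr 1; ring
      _ ≤ Real.exp (n * (B + 3 * ε)) := by
          rw [Real.exp_le_exp]
          have := mul_le_mul_of_nonneg_left e3 hnr.le
          linarith
  calc _ ≤ ∑ k ∈ Finset.range (n + 1), Real.exp (n * (B + 3 * ε)) := norm_sum_le_of_le _ hterm
    _ = ((n : ℝ) + 1) * Real.exp (n * (B + 3 * ε)) := by simp
    _ ≤ Real.exp (ε * n) * Real.exp (n * (B + 3 * ε)) := by gcongr
    _ = _ := by rw [← Real.exp_add]; congr 1; ring

theorem continuousOn_growth {t z : ℂ} (hz : z ∈ offSlit t) :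
    ContinuousOn (fun β : ℝ => growth t β z) (Icc 0 1) := fun β hβ =>
  (hasDerivAt_growth hz.1 (hz.2 β hβ)).continuousAt.continuousWithinAt

/-- Some term of the heat-evolved polynomial has the exponential size prescribed by `α`. -/
theorem exists_large_term {a : ℕ → ℕ → ℂ} {g : ℝ → ℝ} (h : CondA2 a g) {t z : ℂ}
    (hz : z ∈ offSlit t) {α : ℝ} (hα : α ∈ Icc (0 : ℝ) 1) {ρ : ℝ} (hρ : 0 < ρ) {ε : ℝ}
    (hε : 0 < ε) :
    ∀ᶠ n : ℕ in atTop, ∃ k < n,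
      Real.exp (n * (g α + growth t α z - ε)) ≤ ρ * ‖a n k * hermite t n k z‖ := by
  -- One quarter each for the coefficient, the Hermite asymptotics, the continuity of the exponent
  -- in the degree, and the constant `ρ`.
  have hε4 : 0 < ε / 4 := by linarith
  obtain ⟨N, hN⟩ := hermite_asymptotics (isCompact_singleton (x := z))
    (singleton_subset_iff.2 hz) hε4
  have hcont : ContinuousWithinAt (fun β : ℝ => g β + growth t β z) (Icc 0 1) α :=
    (h.continuousOn.add (continuousOn_growth hz)) α hα
  -- Using `n - 1` instead of `n` keeps the index strictly below `n` even for `α = 1`, so that the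
  -- top coefficient stays free to be conditioned on being nonzero.
  have hlim : Tendsto (fun n : ℕ => ((⌊α * ((n : ℝ) - 1)⌋₊ : ℝ) / n)) atTop (𝓝 α) := by
    have h1 : Tendsto (fun n : ℕ => α * ((n : ℝ) - 1) / n) atTop (𝓝 α) := by
      have : Tendsto (fun n : ℕ => α - α * (1 / (n : ℝ))) atTop (𝓝 (α - α * 0)) :=
        tendsto_const_nhds.sub (tendsto_one_div_atTop_nhds_zero_nat.const_mul α)
      rw [mul_zero, sub_zero] at this
      refine this.congr' ?_
      filter_upwards [eventually_gt_atTop 0] with n hn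
      have : (n : ℝ) ≠ 0 := by exact_mod_cast hn.ne'
      field_simp
    have h2 : Tendsto (fun n : ℕ => α * ((n : ℝ) - 1) / n - 1 / n) atTop (𝓝 α) := by
      simpa using h1.sub tendsto_one_div_atTop_nhds_zero_nat
    refine tendsto_of_tendsto_of_tendsto_of_le_of_le' h2 h1 ?_ ?_
    · filter_upwards [eventually_gt_atTop 0] with n hn
      have : (0 : ℝ) < n := by exact_mod_cast hn
      rw [← sub_div]
      gcongr
      linarith [Nat.lt_floor_add_one (α * ((n : ℝ) - 1))]
    · filter_upwards [eventually_gt_atTop 0] with n hn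
      have : (1 : ℝ) ≤ n := by exact_mod_cast hn
      gcongr
      exact Nat.floor_le (mul_nonneg hα.1 (by linarith))
  have hk : ∀ᶠ n : ℕ in atTop, ⌊α * ((n : ℝ) - 1)⌋₊ < n := by
    filter_upwards [eventually_gt_atTop 0] with n hn
    have : (1 : ℝ) ≤ n := by exact_mod_cast hn
    rw [Nat.floor_lt (mul_nonneg hα.1 (by linarith))]
    nlinarith [hα.2]
  have hlim2 : Tendsto (fun n : ℕ => ((⌊α * ((n : ℝ) - 1)⌋₊ : ℝ) / n)) atTop (𝓝[Icc 0 1] α) := by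
    refine tendsto_nhdsWithin_iff.2 ⟨hlim, ?_⟩
    filter_upwards [hk, eventually_gt_atTop 0] with n hn hn0
    have : (0 : ℝ) < n := by exact_mod_cast hn0
    exact ⟨by positivity, (div_le_one this).2 (by exact_mod_cast hn.le)⟩
  have hval := (hcont.tendsto.comp hlim2).eventually
    (lt_mem_nhds (sub_lt_self (g α + growth t α z) hε4))
  have hρn : ∀ᶠ n : ℕ in atTop, Real.log ρ ≥ -(ε / 4 * n) := by
    obtain ⟨M, hM⟩ := exists_nat_gt (-Real.log ρ / (ε / 4))
    filter_upwards [eventually_ge_atTop M] with n hn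
    rw [div_lt_iff₀ hε4] at hM
    have : (M : ℝ) ≤ n := by exact_mod_cast hn
    nlinarith
  filter_upwards [abs_log_norm_coeff_sub_le h hε4, hval, hk, hρn, eventually_ge_atTop N,
    eventually_gt_atTop 0] with n ha hv hkn hr hnN hn0
  refine ⟨_, hkn, ?_⟩
  set k := ⌊α * ((n : ℝ) - 1)⌋₊
  obtain ⟨ha0, ha1⟩ := ha k hkn.le
  obtain ⟨hh0, hh1⟩ := hN n hnN k hkn.le z rfl
  have hnr : (0 : ℝ) < n := by exact_mod_cast hn0
  have hpos : 0 < ρ * ‖a n k * hermite t n k z‖ :=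
    mul_pos hρ (norm_pos_iff.2 (mul_ne_zero ha0 hh0))
  rw [← Real.le_log_iff_exp_le hpos, norm_mul, Real.log_mul hρ.ne'
    (mul_ne_zero (norm_ne_zero_iff.2 ha0) (norm_ne_zero_iff.2 hh0)),
    Real.log_mul (norm_ne_zero_iff.2 ha0) (norm_ne_zero_iff.2 hh0)]
  simp only [Function.comp] at hv
  have h3 := mul_le_mul_of_nonneg_left hv.le hnr.le
  have h1 := (abs_le.1 ha1).1
  have h2 := (abs_le.1 hh1).1
  nlinarith

/-! ### Jensen's formula and comparison with the limiting logarithmic potential -/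

theorem circleAverage_log_norm_sub (z ζ : ℂ) {s : ℝ} (hs : 0 < s) :
    Real.circleAverage (fun x => Real.log ‖x - ζ‖) z s = Real.log (max s ‖z - ζ‖) := by
  rw [circleAverage_log_norm_sub_const_eq_log_radius_add_posLog hs.ne', Real.posLog]
  rcases le_total ‖z - ζ‖ s with h | h
  · rw [max_eq_left h, max_eq_left, add_zero]
    exact Real.log_nonpos (by positivity) (by rw [inv_mul_le_iff₀ hs]; linarith)
  · have h0 : 0 < ‖z - ζ‖ := hs.trans_le h
    rw [max_eq_right h, max_eq_right, Real.log_mul (by positivity) h0.ne', Real.log_inv]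
    · ring
    · exact Real.log_nonneg (by rw [le_inv_mul_iff₀ hs]; linarith)

theorem circleAverage_multiset_log_norm_sub (M : Multiset ℂ) (z : ℂ) {s : ℝ} (hs : 0 < s) :
    CircleIntegrable (fun x => (M.map fun ζ => Real.log ‖x - ζ‖).sum) z s ∧
      Real.circleAverage (fun x => (M.map fun ζ => Real.log ‖x - ζ‖).sum) z s =
        (M.map fun ζ => Real.log (max s ‖z - ζ‖)).sum := by
  induction M using Multiset.induction_on with
  | empty =>
    simp only [Multiset.map_zero, Multiset.sum_zero]
    exact ⟨circleIntegrable_const 0 z s, Real.circleAverage_const 0 z s⟩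
  | cons ζ M ih =>
    have hζ : CircleIntegrable (fun x => Real.log ‖x - ζ‖) z s :=
      circleIntegrable_log_norm_sub_const s
    simp only [Multiset.map_cons, Multiset.sum_cons]
    exact ⟨hζ.add ih.1, by
      rw [Real.circleAverage_fun_add hζ ih.1, ih.2, circleAverage_log_norm_sub z ζ hs]⟩

theorem log_norm_eval_eq {p : Polynomial ℂ} {x : ℂ} (hx : p.eval x ≠ 0) :
    Real.log ‖p.eval x‖ = Real.log ‖p.leadingCoeff‖ +
      (p.roots.map fun ζ => Real.log ‖x - ζ‖).sum := by
  have hp : p ≠ 0 := fun h => hx (by simp [h])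
  rw [(IsAlgClosed.splits p).eval_eq_prod_roots, norm_mul, Real.log_mul
    (norm_ne_zero_iff.2 (Polynomial.leadingCoeff_ne_zero.2 hp))]
  · congr 1
    have hr : ∀ ζ ∈ p.roots, x - ζ ≠ 0 := fun ζ hζ h => hx (by
      rw [sub_eq_zero.1 h]; exact (Polynomial.mem_roots hp).1 hζ)
    revert hr
    generalize p.roots = M
    induction M using Multiset.induction_on with
    | empty => simp
    | cons ζ M ih =>
      intro hr
      have h1 := hr ζ (Multiset.mem_cons_self ζ M)
      have h2 : ∀ η ∈ M, x - η ≠ 0 := fun η hη => hr η (Multiset.mem_cons_of_mem hη)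
      have h3 : (M.map fun η => x - η).prod ≠ 0 := by
        refine Multiset.prod_ne_zero fun h => ?_
        obtain ⟨η, hη, h0⟩ := Multiset.mem_map.1 h
        exact h2 η hη h0
      simp only [Multiset.map_cons, Multiset.prod_cons, Multiset.sum_cons]
      rw [norm_mul, Real.log_mul (norm_ne_zero_iff.2 h1) (norm_ne_zero_iff.2 h3), ih h2]
  · rw [(IsAlgClosed.splits p).eval_eq_prod_roots] at hx
    exact norm_ne_zero_iff.2 (right_ne_zero_of_mul hx)

/-- An upper bound on a circle bounds the regularized logarithmic potential at the centre. -/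
theorem log_leadingCoeff_add_sum_log_max_le {p : Polynomial ℂ} (hp : p ≠ 0) {z : ℂ} {s C : ℝ}
    (hs : 0 < s) (hC : ∀ x ∈ Metric.sphere z s, ‖p.eval x‖ ≤ Real.exp C) :
    Real.log ‖p.leadingCoeff‖ + (p.roots.map fun ζ => Real.log (max s ‖z - ζ‖)).sum ≤ C := by
  obtain ⟨hi, ha⟩ := circleAverage_multiset_log_norm_sub p.roots z hs
  set q : ℂ → ℝ := fun x => Real.log ‖p.leadingCoeff‖ +
    (p.roots.map fun ζ => Real.log ‖x - ζ‖).sum with hq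
  have hqi : CircleIntegrable q z s := (circleIntegrable_const _ z s).add hi
  have hqa : Real.circleAverage q z s = Real.log ‖p.leadingCoeff‖ +
      (p.roots.map fun ζ => Real.log (max s ‖z - ζ‖)).sum := by
    rw [hq, Real.circleAverage_fun_add (circleIntegrable_const _ z s) hi, ha,
      Real.circleAverage_const]
  have hfin : {x | p.eval x = 0}.Finite := p.finite_setOfPred_isRoot hp
  -- At a zero on the circle the convention `Real.log 0 = 0` makes `q` differ from `log |p|`, so `q
  -- ≤ C` may fail there. Truncation at `C` changes `q` only at these finitely many points and
  -- leaves the average unchanged.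
  have hcod : q =ᶠ[codiscreteWithin (Metric.sphere z |s|)] fun x => min (q x) C := by
    have : {x | p.eval x ≠ 0} ∈ codiscreteWithin (Metric.sphere z |s|) := by
      refine codiscreteWithin_iff_locallyFiniteComplementWithin.2 fun y _ => ⟨univ, univ_mem, ?_⟩
      refine hfin.subset fun x hx => ?_
      simpa using hx.2.2
    filter_upwards [this, self_mem_codiscreteWithin _] with x hx hxs
    rw [abs_of_pos hs] at hxs
    have := hC x hxs
    rw [← Real.log_le_iff_le_exp (norm_pos_iff.2 hx), log_norm_eval_eq hx] at this
    exact (min_eq_left this).symm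
  rw [← hqa, Real.circleAverage_congr_codiscreteWithin hcod hs.ne']
  exact Real.circleAverage_mono_on_of_le_circle (hqi.congr_codiscreteWithin hcod)
    fun x _ => min_le_right _ _

theorem integral_zeroMeasure (p : Polynomial ℂ) (f : ℂ → ℝ) :
    ∫ z, f z ∂(zeroMeasure p) = (p.natDegree : ℝ)⁻¹ * (p.roots.map f).sum := by
  have key : ∀ M : Multiset ℂ, Integrable f (M.map fun z => Measure.dirac z).sum ∧
      ∫ z, f z ∂(M.map fun z => Measure.dirac z).sum = (M.map f).sum := by
    intro M
    induction M using Multiset.induction_on with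
    | empty => simp
    | cons ζ M ih =>
      have h : Integrable f (Measure.dirac ζ) := integrable_dirac enorm_lt_top
      simp only [Multiset.map_cons, Multiset.sum_cons]
      exact ⟨h.add_measure ih.1, by rw [integral_add_measure h ih.1, ih.2, integral_dirac]⟩
  rw [zeroMeasure, integral_smul_measure, (key _).2]
  simp

/-- The difference of two regularized logarithmic kernels. -/
noncomputable def logKernelDiff (z : ℂ) (s : ℝ) (z' : ℂ) (s' : ℝ) (ζ : ℂ) : ℝ :=
  Real.log (max s ‖z - ζ‖) - Real.log (max s' ‖z' - ζ‖)

theorem continuous_log_max (z : ℂ) {s : ℝ} (hs : 0 < s) :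
    Continuous fun ζ : ℂ => Real.log (max s ‖z - ζ‖) :=
  Continuous.log (by fun_prop) fun ζ => (lt_max_of_lt_left hs).ne'

theorem continuous_logKernelDiff (z z' : ℂ) {s s' : ℝ} (hs : 0 < s) (hs' : 0 < s') :
    Continuous (logKernelDiff z s z' s') :=
  (continuous_log_max z hs).sub (continuous_log_max z' hs')

/-- The logarithmic growth at infinity cancels in the difference, and the cut-offs remove the finite
singularities. The kernel difference is therefore an admissible bounded continuous test function for
weak convergence, with no tightness or moment condition on the zeros. -/
theorem abs_logKernelDiff_le (z z' ζ : ℂ) {s s' : ℝ} (hs : 0 < s) (hs' : 0 < s') :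
    |logKernelDiff z s z' s' ζ| ≤ (|s - s'| + ‖z - z'‖) / min s s' := by
  refine (abs_log_sub_log_le (lt_min hs hs') ((min_le_left _ _).trans (le_max_left _ _))
    ((min_le_right _ _).trans (le_max_left _ _))).trans ?_
  gcongr
  refine (abs_max_sub_max_le_max _ _ _ _).trans (max_le (by linarith [norm_nonneg (z - z')]) ?_)
  refine (abs_norm_sub_norm_le _ _).trans ?_
  rw [sub_sub_sub_cancel_right]
  linarith [abs_nonneg (s - s')]

theorem integrable_logKernelDiff {ν : Measure ℂ} [IsFiniteMeasure ν] (z z' : ℂ) {s s' : ℝ}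
    (hs : 0 < s) (hs' : 0 < s') : Integrable (logKernelDiff z s z' s') ν :=
  Integrable.of_bound (continuous_logKernelDiff z z' hs hs').aestronglyMeasurable _
    (Eventually.of_forall fun ζ => abs_logKernelDiff_le z z' ζ hs hs')

/-- Lower bounds for the growth exponent at `z` and upper bounds on a circle around `z'` compare
the logarithmic potentials of the limiting zero distribution at the two points. -/
theorem sub_le_integral_logKernelDiff {Ω : Type*} [MeasurableSpace Ω] {P : Measure Ω}
    [IsProbabilityMeasure P] {ξ : ℕ → Ω → ℂ} {a : ℕ → ℕ → ℂ} {g : ℝ → ℝ} (hA1 : CondA1 P ξ)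
    (hA2 : CondA2 a g) {t : ℂ} {ν : Measure ℂ} (hν : IsLimitZeroDistribution P ξ a t ν)
    {z z' : ℂ} {s α B : ℝ} (hs : 0 < s) (hz : z ∈ offSlit t) (hz' : Metric.sphere z' s ⊆ offSlit t)
    (hα : α ∈ Icc (0 : ℝ) 1)
    (hB : ∀ x ∈ Metric.sphere z' s, ∀ β ∈ Icc (0 : ℝ) 1, g β + growth t β x ≤ B) :
    g α + growth t α z - B ≤ ∫ ζ, logKernelDiff z s z' s ζ ∂ν := by
  have := hν.isProbabilityMeasure
  obtain ⟨ρ, hρ, p, hp, hanti⟩ := exists_pos_le_measure_norm_sum hA1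
  refine le_of_forall_pos_le_add fun ε₀ hε₀ => ?_
  -- The lower bound at `z` loses `ε`, the upper bound on the circle `4ε`, and weak convergence
  -- another `ε`.
  obtain ⟨ε, hε, hεe⟩ : ∃ ε : ℝ, 0 < ε ∧ 6 * ε = ε₀ := ⟨ε₀ / 6, by linarith, by ring⟩
  set f : ℂ →ᵇ ℝ := BoundedContinuousFunction.ofNormedAddCommGroup (logKernelDiff z s z' s)
    (continuous_logKernelDiff z z' hs hs) _ (fun ζ => abs_logKernelDiff_le z z' ζ hs hs)
  have hweak := tendstoInMeasure_iff_norm.1 (hν.tendsto f) ε hε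
  have hsum := (tendsto_measure_exists_exp_lt hA1 hε).add hweak
  rw [add_zero] at hsum
  obtain ⟨n, hsmall, hup, ⟨k, hk, hlow⟩, hcoef, hn0⟩ := ((hsum.eventually (gt_mem_nhds hp)).and
    ((norm_eval_heatPoly_le hA2 (isCompact_sphere z' s) hz' hB hε).and
    ((exists_large_term hA2 hz hα hρ hε).and ((abs_log_norm_coeff_sub_le hA2 hε).and
      (eventually_gt_atTop 0))))).exists
  have hnr : (0 : ℝ) < n := by exact_mod_cast hn0
  have hev := hanti n k hk fun j => a n j * hermite t n j z
  -- The good event has probability at least `p`, while the bad ones together have probability below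
  -- `p` for this `n`. One outcome is enough, since the claimed inequality involves only
  -- deterministic quantities.
  obtain ⟨ω, ⟨hω0, hω1⟩, hωb⟩ : ∃ ω, ω ∈ {ω | ξ n ω ≠ 0 ∧ ρ * ‖a n k * hermite t n k z‖ ≤
      ‖∑ j ∈ Finset.range (n + 1), ξ j ω * (a n j * hermite t n j z)‖} ∧
      ω ∉ {ω | ∃ k ≤ n, Real.exp (ε * n) < ‖ξ k ω‖} ∪
        {ω | ε ≤ ‖∫ ζ, f ζ ∂(zeroMeasure (heatPoly a (fun k => ξ k ω) t n)) - ∫ ζ, f ζ ∂ν‖} := by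
    by_contra! hcon
    exact absurd ((hev.trans (measure_mono hcon)).trans (measure_union_le _ _)) (not_le.2 hsmall)
  simp only [mem_union, mem_ofPred_eq, not_or, not_exists, not_and, not_lt, not_le] at hωb
  obtain ⟨hωu, hωf⟩ := hωb
  set q := heatPoly a (fun k => ξ k ω) t n with hq
  have hdeg : q.natDegree = n := natDegree_heatPoly t hω0 (hcoef n le_rfl).1
  have hlow2 : Real.exp (n * (g α + growth t α z - ε)) ≤ ‖q.eval z‖ := by
    refine (hlow.trans hω1).trans (le_of_eq ?_)
    rw [hq, eval_heatPoly]
    rfl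
  have hqz : q.eval z ≠ 0 := norm_pos_iff.1 ((Real.exp_pos _).trans_le hlow2)
  have hq0 : q ≠ 0 := fun h => hqz (by simp [h])
  rw [← Real.le_log_iff_exp_le (norm_pos_iff.2 hqz), log_norm_eval_eq hqz] at hlow2
  have hupq := log_leadingCoeff_add_sum_log_max_le hq0 hs (fun x hx => hup _ hωu x hx)
  have hmono : (q.roots.map fun ζ => Real.log ‖z - ζ‖).sum ≤
      (q.roots.map fun ζ => Real.log (max s ‖z - ζ‖)).sum := by
    refine Multiset.sum_map_le_sum_map _ _ fun ζ hζ => ?_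
    refine Real.log_le_log (norm_pos_iff.2 fun h => hqz ?_) (le_max_right _ _)
    rw [sub_eq_zero.1 h]
    exact (Polynomial.mem_roots hq0).1 hζ
  have hint : (n : ℝ) * ∫ ζ, f ζ ∂(zeroMeasure q) =
      (q.roots.map fun ζ => Real.log (max s ‖z - ζ‖)).sum -
        (q.roots.map fun ζ => Real.log (max s ‖z' - ζ‖)).sum := by
    rw [integral_zeroMeasure, hdeg, mul_inv_cancel_left₀ hnr.ne', ← Multiset.sum_map_sub]
    rfl
  have hfν : ∫ ζ, f ζ ∂ν = ∫ ζ, logKernelDiff z s z' s ζ ∂ν := rfl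
  have h5 : (n : ℝ) * (g α + growth t α z - B - 5 * ε) ≤ n * ∫ ζ, f ζ ∂(zeroMeasure q) := by
    rw [hint]; linarith
  have h6 := le_of_mul_le_mul_left h5 hnr
  rw [Real.norm_eq_abs] at hωf
  have h7 := (abs_lt.1 hωf).2
  rw [← hfν]
  linarith

/-! ### Circle averages of regularized potentials -/

theorem circleAverage_real (f : ℂ → ℝ) (c : ℂ) (r : ℝ) :
    Real.circleAverage f c r = (2 * Real.pi)⁻¹ * ∫ θ in (0 : ℝ)..2 * Real.pi, f (circleMap c r θ) :=
  rfl

theorem countable_sin_eq (φ k : ℝ) : {θ : ℝ | Real.sin (θ - φ) = k}.Countable := by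
  by_cases h : ∃ θ₀, Real.sin (θ₀ - φ) = k
  · obtain ⟨θ₀, rfl⟩ := h
    refine ((countable_range fun m : ℤ => 2 * m * Real.pi + (θ₀ - φ) + φ).union
      (countable_range fun m : ℤ => (2 * m + 1) * Real.pi - (θ₀ - φ) + φ)).mono fun θ hθ => ?_
    obtain ⟨m, hm⟩ := Real.sin_eq_sin_iff.1 (Eq.symm (show Real.sin (θ - φ) = _ from hθ))
    rcases hm with hm | hm
    · exact Or.inl ⟨m, by simp only; linarith⟩
    · exact Or.inr ⟨m, by simp only; linarith⟩
  · convert countable_empty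
    ext θ
    simpa using fun hθ => h ⟨θ, hθ⟩

/-- A circle meets a line in a null set of angles. -/
theorem volume_circleMap_mem_line {v : ℂ} (hv : v ≠ 0) (c : ℂ) {r : ℝ} (hr : r ≠ 0) (k : ℝ) :
    volume {θ : ℝ | (starRingEnd ℂ v * circleMap c r θ).im = k} = 0 := by
  refine Countable.measure_zero ((countable_sin_eq v.arg
    ((k - (starRingEnd ℂ v * c).im) / (‖v‖ * r))).mono fun θ hθ => ?_) _
  have hθ' : (starRingEnd ℂ v * circleMap c r θ).im = k := hθ
  have hv' : ‖v‖ ≠ 0 := norm_ne_zero_iff.2 hv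
  have e : starRingEnd ℂ v * (r * Complex.exp (θ * Complex.I)) =
      ((‖v‖ * r : ℝ) : ℂ) * Complex.exp (((θ - v.arg : ℝ) : ℂ) * Complex.I) := by
    conv_lhs => rw [← Complex.norm_mul_exp_arg_mul_I v]
    rw [map_mul, Complex.conj_ofReal, ← Complex.exp_conj, map_mul, Complex.conj_ofReal,
      Complex.conj_I]
    rw [show (‖v‖ : ℂ) * Complex.exp (v.arg * -Complex.I) * (r * Complex.exp (θ * Complex.I)) =
      ‖v‖ * r * (Complex.exp (v.arg * -Complex.I) * Complex.exp (θ * Complex.I)) by ring,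
      ← Complex.exp_add]
    push_cast
    ring_nf
  rw [circleMap, mul_add, e, Complex.add_im, Complex.im_ofReal_mul,
    Complex.exp_ofReal_mul_I_im] at hθ'
  show Real.sin (θ - v.arg) = _
  rw [eq_div_iff (mul_ne_zero hv' hr)]
  linarith

theorem ae_circleMap_notMem_line {v : ℂ} (hv : v ≠ 0) (c : ℂ) {r : ℝ} (hr : r ≠ 0) :
    ∀ᵐ θ : ℝ, (starRingEnd ℂ v * circleMap c r θ).im ≠ 0 := by
  rw [ae_iff]
  simpa using volume_circleMap_mem_line hv c hr 0

theorem ae_circleMap_ne (c ζ : ℂ) {r : ℝ} (hr : r ≠ 0) : ∀ᵐ θ : ℝ, circleMap c r θ ≠ ζ := by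
  refine measure_mono_null (fun θ hθ => ?_) (volume_circleMap_mem_line one_ne_zero c hr ζ.im)
  have : circleMap c r θ = ζ := not_not.1 hθ
  show (starRingEnd ℂ 1 * circleMap c r θ).im = ζ.im
  simp [this]

theorem norm_circleMap_le (c : ℂ) (r θ : ℝ) : ‖circleMap c r θ‖ ≤ ‖c‖ + |r| := by
  refine (norm_add_le _ _).trans ?_
  simp

theorem tendsto_circleAverage_log_max (c ζ : ℂ) {r : ℝ} (hr : 0 < r) {s : ℕ → ℝ}
    (hs0 : ∀ j, 0 < s j) (hs1 : ∀ j, s j ≤ 1) (hs : Tendsto s atTop (𝓝 0)) :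
    Tendsto (fun j => Real.circleAverage (fun z => Real.log (max (s j) ‖z - ζ‖)) c r) atTop
      (𝓝 (Real.log (max r ‖c - ζ‖))) := by
  rw [← circleAverage_log_norm_sub c ζ hr]
  simp_rw [circleAverage_real]
  refine Tendsto.const_mul _ ?_
  have hint : CircleIntegrable (fun x => Real.log ‖x - ζ‖) c r :=
    circleIntegrable_log_norm_sub_const r
  have hcont : ∀ a : ℝ, 0 < a →
      Continuous fun θ : ℝ => Real.log (max a ‖circleMap c r θ - ζ‖) := fun a ha =>
    Continuous.log (continuous_const.max ((continuous_circleMap c r).sub continuous_const).norm)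
      fun θ => (lt_max_of_lt_left ha).ne'
  refine intervalIntegral.tendsto_integral_filter_of_dominated_convergence
    (fun θ => |Real.log ‖circleMap c r θ - ζ‖| + |Real.log (max 1 ‖circleMap c r θ - ζ‖)|)
    (Eventually.of_forall fun j => (hcont _ (hs0 j)).aestronglyMeasurable)
    (Eventually.of_forall fun j => ?_) ?_ ?_
  · filter_upwards [ae_circleMap_ne c ζ hr.ne'] with θ hθ _
    have h0 : 0 < ‖circleMap c r θ - ζ‖ := norm_pos_iff.2 (sub_ne_zero.2 hθ)
    have h1 : Real.log ‖circleMap c r θ - ζ‖ ≤ Real.log (max (s j) ‖circleMap c r θ - ζ‖) :=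
      Real.log_le_log h0 (le_max_right _ _)
    have h2 : Real.log (max (s j) ‖circleMap c r θ - ζ‖) ≤
        Real.log (max 1 ‖circleMap c r θ - ζ‖) :=
      Real.log_le_log (lt_max_of_lt_right h0) (max_le_max_right _ (hs1 j))
    rw [Real.norm_eq_abs, abs_le]
    constructor
    · linarith [neg_abs_le (Real.log ‖circleMap c r θ - ζ‖),
        abs_nonneg (Real.log (max 1 ‖circleMap c r θ - ζ‖))]
    · linarith [le_abs_self (Real.log (max 1 ‖circleMap c r θ - ζ‖)),
        abs_nonneg (Real.log ‖circleMap c r θ - ζ‖)]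
  · exact (IntervalIntegrable.abs hint).add
      ((hcont 1 one_pos).abs.intervalIntegrable _ _)
  · filter_upwards [ae_circleMap_ne c ζ hr.ne'] with θ hθ _
    have h0 : 0 < ‖circleMap c r θ - ζ‖ := norm_pos_iff.2 (sub_ne_zero.2 hθ)
    have h1 : Tendsto (fun j => max (s j) ‖circleMap c r θ - ζ‖) atTop
        (𝓝 (max 0 ‖circleMap c r θ - ζ‖)) := hs.max tendsto_const_nhds
    rw [max_eq_right h0.le] at h1
    exact h1.log h0.ne'

variable {ν : Measure ℂ} [IsProbabilityMeasure ν]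

/-- The logarithmic potential of `ν`, regularized at scale `s` and renormalized at infinity. -/
noncomputable def regPotential (ν : Measure ℂ) (s : ℝ) (z : ℂ) : ℝ :=
  ∫ ζ, logKernelDiff z s 0 1 ζ ∂ν

theorem integral_logKernelDiff_eq (z z' : ℂ) {s s' : ℝ} (hs : 0 < s) (hs' : 0 < s') :
    ∫ ζ, logKernelDiff z s z' s' ζ ∂ν = regPotential ν s z - regPotential ν s' z' := by
  rw [regPotential, regPotential, ← integral_sub (integrable_logKernelDiff z 0 hs one_pos)
    (integrable_logKernelDiff z' 0 hs' one_pos)]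
  refine integral_congr_ae (Eventually.of_forall fun ζ => ?_)
  simp [logKernelDiff]

theorem regPotential_mono {s s' : ℝ} (hs : 0 < s) (h : s ≤ s') (z : ℂ) :
    regPotential ν s z ≤ regPotential ν s' z := by
  refine integral_mono (integrable_logKernelDiff z 0 hs one_pos)
    (integrable_logKernelDiff z 0 (hs.trans_le h) one_pos) fun ζ => ?_
  refine sub_le_sub_right (Real.log_le_log (lt_max_of_lt_left hs) (max_le_max_right _ h)) _

theorem continuous_regPotential {s : ℝ} (hs : 0 < s) : Continuous (regPotential ν s) := by
  refine continuous_iff_continuousAt.2 fun z => ?_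
  have hb : ∀ z', ‖regPotential ν s z' - regPotential ν s z‖ ≤ ‖z' - z‖ / s := fun z' => by
    rw [← integral_logKernelDiff_eq z' z hs hs]
    refine (norm_integral_le_of_norm_le_const (C := ‖z' - z‖ / s)
      (Eventually.of_forall fun ζ => ?_)).trans (by simp)
    have := abs_logKernelDiff_le z' z ζ hs hs
    simpa using this
  refine tendsto_iff_norm_sub_tendsto_zero.2 (squeeze_zero (fun _ => norm_nonneg _) hb ?_)
  have : Continuous fun z' : ℂ => ‖z' - z‖ / s := by fun_prop
  simpa using this.tendsto z

theorem circleAverage_regPotential {s : ℝ} (hs : 0 < s) (c : ℂ) (r : ℝ) :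
    Real.circleAverage (regPotential ν s) c r =
      ∫ ζ, Real.circleAverage (fun z => logKernelDiff z s 0 1 ζ) c r ∂ν := by
  simp_rw [circleAverage_real, regPotential]
  rw [integral_const_mul]
  congr 1
  simp_rw [intervalIntegral.integral_of_le Real.two_pi_pos.le]
  refine integral_integral_swap ?_
  have hc : Continuous (Function.uncurry fun (θ : ℝ) (ζ : ℂ) =>
      logKernelDiff (circleMap c r θ) s 0 1 ζ) := by
    unfold Function.uncurry logKernelDiff
    have hm : Continuous fun a : ℝ × ℂ => circleMap c r a.1 :=
      (continuous_circleMap c r).comp continuous_fst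
    refine Continuous.sub (Continuous.log (continuous_const.max (hm.sub continuous_snd).norm)
      fun a => (lt_max_of_lt_left hs).ne') (Continuous.log (by fun_prop)
      fun a => (lt_max_of_lt_left one_pos).ne')
  refine Integrable.of_bound hc.aestronglyMeasurable ((|s - 1| + (‖c‖ + |r|)) / min s 1)
    (Eventually.of_forall fun a => ?_)
  refine (abs_logKernelDiff_le _ _ _ hs one_pos).trans ?_
  have := lt_min hs one_pos
  gcongr
  rw [sub_zero]
  exact norm_circleMap_le c r a.1

theorem circleIntegrable_log_max (c ζ : ℂ) (r : ℝ) {s : ℝ} (hs : 0 < s) :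
    CircleIntegrable (fun z => Real.log (max s ‖z - ζ‖)) c r :=
  (Continuous.log (by fun_prop) fun z => (lt_max_of_lt_left hs).ne').continuousOn.circleIntegrable'

theorem circleAverage_logKernelDiff (c ζ : ℂ) (r : ℝ) {s : ℝ} (hs : 0 < s) :
    Real.circleAverage (fun z => logKernelDiff z s 0 1 ζ) c r =
      Real.circleAverage (fun z => Real.log (max s ‖z - ζ‖)) c r -
        Real.log (max 1 ‖0 - ζ‖) := by
  unfold logKernelDiff
  rw [Real.circleAverage_fun_sub (circleIntegrable_log_max c ζ r hs)
    (circleIntegrable_const _ c r), Real.circleAverage_const]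

theorem log_max_le_circleAverage (c ζ : ℂ) {r s : ℝ} (hr : 0 < r) (hs : 0 < s) :
    Real.log (max r ‖c - ζ‖) ≤ Real.circleAverage (fun z => Real.log (max s ‖z - ζ‖)) c r := by
  rw [← circleAverage_log_norm_sub c ζ hr, circleAverage_real, circleAverage_real]
  refine mul_le_mul_of_nonneg_left ?_ (inv_nonneg.2 Real.two_pi_pos.le)
  have hint : CircleIntegrable (fun x => Real.log ‖x - ζ‖) c r :=
    circleIntegrable_log_norm_sub_const r
  refine intervalIntegral.integral_mono_ae Real.two_pi_pos.le hint
    (circleIntegrable_log_max c ζ r hs) ?_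
  filter_upwards [ae_circleMap_ne c ζ hr.ne'] with θ hθ
  exact Real.log_le_log (norm_pos_iff.2 (sub_ne_zero.2 hθ)) (le_max_right _ _)

/-- The average of `log |z - ζ|` over a circle of radius `r` about `c` is `log max(r, |c - ζ|)`:
regularizing at scale `r` is the same as averaging over that circle. The limit passes through Fubini
and dominated convergence. -/
theorem tendsto_circleAverage_regPotential (c : ℂ) {r : ℝ} (hr : 0 < r) {s : ℕ → ℝ}
    (hs0 : ∀ j, 0 < s j) (hs1 : ∀ j, s j ≤ 1) (hs : Tendsto s atTop (𝓝 0)) :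
    Tendsto (fun j => Real.circleAverage (regPotential ν (s j)) c r) atTop
      (𝓝 (regPotential ν r c)) := by
  simp_rw [circleAverage_regPotential (hs0 _)]
  set C : ℝ := (|r - 1| + ‖c - 0‖) / min r 1 + (‖c‖ + |r|) with hC
  refine tendsto_integral_of_dominated_convergence (fun _ => C) (fun j => ?_)
    (integrable_const C) (fun j => Eventually.of_forall fun ζ => ?_)
    (Eventually.of_forall fun ζ => ?_)
  · refine Continuous.aestronglyMeasurable ?_
    simp_rw [circleAverage_real]
    refine continuous_const.mul ?_
    refine intervalIntegral.continuous_parametric_intervalIntegral_of_continuous' ?_ _ _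
    unfold Function.uncurry logKernelDiff
    have hm : Continuous fun a : ℂ × ℝ => circleMap c r a.2 :=
      (continuous_circleMap c r).comp continuous_snd
    exact Continuous.sub (Continuous.log (continuous_const.max (hm.sub continuous_fst).norm)
      fun a => (lt_max_of_lt_left (hs0 j)).ne') (Continuous.log (by fun_prop)
      fun a => (lt_max_of_lt_left one_pos).ne')
  · have h1 := log_max_le_circleAverage c ζ hr (hs0 j)
    have h2 : Real.circleAverage (fun z => Real.log (max (s j) ‖z - ζ‖)) c r ≤
        Real.log (max 1 ‖0 - ζ‖) + (‖c‖ + |r|) := by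
      refine Real.circleAverage_mono_on_of_le_circle (circleIntegrable_log_max c ζ r (hs0 j))
        fun x hx => ?_
      have hx' : ‖x‖ ≤ ‖c‖ + |r| := by
        have := norm_add_le c (x - c)
        rw [mem_sphere_iff_norm] at hx
        rw [add_sub_cancel, hx] at this
        exact this
      have h3 : Real.log (max (s j) ‖x - ζ‖) ≤ Real.log (max 1 ‖x - ζ‖) :=
        Real.log_le_log (lt_max_of_lt_left (hs0 j)) (max_le_max_right _ (hs1 j))
      have h4 := (abs_le.1 (abs_logKernelDiff_le x 0 ζ one_pos one_pos)).2
      simp only [logKernelDiff, sub_self, abs_zero, sub_zero, zero_add, min_self, div_one] at h4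
      rw [zero_sub] at *
      linarith
    have h5 := (abs_le.1 (abs_logKernelDiff_le c 0 ζ hr one_pos)).1
    have h6 : 0 ≤ (|r - 1| + ‖c - 0‖) / min r 1 := by
      have := lt_min hr one_pos
      positivity
    have h7 : 0 ≤ ‖c‖ + |r| := by positivity
    rw [logKernelDiff] at h5
    rw [circleAverage_logKernelDiff c ζ r (hs0 j), Real.norm_eq_abs, abs_le]
    constructor <;> linarith
  · simp_rw [circleAverage_logKernelDiff c ζ r (hs0 _)]
    exact (tendsto_circleAverage_log_max c ζ hr hs0 hs1 hs).sub_const _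

/-- A continuous function which is compared to the logarithmic potential of `ν` off a line has
the circle averages of that potential. -/
theorem circleAverage_sub_circleAverage_eq {D : Set ℂ} (hD : IsOpen D) {U : ℂ → ℝ}
    (hU : ContinuousOn U D) {v : ℂ} (hv : v ≠ 0)
    (H : ∀ z ∈ D, (starRingEnd ℂ v * z).im ≠ 0 → ∀ (z' : ℂ) (s B : ℝ), 0 < s →
      (∀ x ∈ Metric.closedBall z' s, x ∈ D ∧ (starRingEnd ℂ v * x).im ≠ 0 ∧ U x ≤ B) →
      U z - B ≤ ∫ ζ, logKernelDiff z s z' s ζ ∂ν)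
    {c : ℂ} {r r' : ℝ} (hr : 0 < r) (hr' : r ≤ r') (hc : Metric.closedBall c r' ⊆ D) :
    Real.circleAverage U c r' - Real.circleAverage U c r = ∫ ζ, logKernelDiff c r' c r ζ ∂ν := by
  set E : Set ℂ := {x | x ∈ D ∧ (starRingEnd ℂ v * x).im ≠ 0} with hE
  have hEo : IsOpen E := hD.inter (isOpen_ne_fun (by fun_prop) continuous_const)
  set s : ℕ → ℝ := fun j => 1 / ((j : ℝ) + 1) with hsdef
  have hs0 : ∀ j, 0 < s j := fun j => by positivity
  have hs1 : ∀ j, s j ≤ 1 := fun j => by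
    rw [hsdef]; simp only
    rw [div_le_one (by positivity)]
    linarith [(Nat.cast_nonneg j : (0 : ℝ) ≤ j)]
  have hs : Tendsto s atTop (𝓝 0) := tendsto_one_div_add_atTop_nhds_zero_nat
  have hsanti : Antitone s := fun i j hij => one_div_le_one_div_of_le (by positivity)
    (by simpa using hij)
  have hsub : ∀ {ρ : ℝ}, 0 < ρ → ρ ≤ r' → ∀ θ, circleMap c ρ θ ∈ D := fun {ρ} h0 h1 θ =>
    hc (Metric.closedBall_subset_closedBall h1
      (Metric.sphere_subset_closedBall (circleMap_mem_sphere c h0.le θ)))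
  -- With `B = U z' + η` on a small disc, and the roles of `z` and `z'` exchangeable, the
  -- differences of regularized potentials converge to those of `U` off the line.
  have hstep : ∀ z ∈ E, ∀ z' ∈ E, ∀ η > 0, ∀ᶠ j in atTop,
      U z - U z' - η ≤ regPotential ν (s j) z - regPotential ν (s j) z' := by
    intro z hz z' hz' η hη
    have h1 : ∀ᶠ x in 𝓝 z', x ∈ E ∧ U x ≤ U z' + η :=
      (hEo.eventually_mem hz').and (((hU.continuousAt (hD.mem_nhds hz'.1)).eventually
        (gt_mem_nhds (by linarith : U z' < U z' + η))).mono fun _ h => le_of_lt h)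
    obtain ⟨ε, hε, hball⟩ := Metric.nhds_basis_closedBall.eventually_iff.1 h1
    filter_upwards [hs.eventually (gt_mem_nhds hε)] with j hj
    rw [← integral_logKernelDiff_eq z z' (hs0 j) (hs0 j)]
    have := H z hz.1 hz.2 z' (s j) (U z' + η) (hs0 j) fun x hx => by
      obtain ⟨a, b⟩ := hball (Metric.closedBall_subset_closedBall hj.le hx)
      exact ⟨a.1, a.2, b⟩
    linarith
  obtain ⟨z₀, hz₀⟩ : E.Nonempty := by
    obtain ⟨θ, hθ⟩ := (ae_circleMap_notMem_line hv c hr.ne').exists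
    exact ⟨_, hsub hr hr' θ, hθ⟩
  have hanti : ∀ z, Antitone fun j => regPotential ν (s j) z := fun z i j hij =>
    regPotential_mono (hs0 j) (hsanti hij) z
  -- The sequence is decreasing, so it has a limit unless it tends to `-∞`. In that case the
  -- comparison would push its averages over a small circle about `z₀` to `-∞`, but these averages
  -- have a finite limit.
  obtain ⟨κ, hκ⟩ : ∃ κ, Tendsto (fun j => regPotential ν (s j) z₀) atTop (𝓝 κ) := by
    refine (tendsto_atTop_of_antitone (hanti z₀)).resolve_left fun hbot => ?_
    obtain ⟨ε, hε, hball⟩ := Metric.nhds_basis_closedBall.mem_iff.1 (hEo.mem_nhds hz₀)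
    have hUc : ContinuousOn U (Metric.closedBall z₀ ε) := hU.mono fun x hx => (hball hx).1
    obtain ⟨B, hB⟩ := (isCompact_closedBall z₀ ε).bddAbove_image hUc
    have hav := tendsto_circleAverage_regPotential (ν := ν) z₀ (half_pos hε) hs0 hs1 hs
    have hle : ∀ᶠ j in atTop, Real.circleAverage (regPotential ν (s j)) z₀ (ε / 2) ≤
        regPotential ν (s j) z₀ - U z₀ + B := by
      filter_upwards [hs.eventually (gt_mem_nhds (half_pos hε))] with j hj
      refine Real.circleAverage_mono_on_of_le_circle
        (continuous_regPotential (hs0 j)).continuousOn.circleIntegrable' fun x hx => ?_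
      rw [abs_of_pos (half_pos hε), mem_sphere_iff_norm] at hx
      have := H z₀ hz₀.1 hz₀.2 x (s j) B (hs0 j) fun y hy => by
        have hy' : y ∈ Metric.closedBall z₀ ε := by
          rw [Metric.mem_closedBall] at hy ⊢
          have h1 := dist_triangle y x z₀
          rw [dist_eq_norm x z₀, hx] at h1
          linarith
        exact ⟨(hball hy').1, (hball hy').2, hB (mem_image_of_mem U hy')⟩
      rw [integral_logKernelDiff_eq z₀ x (hs0 j) (hs0 j)] at this
      linarith
    have h1 := hav.eventually (lt_mem_nhds (sub_one_lt (regPotential ν (ε / 2) z₀)))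
    obtain ⟨j, h2, h3, h4⟩ := (h1.and (hle.and
      (hbot.eventually_lt_atBot (regPotential ν (ε / 2) z₀ - 1 + U z₀ - B)))).exists
    linarith
  have hlim : ∀ z ∈ E, Tendsto (fun j => regPotential ν (s j) z) atTop (𝓝 (U z - U z₀ + κ)) := by
    intro z hz
    have hdiff : Tendsto (fun j => regPotential ν (s j) z - regPotential ν (s j) z₀) atTop
        (𝓝 (U z - U z₀)) := by
      rw [Metric.tendsto_atTop']
      intro ε hε
      obtain ⟨N, hN⟩ := eventually_atTop.1 ((hstep z hz z₀ hz₀ (ε / 2) (half_pos hε)).and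
        (hstep z₀ hz₀ z hz (ε / 2) (half_pos hε)))
      refine ⟨N, fun j hj => ?_⟩
      obtain ⟨h1, h2⟩ := hN j hj.le
      rw [Real.dist_eq, abs_lt]
      constructor <;> linarith
    simpa using hdiff.add hκ
  have hmain : ∀ ρ : ℝ, 0 < ρ → ρ ≤ r' →
      regPotential ν ρ c = Real.circleAverage U c ρ - U z₀ + κ := by
    intro ρ hρ hρ'
    have hUcirc : Continuous fun θ => U (circleMap c ρ θ) :=
      hU.comp_continuous (continuous_circleMap c ρ) (hsub hρ hρ')
    have hUint : CircleIntegrable U c ρ := hUcirc.intervalIntegrable _ _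
    have hlim2 : Tendsto (fun j => Real.circleAverage (regPotential ν (s j)) c ρ) atTop
        (𝓝 (Real.circleAverage (fun z => U z + (κ - U z₀)) c ρ)) := by
      simp_rw [circleAverage_real]
      refine Tendsto.const_mul _ ?_
      refine intervalIntegral.tendsto_integral_filter_of_dominated_convergence
        (fun θ => |U (circleMap c ρ θ) + (κ - U z₀)| + |regPotential ν (s 0) (circleMap c ρ θ)|)
        (Eventually.of_forall fun j =>
          ((continuous_regPotential (hs0 j)).comp (continuous_circleMap c ρ)).aestronglyMeasurable)
        (Eventually.of_forall fun j => ?_) ?_ ?_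
      -- Monotonicity in `j` traps the integrand between its limit and its first member. Both are
      -- continuous in the angle, which gives domination.
      · filter_upwards [ae_circleMap_notMem_line hv c hρ.ne'] with θ hθ _
        have hl := hlim _ (show circleMap c ρ θ ∈ E from ⟨hsub hρ hρ' θ, hθ⟩)
        have h1 := (hanti (circleMap c ρ θ)).le_of_tendsto hl j
        have h2 := hanti (circleMap c ρ θ) (zero_le : 0 ≤ j)
        simp only at h1 h2
        rw [Real.norm_eq_abs, abs_le]
        constructor
        · linarith [neg_abs_le (U (circleMap c ρ θ) + (κ - U z₀)),
            abs_nonneg (regPotential ν (s 0) (circleMap c ρ θ))]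
        · linarith [le_abs_self (regPotential ν (s 0) (circleMap c ρ θ)),
            abs_nonneg (U (circleMap c ρ θ) + (κ - U z₀))]
      · refine Continuous.intervalIntegrable ?_ _ _
        exact (hUcirc.add continuous_const).abs.add
          ((continuous_regPotential (hs0 0)).comp (continuous_circleMap c ρ)).abs
      · filter_upwards [ae_circleMap_notMem_line hv c hρ.ne'] with θ hθ _
        have hl := hlim _ (show circleMap c ρ θ ∈ E from ⟨hsub hρ hρ' θ, hθ⟩)
        rwa [sub_add_eq_add_sub, add_sub_assoc] at hl
    have := tendsto_nhds_unique (tendsto_circleAverage_regPotential (ν := ν) c hρ hs0 hs1 hs) hlim2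
    rw [this, Real.circleAverage_fun_add hUint (circleIntegrable_const _ c ρ),
      Real.circleAverage_const]
    ring
  rw [integral_logKernelDiff_eq c c (hr.trans_le hr') hr, hmain r' (hr.trans_le hr') le_rfl,
    hmain r hr hr']
  ring

/-! ### From circle averages to masses of small discs -/

/-- Second-order expansion of a function whose differential is `Re (m dz)`. -/
theorem abs_sub_taylor_le {D : Set ℂ} (hD : IsOpen D) {U : ℂ → ℝ} {m : ℂ → ℂ} {m' : ℂ →L[ℝ] ℂ}
    (hU : ∀ x ∈ D, HasFDerivAt U (Complex.reCLM.comp (m x • ContinuousLinearMap.id ℝ ℂ)) x)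
    {c : ℂ} (hc : c ∈ D) (hm : HasFDerivAt m m' c) {ε : ℝ} (hε : 0 < ε) :
    ∃ δ > 0, ∀ h : ℂ, ‖h‖ < δ →
      c + h ∈ D ∧ |U (c + h) - (U c + (m c * h).re + 1 / 2 * (m' h * h).re)| ≤ ε * ‖h‖ ^ 2 := by
  have h1 := (hasFDerivAt_iff_isLittleO_nhds_zero.1 hm).def hε
  obtain ⟨δ₁, hδ₁, hb₁⟩ := Metric.eventually_nhds_iff.1 h1
  obtain ⟨δ₂, hδ₂, hb₂⟩ := Metric.mem_nhds_iff.1 (hD.mem_nhds hc)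
  refine ⟨min δ₁ δ₂, lt_min hδ₁ hδ₂, fun h hh => ?_⟩
  have hmem : ∀ τ ∈ Icc (0 : ℝ) 1, c + τ * h ∈ D ∧
      ‖m (c + τ * h) - m c - m' (τ * h)‖ ≤ ε * ‖(τ : ℂ) * h‖ ∧ ‖(τ : ℂ) * h‖ ≤ ‖h‖ := by
    intro τ hτ
    have hle : ‖(τ : ℂ) * h‖ ≤ ‖h‖ := by
      rw [norm_mul, Complex.norm_real, Real.norm_of_nonneg hτ.1]
      exact mul_le_of_le_one_left (norm_nonneg _) hτ.2
    refine ⟨hb₂ ?_, hb₁ ?_, hle⟩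
    · rw [Metric.mem_ball, dist_eq_norm, add_sub_cancel_left]
      exact hle.trans_lt (hh.trans_le (min_le_right _ _))
    · rw [dist_zero_right]
      exact hle.trans_lt (hh.trans_le (min_le_left _ _))
  refine ⟨by simpa using (hmem 1 (by simp)).1, ?_⟩
  -- The derivative of `φ` is the first-order Taylor remainder of `m`, paired with `h`. Thus
  -- differentiability of `m` at the single point `c` is enough for a second-order expansion of `U`.
  set φ : ℝ → ℝ := fun τ => U (c + τ * h) - (τ * (m c * h).re + τ ^ 2 * (1 / 2 * (m' h * h).re))
    with hφ
  have hder : ∀ τ ∈ Icc (0 : ℝ) 1, HasDerivWithinAt φ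
      (((m (c + τ * h) - m c - m' (τ * h)) * h).re) (Icc 0 1) τ := by
    intro τ hτ
    have hlin : HasDerivAt (fun τ : ℝ => c + (τ : ℂ) * h) h τ := by
      simpa using ((Complex.ofRealCLM.hasDerivAt (x := τ)).mul_const h).const_add c
    have hU1 := (hU _ (hmem τ hτ).1).comp_hasDerivAt τ hlin
    have hpoly : HasDerivAt (fun τ : ℝ => τ * (m c * h).re + τ ^ 2 * (1 / 2 * (m' h * h).re))
        (1 * (m c * h).re + (2 * τ) * (1 / 2 * (m' h * h).re)) τ := by
      have h2 := hasDerivAt_pow 2 τ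
      norm_num at h2
      exact ((hasDerivAt_id τ).mul_const _).add (h2.mul_const _)
    refine (hU1.sub hpoly).hasDerivWithinAt.congr_deriv ?_
    have e : m' ((τ : ℂ) * h) = (τ : ℂ) * m' h := by
      rw [← Complex.real_smul, map_smul, Complex.real_smul]
    rw [e]
    simp only [ContinuousLinearMap.comp_apply, _root_.smul_apply, ContinuousLinearMap.id_apply,
      Complex.reCLM_apply, smul_eq_mul]
    rw [sub_mul, sub_mul, mul_assoc (τ : ℂ), Complex.sub_re, Complex.sub_re, Complex.re_ofReal_mul]
    ring
  have hbound : ∀ τ ∈ Ico (0 : ℝ) 1,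
      ‖((m (c + τ * h) - m c - m' (τ * h)) * h).re‖ ≤ ε * ‖h‖ ^ 2 := by
    intro τ hτ
    obtain ⟨-, h2, h3⟩ := hmem τ (Ico_subset_Icc_self hτ)
    rw [Real.norm_eq_abs]
    refine (Complex.abs_re_le_norm _).trans ?_
    rw [norm_mul]
    calc _ ≤ ε * ‖h‖ * ‖h‖ := by
          gcongr
          exact h2.trans (by gcongr)
      _ = _ := by ring
  have := norm_image_sub_le_of_norm_deriv_le_segment_01' hder hbound
  rw [Real.norm_eq_abs] at this
  convert this using 2
  simp only [hφ, Complex.ofReal_one, Complex.ofReal_zero, one_mul, zero_mul, add_zero]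
  ring

theorem integral_trig_polynomial (k p q a b d : ℝ) :
    ∫ θ in (0 : ℝ)..2 * Real.pi, (k + (p * Real.cos θ + q * Real.sin θ + (a * Real.cos θ ^ 2 +
      b * (Real.sin θ * Real.cos θ) + d * Real.sin θ ^ 2))) = Real.pi * (2 * k + a + d) := by
  have ii : ∀ f : ℝ → ℝ, Continuous f → IntervalIntegrable f volume 0 (2 * Real.pi) :=
    fun f hf => hf.intervalIntegrable _ _
  rw [intervalIntegral.integral_add (ii _ (by fun_prop)) (ii _ (by fun_prop)),
    intervalIntegral.integral_add (ii _ (by fun_prop)) (ii _ (by fun_prop)),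
    intervalIntegral.integral_add (ii _ (by fun_prop)) (ii _ (by fun_prop)),
    intervalIntegral.integral_add (ii _ (by fun_prop)) (ii _ (by fun_prop)),
    intervalIntegral.integral_add (ii _ (by fun_prop)) (ii _ (by fun_prop))]
  simp only [intervalIntegral.integral_const_mul, integral_cos, integral_sin, integral_cos_sq,
    integral_sin_sq, integral_sin_mul_cos₁, intervalIntegral.integral_const]
  simp
  ring

/-- The real part of `∂m/∂x + i ∂m/∂y`, that is of `2 ∂m/∂z̄`, for a differential `L` of `m`. -/
noncomputable def reDbar (L : ℂ →L[ℝ] ℂ) : ℝ := (L 1 + Complex.I * L Complex.I).re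

/-- The linear and mixed terms average to zero, and `reDbar L` is the Laplacian of the quadratic
part: its second derivatives are `Re (L 1)` and `Re (i L i)`. -/
theorem circleAverage_taylor (u : ℝ) (m₀ : ℂ) (L : ℂ →L[ℝ] ℂ) (c : ℂ) (r : ℝ) :
    Real.circleAverage (fun x => u + (m₀ * (x - c)).re + 1 / 2 * (L (x - c) * (x - c)).re) c r =
      u + r ^ 2 / 4 * reDbar L := by
  rw [circleAverage_real]
  have e : ∀ θ : ℝ, u + (m₀ * (circleMap c r θ - c)).re +
      1 / 2 * (L (circleMap c r θ - c) * (circleMap c r θ - c)).re =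
      u + ((r * m₀.re) * Real.cos θ + (-(r * m₀.im)) * Real.sin θ +
        ((r ^ 2 / 2 * (L 1).re) * Real.cos θ ^ 2 +
          (r ^ 2 / 2 * ((L Complex.I).re - (L 1).im)) * (Real.sin θ * Real.cos θ) +
          (r ^ 2 / 2 * (-(L Complex.I).im)) * Real.sin θ ^ 2)) := by
    intro θ
    have h : circleMap c r θ - c = ((r * Real.cos θ : ℝ) : ℂ) * 1 +
        ((r * Real.sin θ : ℝ) : ℂ) * Complex.I := by
      rw [circleMap, Complex.exp_mul_I]
      push_cast
      ring
    have hL : L (circleMap c r θ - c) = ((r * Real.cos θ : ℝ) : ℂ) * L 1 +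
        ((r * Real.sin θ : ℝ) : ℂ) * L Complex.I := by
      rw [h, map_add, ← Complex.real_smul, ← Complex.real_smul, map_smul, map_smul,
        Complex.real_smul, Complex.real_smul]
    rw [hL, h]
    simp only [Complex.add_re, Complex.mul_re, Complex.add_im, Complex.mul_im, Complex.ofReal_re,
      Complex.ofReal_im, Complex.one_re, Complex.one_im, Complex.I_re, Complex.I_im]
    ring
  simp_rw [e]
  rw [integral_trig_polynomial, reDbar]
  have hpi := Real.pi_ne_zero
  simp only [Complex.add_re, Complex.mul_re, Complex.I_re, Complex.I_im]
  field_simp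
  ring

theorem abs_circleAverage_sub_le {D : Set ℂ} (hD : IsOpen D) {U : ℂ → ℝ} {m : ℂ → ℂ}
    {m' : ℂ →L[ℝ] ℂ}
    (hU : ∀ x ∈ D, HasFDerivAt U (Complex.reCLM.comp (m x • ContinuousLinearMap.id ℝ ℂ)) x)
    {c : ℂ} (hc : c ∈ D) (hm : HasFDerivAt m m' c) {ε : ℝ} (hε : 0 < ε) :
    ∃ δ > 0, ∀ r, 0 < r → r < δ → Metric.closedBall c r ⊆ D ∧
      |Real.circleAverage U c r - (U c + r ^ 2 / 4 * reDbar m')| ≤ ε * r ^ 2 := by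
  obtain ⟨δ, hδ, h⟩ := abs_sub_taylor_le hD hU hc hm hε
  refine ⟨δ, hδ, fun r hr hrδ => ?_⟩
  have hball : Metric.closedBall c r ⊆ D := fun x hx => by
    have := (h (x - c) (by
      rw [Metric.mem_closedBall, dist_eq_norm] at hx
      exact hx.trans_lt hrδ)).1
    simpa using this
  refine ⟨hball, ?_⟩
  have hi : CircleIntegrable U c r := by
    refine ContinuousOn.circleIntegrable' fun x hx => ?_
    rw [abs_of_pos hr] at hx
    exact (hU x (hball (Metric.sphere_subset_closedBall hx))).continuousAt.continuousWithinAt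
  have hi2 : CircleIntegrable
      (fun x => U c + (m c * (x - c)).re + 1 / 2 * (m' (x - c) * (x - c)).re) c r := by
    refine Continuous.continuousOn ?_ |>.circleIntegrable'
    have : Continuous fun x : ℂ => m' (x - c) := m'.continuous.comp (by fun_prop)
    fun_prop
  rw [← circleAverage_taylor (U c) (m c) m' c r, ← Real.circleAverage_fun_sub hi hi2]
  refine Real.abs_circleAverage_le_circleAverage_abs.trans ?_
  refine Real.circleAverage_mono_on_of_le_circle (hi.sub hi2).abs fun x hx => ?_
  rw [abs_of_pos hr, mem_sphere_iff_norm] at hx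
  have := (h (x - c) (hx.trans_lt hrδ)).2
  rw [add_sub_cancel, hx] at this
  exact this

/-- For concentric circles the kernel difference equals `log(r'/r)` on the small disc and vanishes
outside the large one. Together with the reverse bound below, increments of circle averages thus
enclose the masses of discs. -/
theorem logKernelDiff_self_le (c ζ : ℂ) {r r' : ℝ} (hr : 0 < r) (h : r ≤ r') :
    logKernelDiff c r' c r ζ ≤
      (Metric.closedBall c r').indicator (fun _ => Real.log (r' / r)) ζ := by
  have hr' := hr.trans_le h
  unfold logKernelDiff
  by_cases hζ : ζ ∈ Metric.closedBall c r'
  · rw [indicator_of_mem hζ]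
    rw [Metric.mem_closedBall, dist_eq_norm, norm_sub_rev] at hζ
    rw [max_eq_left hζ, Real.log_div hr'.ne' hr.ne']
    linarith [Real.log_le_log hr (le_max_left r ‖c - ζ‖)]
  · rw [indicator_of_notMem hζ]
    rw [Metric.mem_closedBall, dist_eq_norm, norm_sub_rev, not_le] at hζ
    rw [max_eq_right hζ.le, max_eq_right (h.trans hζ.le), sub_self]

theorem le_logKernelDiff_self (c ζ : ℂ) {r r' : ℝ} (hr : 0 < r) (h : r ≤ r') :
    (Metric.closedBall c r).indicator (fun _ => Real.log (r' / r)) ζ ≤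
      logKernelDiff c r' c r ζ := by
  have hr' := hr.trans_le h
  unfold logKernelDiff
  by_cases hζ : ζ ∈ Metric.closedBall c r
  · rw [indicator_of_mem hζ]
    rw [Metric.mem_closedBall, dist_eq_norm, norm_sub_rev] at hζ
    rw [max_eq_left (hζ.trans h), max_eq_left hζ, Real.log_div hr'.ne' hr.ne']
  · rw [indicator_of_notMem hζ, sub_nonneg]
    exact Real.log_le_log (lt_max_of_lt_left hr) (max_le_max_right _ h)

/-- Small discs have mass asymptotic to half the Laplacian times the squared radius, if the circle
averages of `U` are those of the logarithmic potential of `ν`. -/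
theorem eventually_abs_measureReal_closedBall_sub_le {ν : Measure ℂ} [IsFiniteMeasure ν]
    {D : Set ℂ} (hD : IsOpen D) {U : ℂ → ℝ} {m : ℂ → ℂ} {m' : ℂ →L[ℝ] ℂ}
    (hU : ∀ x ∈ D, HasFDerivAt U (Complex.reCLM.comp (m x • ContinuousLinearMap.id ℝ ℂ)) x)
    {c : ℂ} (hc : c ∈ D) (hm : HasFDerivAt m m' c)
    (hν : ∀ r r' : ℝ, 0 < r → r ≤ r' → Metric.closedBall c r' ⊆ D →
      Real.circleAverage U c r' - Real.circleAverage U c r = ∫ ζ, logKernelDiff c r' c r ζ ∂ν) :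
    0 ≤ reDbar m' ∧ ∀ ε > 0, ∀ᶠ r in 𝓝[>] (0 : ℝ),
      |ν.real (Metric.closedBall c r) - reDbar m' / 2 * r ^ 2| ≤ ε * r ^ 2 := by
  set σ := reDbar m'
  have hind : ∀ a b : ℝ, ∫ ζ, (Metric.closedBall c a).indicator (fun _ => b) ζ ∂ν =
      ν.real (Metric.closedBall c a) * b := fun a b => by
    rw [integral_indicator_const b Metric.isClosed_closedBall.measurableSet, smul_eq_mul]
  have hindi : ∀ a b : ℝ, Integrable ((Metric.closedBall c a).indicator fun _ => b) ν :=
    fun a b => (integrable_const b).indicator Metric.isClosed_closedBall.measurableSet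
  have hlow : ∀ r r' : ℝ, 0 < r → r ≤ r' → Metric.closedBall c r' ⊆ D →
      ν.real (Metric.closedBall c r) * Real.log (r' / r) ≤
        Real.circleAverage U c r' - Real.circleAverage U c r := fun r r' hr hrr' hb => by
    rw [hν r r' hr hrr' hb, ← hind]
    exact integral_mono (hindi _ _) (integrable_logKernelDiff c c (hr.trans_le hrr') hr)
      fun ζ => le_logKernelDiff_self c ζ hr hrr'
  have hupp : ∀ r r' : ℝ, 0 < r → r ≤ r' → Metric.closedBall c r' ⊆ D →
      Real.circleAverage U c r' - Real.circleAverage U c r ≤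
        ν.real (Metric.closedBall c r') * Real.log (r' / r) := fun r r' hr hrr' hb => by
    rw [hν r r' hr hrr' hb, ← hind]
    exact integral_mono (integrable_logKernelDiff c c (hr.trans_le hrr') hr) (hindi _ _)
      fun ζ => logKernelDiff_self_le c ζ hr hrr'
  have hσ : 0 ≤ σ := by
    refine le_of_forall_pos_le_add fun ε hε => ?_
    obtain ⟨δ, hδ, h⟩ := abs_circleAverage_sub_le hD hU hc hm (show 0 < ε / 10 by linarith)
    have h1 := h (δ / 4) (by linarith) (by linarith)
    have h2 := h (2 * (δ / 4)) (by linarith) (by linarith)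
    have h3 := hlow (δ / 4) (2 * (δ / 4)) (by linarith) (by linarith) h2.1
    have h4 : 0 ≤ ν.real (Metric.closedBall c (δ / 4)) * Real.log (2 * (δ / 4) / (δ / 4)) :=
      mul_nonneg measureReal_nonneg (Real.log_nonneg (by
        rw [mul_div_assoc, div_self (by linarith)]; norm_num))
    have h5 := (abs_le.1 h1.2).1
    have h6 := (abs_le.1 h2.2).2
    have h7 : 0 < δ ^ 2 := by positivity
    have h8 : 0 ≤ (σ + ε) * δ ^ 2 := by nlinarith
    exact nonneg_of_mul_nonneg_left h8 h7
  refine ⟨hσ, fun ε hε => ?_⟩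
  -- The radius `r` is compared with `r/(1 + η)` and `r(1 + η)`, then one divides by `log(1 + η)`,
  -- which is of order `η`. The finite thickness of the annulus costs at most `σ η r²`, and a Taylor
  -- error proportional to `ε η` leaves only a fraction of `ε`.
  obtain ⟨η, hη0, hη1, hση⟩ : ∃ η : ℝ, 0 < η ∧ η ≤ 1 ∧ σ * η ≤ ε / 2 := by
    refine ⟨min 1 (ε / (2 * (σ + 1))), lt_min one_pos (by positivity), min_le_left _ _, ?_⟩
    calc σ * min 1 (ε / (2 * (σ + 1))) ≤ σ * (ε / (2 * (σ + 1))) := by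
          gcongr; exact min_le_right _ _
      _ = ε / 2 * (σ / (σ + 1)) := by field_simp
      _ ≤ ε / 2 * 1 := by gcongr; exact (div_le_one (by positivity)).2 (by linarith)
      _ = ε / 2 := mul_one _
  obtain ⟨δ, hδ, h⟩ := abs_circleAverage_sub_le hD hU hc hm
    (show 0 < ε * η / 40 by positivity)
  have hev : ∀ᶠ r in 𝓝[>] (0 : ℝ), r < δ / 2 :=
    (gt_mem_nhds (show (0 : ℝ) < δ / 2 by linarith)).filter_mono nhdsWithin_le_nhds
  filter_upwards [hev, self_mem_nhdsWithin] with r hrδ hr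
  have hr0 : 0 < r := hr
  have hr2 : 0 < r ^ 2 := by positivity
  have h1η : 0 < 1 + η := by linarith
  have hb := h r hr0 (by linarith)
  rw [abs_le]
  constructor
  · have hs0 : 0 < r / (1 + η) := by positivity
    have hsr : r / (1 + η) ≤ r := div_le_self hr0.le (by linarith)
    have hs := h (r / (1 + η)) hs0 (by linarith)
    have h3 := hupp (r / (1 + η)) r hs0 hsr hb.1
    rw [show r / (r / (1 + η)) = 1 + η by field_simp] at h3
    have h4 : Real.log (1 + η) ≤ η := by
      linarith [Real.log_le_sub_one_of_pos h1η]
    have h5 : ν.real (Metric.closedBall c r) * Real.log (1 + η) ≤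
        ν.real (Metric.closedBall c r) * η := mul_le_mul_of_nonneg_left h4 measureReal_nonneg
    have h6 := (abs_le.1 hb.2).1
    have h7 := (abs_le.1 hs.2).2
    have h8 : (r / (1 + η)) ^ 2 ≤ r ^ 2 := by gcongr
    have h9 : (r / (1 + η)) ^ 2 ≤ r ^ 2 - r ^ 2 * (η * (2 - 4 * η)) := by
      rw [div_pow, div_le_iff₀ (by positivity)]
      have : 0 ≤ r ^ 2 * (η ^ 2 * (6 * η + 4 * η ^ 2)) := by positivity
      nlinarith [mul_pos hr2 (pow_pos hη0 2), mul_pos hr2 (pow_pos hη0 3)]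
    have h10 : σ / 4 * (r ^ 2 * (η * (2 - 4 * η))) ≤ σ / 4 * (r ^ 2 - (r / (1 + η)) ^ 2) := by
      gcongr; linarith
    have h11 : ε * η / 40 * (r / (1 + η)) ^ 2 ≤ ε * η / 40 * r ^ 2 := by gcongr
    have h12 : σ * η * (r ^ 2 * η) ≤ ε / 2 * (r ^ 2 * η) := by gcongr
    have h13 : 0 < ε * η * r ^ 2 := by positivity
    have h14 : (σ / 2 * r ^ 2 - ε * r ^ 2) * η ≤ ν.real (Metric.closedBall c r) * η := by
      nlinarith
    have := le_of_mul_le_mul_right h14 hη0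
    linarith
  · have hrs : r ≤ r * (1 + η) := le_mul_of_one_le_right hr0.le (by linarith)
    have hs := h (r * (1 + η)) (by positivity) (by nlinarith)
    have h3 := hlow r (r * (1 + η)) hr0 hrs hs.1
    rw [mul_div_cancel_left₀ _ hr0.ne'] at h3
    have h4 : η / (1 + η) ≤ Real.log (1 + η) := by
      have := Real.one_sub_inv_le_log_of_pos h1η
      refine le_trans (le_of_eq ?_) this
      field_simp
      ring
    have h5 : ν.real (Metric.closedBall c r) * (η / (1 + η)) ≤
        ν.real (Metric.closedBall c r) * Real.log (1 + η) :=
      mul_le_mul_of_nonneg_left h4 measureReal_nonneg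
    have h6 := (abs_le.1 hb.2).1
    have h7 := (abs_le.1 hs.2).2
    have h8 : ν.real (Metric.closedBall c r) * (η / (1 + η)) ≤
        σ / 4 * r ^ 2 * (2 * η + η ^ 2) + ε * η / 40 * r ^ 2 * ((1 + η) ^ 2 + 1) := by
      nlinarith
    have h9 : ν.real (Metric.closedBall c r) * η ≤
        (σ / 4 * r ^ 2 * (2 * η + η ^ 2) + ε * η / 40 * r ^ 2 * ((1 + η) ^ 2 + 1)) * (1 + η) := by
      rwa [← mul_div_assoc, div_le_iff₀ h1η] at h8
    have h10 : (1 + η) * ((1 + η) ^ 2 + 1) ≤ 10 := by nlinarith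
    have h11 : (2 + η) * (1 + η) ≤ 2 + 4 * η := by nlinarith
    have h12 : σ / 4 * r ^ 2 * η * ((2 + η) * (1 + η)) ≤ σ / 4 * r ^ 2 * η * (2 + 4 * η) := by
      gcongr
    have h13 : ε * η / 40 * r ^ 2 * ((1 + η) * ((1 + η) ^ 2 + 1)) ≤ ε * η / 40 * r ^ 2 * 10 := by
      gcongr
    have h14 : σ * η * (r ^ 2 * η) ≤ ε / 2 * (r ^ 2 * η) := by gcongr
    have h15 : 0 < ε * η * r ^ 2 := by positivity
    have h16 : ν.real (Metric.closedBall c r) * η ≤ (σ / 2 * r ^ 2 + ε * r ^ 2) * η := by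
      nlinarith
    have := le_of_mul_le_mul_right h16 hη0
    linarith

/-! ### Densities from disc masses by Besicovitch differentiation -/

/-- Comparison of two measures whose densities on small discs are comparable. -/
theorem measure_le_of_closedBall_density {μ₁ μ₂ : Measure ℂ} [IsLocallyFiniteMeasure μ₁]
    [IsLocallyFiniteMeasure μ₂] {f : ℂ → ℝ} {s : Set ℂ} (hs : volume s ≠ ∞)
    (h₁ : ∀ x ∈ s, ∀ ε > 0, ∀ᶠ r in 𝓝[>] (0 : ℝ), μ₁ (Metric.closedBall x r) ≤
      ENNReal.ofReal (f x + ε) * volume (Metric.closedBall x r))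
    (h₂ : ∀ x ∈ s, ∀ ε > 0, ∀ᶠ r in 𝓝[>] (0 : ℝ),
      ENNReal.ofReal (f x - ε) * volume (Metric.closedBall x r) ≤ μ₂ (Metric.closedBall x r)) :
    μ₁ s ≤ μ₂ s := by
  -- Adding `ε` times Lebesgue measure to `μ₂` makes the comparison exact on small discs. The finite
  -- volume of `s` then allows `ε → 0`.
  have key : ∀ ε : ℝ, 0 < ε → μ₁ s ≤ μ₂ s + ENNReal.ofReal ε * volume s := by
    intro ε hε
    have hlf : IsLocallyFiniteMeasure (μ₂ + ENNReal.ofReal ε • (volume : Measure ℂ)) := by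
      refine ⟨fun x => ?_⟩
      obtain ⟨u, hu, hfu⟩ := μ₂.finiteAt_nhds x
      refine ⟨u ∩ Metric.ball x 1, inter_mem hu (Metric.ball_mem_nhds x one_pos), ?_⟩
      rw [Measure.add_apply, Measure.smul_apply, smul_eq_mul]
      exact ENNReal.add_lt_top.2 ⟨(measure_mono inter_subset_left).trans_lt hfu,
        ENNReal.mul_lt_top ENNReal.ofReal_lt_top
          ((measure_mono inter_subset_right).trans_lt measure_ball_lt_top)⟩
    have hle := (Besicovitch.vitaliFamily μ₁).measure_le_of_frequently_le
      (ρ := μ₁) (μ₂ + ENNReal.ofReal ε • volume) Measure.AbsolutelyContinuous.rfl s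
      fun x hx => by
        refine (Besicovitch.tendsto_filterAt μ₁ x).frequently (Eventually.frequently ?_)
        filter_upwards [h₁ x hx (ε / 2) (half_pos hε), h₂ x hx (ε / 2) (half_pos hε)] with r a b
        refine a.trans ?_
        rw [Measure.add_apply, Measure.smul_apply, smul_eq_mul]
        refine le_trans ?_ (add_le_add_left b _)
        rw [← add_mul]
        gcongr
        refine le_trans (le_of_eq ?_) (ENNReal.ofReal_add_le)
        congr 1
        ring
    rwa [Measure.add_apply, Measure.smul_apply, smul_eq_mul] at hle
  have hlim : Tendsto (fun ε : ℝ => μ₂ s + ENNReal.ofReal ε * volume s) (𝓝[>] 0)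
      (𝓝 (μ₂ s + ENNReal.ofReal 0 * volume s)) := by
    refine Tendsto.mono_left ?_ nhdsWithin_le_nhds
    exact tendsto_const_nhds.add (ENNReal.Tendsto.mul_const
      (ENNReal.continuous_ofReal.tendsto 0) (Or.inr hs))
  rw [ENNReal.ofReal_zero, zero_mul, add_zero] at hlim
  exact ge_of_tendsto hlim (eventually_mem_nhdsWithin.mono fun ε hε => key ε hε)

theorem closedBall_density_of_abs_le {ν : Measure ℂ} [IsFiniteMeasure ν] {x : ℂ} {ρ : ℝ}
    (h : ∀ ε > 0, ∀ᶠ r in 𝓝[>] (0 : ℝ),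
      |ν.real (Metric.closedBall x r) - ρ * Real.pi * r ^ 2| ≤ ε * r ^ 2) {ε : ℝ} (hε : 0 < ε) :
    ∀ᶠ r in 𝓝[>] (0 : ℝ), ν (Metric.closedBall x r) ≤
        ENNReal.ofReal (ρ + ε) * volume (Metric.closedBall x r) ∧
      ENNReal.ofReal (ρ - ε) * volume (Metric.closedBall x r) ≤ ν (Metric.closedBall x r) := by
  filter_upwards [h ε hε, self_mem_nhdsWithin] with r hr hr0
  have hr0' : 0 < r := hr0
  have hvol : volume (Metric.closedBall x r) = ENNReal.ofReal (Real.pi * r ^ 2) := by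
    rw [Complex.volume_closedBall, mul_comm Real.pi, ENNReal.ofReal_mul (by positivity),
      ENNReal.ofReal_pow hr0'.le]
    congr 1
    exact (ENNReal.ofReal_coe_nnreal (p := NNReal.pi)).symm
  have hνr : ν (Metric.closedBall x r) = ENNReal.ofReal (ν.real (Metric.closedBall x r)) :=
    (ofReal_measureReal (measure_ne_top _ _)).symm
  obtain ⟨h1, h2⟩ := abs_le.1 hr
  have hpi : (1 : ℝ) ≤ Real.pi := by linarith [Real.pi_gt_three]
  have h3 : ε * r ^ 2 * 1 ≤ ε * r ^ 2 * Real.pi := by gcongr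
  rw [hvol, hνr, ← ENNReal.ofReal_mul' (by positivity), ← ENNReal.ofReal_mul' (by positivity)]
  exact ⟨ENNReal.ofReal_le_ofReal (by nlinarith), ENNReal.ofReal_le_ofReal (by nlinarith)⟩

theorem closedBall_density_withDensity {D : Set ℂ} (hD : IsOpen D) {f : ℂ → ℝ}
    (hf : ContinuousOn f D) {x : ℂ} (hx : x ∈ D) {ε : ℝ} (hε : 0 < ε) :
    ∀ᶠ r in 𝓝[>] (0 : ℝ), volume.withDensity (D.indicator fun y => ENNReal.ofReal (f y))
        (Metric.closedBall x r) ≤ ENNReal.ofReal (f x + ε) * volume (Metric.closedBall x r) ∧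
      ENNReal.ofReal (f x - ε) * volume (Metric.closedBall x r) ≤
        volume.withDensity (D.indicator fun y => ENNReal.ofReal (f y)) (Metric.closedBall x r) := by
  have hnear : ∀ᶠ y in 𝓝 x, y ∈ D ∧ f y ≤ f x + ε ∧ f x - ε ≤ f y := by
    have hc := hf.continuousAt (hD.mem_nhds hx)
    filter_upwards [hD.mem_nhds hx, hc.eventually (gt_mem_nhds (lt_add_of_pos_right (f x) hε)),
      hc.eventually (lt_mem_nhds (sub_lt_self (f x) hε))] with y a b c
    exact ⟨a, b.le, c.le⟩
  obtain ⟨δ, hδ, hball⟩ := Metric.nhds_basis_closedBall.eventually_iff.1 hnear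
  have hev : ∀ᶠ r in 𝓝[>] (0 : ℝ), r < δ := (gt_mem_nhds hδ).filter_mono nhdsWithin_le_nhds
  filter_upwards [hev] with r hr
  have hms : MeasurableSet (Metric.closedBall x r) := Metric.isClosed_closedBall.measurableSet
  have hb : ∀ y ∈ Metric.closedBall x r, y ∈ D ∧ f y ≤ f x + ε ∧ f x - ε ≤ f y := fun y hy =>
    hball (Metric.closedBall_subset_closedBall hr.le hy)
  rw [withDensity_apply _ hms, ← setLIntegral_const, ← setLIntegral_const]
  constructor
  · refine setLIntegral_mono' hms fun y hy => ?_
    rw [indicator_of_mem (hb y hy).1]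
    exact ENNReal.ofReal_le_ofReal (hb y hy).2.1
  · refine setLIntegral_mono' hms fun y hy => ?_
    rw [indicator_of_mem (hb y hy).1]
    exact ENNReal.ofReal_le_ofReal (hb y hy).2.2

/-- A finite measure whose masses of small discs have a continuous density on an open set is
absolutely continuous there, with this density. -/
theorem restrict_eq_withDensity_of_closedBall {ν : Measure ℂ} [IsFiniteMeasure ν] {D : Set ℂ}
    (hD : IsOpen D) {f : ℂ → ℝ} (hf : ContinuousOn f D)
    (h : ∀ x ∈ D, ∀ ε > 0, ∀ᶠ r in 𝓝[>] (0 : ℝ),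
      |ν.real (Metric.closedBall x r) - f x * Real.pi * r ^ 2| ≤ ε * r ^ 2) {s : Set ℂ}
    (hs : MeasurableSet s) (hsD : s ⊆ D) : ν s = ∫⁻ x in s, ENNReal.ofReal (f x) := by
  -- On each `V n` both the volume and the density are bounded, so the comparison measure is finite.
  -- The sets exhaust `D`.
  set V : ℕ → Set ℂ := fun n => {x | x ∈ D ∧ f x < n ∧ ‖x‖ < n} with hV
  have hVo : ∀ n, IsOpen (V n) := fun n => by
    have h1 : IsOpen (D ∩ f ⁻¹' Iio (n : ℝ)) := hf.isOpen_inter_preimage hD isOpen_Iio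
    have h2 : IsOpen {x : ℂ | ‖x‖ < n} := isOpen_lt continuous_norm continuous_const
    convert h1.inter h2 using 1
    ext x
    simp only [hV, mem_ofPred_eq, mem_inter_iff, mem_preimage, mem_Iio]
    tauto
  have hVmono : Monotone V := fun i j hij x hx => by
    have : (i : ℝ) ≤ j := by exact_mod_cast hij
    exact ⟨hx.1, hx.2.1.trans_le this, hx.2.2.trans_le this⟩
  have hVU : s = ⋃ n, s ∩ V n := by
    rw [← inter_iUnion]
    refine (inter_eq_left.2 fun x hx => ?_).symm
    obtain ⟨n, hn⟩ := exists_nat_gt (max (f x) ‖x‖)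
    exact mem_iUnion.2 ⟨n, hsD hx, (le_max_left _ _).trans_lt hn, (le_max_right _ _).trans_lt hn⟩
  have hpiece : ∀ n, ν (s ∩ V n) = ∫⁻ x in s ∩ V n, ENNReal.ofReal (f x) := by
    intro n
    set lam := (volume : Measure ℂ).withDensity ((V n).indicator fun y => ENNReal.ofReal (f y))
    have hVfin : volume (V n) < ∞ := by
      refine (measure_mono fun x hx => ?_).trans_lt (measure_ball_lt_top (x := (0 : ℂ)) (r := n))
      simpa using hx.2.2
    have hlam : IsFiniteMeasure lam := by
      refine isFiniteMeasure_withDensity (ne_top_of_le_ne_top (b := (n : ℝ≥0∞) * volume (V n))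
        (ENNReal.mul_lt_top (ENNReal.natCast_lt_top n) hVfin).ne ?_)
      rw [lintegral_indicator (hVo n).measurableSet, ← setLIntegral_const]
      refine setLIntegral_mono' (hVo n).measurableSet fun y hy => ?_
      exact ENNReal.ofReal_le_of_le_toReal (by simpa using hy.2.1.le)
    have hms : MeasurableSet (s ∩ V n) := hs.inter (hVo n).measurableSet
    have hfin : volume (s ∩ V n) ≠ ∞ := ((measure_mono inter_subset_right).trans_lt hVfin).ne
    have hd := fun x (hx : x ∈ s ∩ V n) ε (hε : 0 < ε) =>
      closedBall_density_of_abs_le (h x (hsD hx.1)) hε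
    have hd' := fun x (hx : x ∈ s ∩ V n) ε (hε : 0 < ε) =>
      closedBall_density_withDensity (hVo n) (hf.mono fun y hy => hy.1) hx.2 hε
    have heq : ν (s ∩ V n) = lam (s ∩ V n) := le_antisymm
      (measure_le_of_closedBall_density hfin (fun x hx ε hε => (hd x hx ε hε).mono fun _ a => a.1)
        (fun x hx ε hε => (hd' x hx ε hε).mono fun _ a => a.2))
      (measure_le_of_closedBall_density hfin (fun x hx ε hε => (hd' x hx ε hε).mono fun _ a => a.1)
        (fun x hx ε hε => (hd x hx ε hε).mono fun _ a => a.2))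
    rw [heq, withDensity_apply _ hms]
    exact setLIntegral_congr_fun hms fun x hx => indicator_of_mem hx.2 _
  have hm : Monotone fun n => s ∩ V n := fun i j hij => inter_subset_inter_right _ (hVmono hij)
  have hD1 := tendsto_measure_iUnion_atTop (μ := ν) hm
  have hms : ∀ n, MeasurableSet (s ∩ V n) := fun n => hs.inter (hVo n).measurableSet
  have hD2 := tendsto_measure_iUnion_atTop
    (μ := (volume : Measure ℂ).withDensity fun x => ENNReal.ofReal (f x)) hm
  have e : ∀ n, (volume : Measure ℂ).withDensity (fun x => ENNReal.ofReal (f x)) (s ∩ V n) =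
      ν (s ∩ V n) := fun n => by rw [withDensity_apply _ (hms n), hpiece n]
  simp only [Function.comp_def, e, ← hVU] at hD1 hD2
  rw [tendsto_nhds_unique hD1 hD2, withDensity_apply _ hs]

/-- Local density of the limiting zero distribution in terms of the differential of its
logarithmic potential. -/
theorem measure_eq_lintegral_reDbar {ν : Measure ℂ} [IsFiniteMeasure ν] {D : Set ℂ}
    (hD : IsOpen D) {U : ℂ → ℝ} {m : ℂ → ℂ}
    (hU : ∀ x ∈ D, HasFDerivAt U (Complex.reCLM.comp (m x • ContinuousLinearMap.id ℝ ℂ)) x)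
    (hm : ContDiffOn ℝ 1 m D)
    (hν : ∀ (c : ℂ) (r r' : ℝ), 0 < r → r ≤ r' → Metric.closedBall c r' ⊆ D →
      Real.circleAverage U c r' - Real.circleAverage U c r = ∫ ζ, logKernelDiff c r' c r ζ ∂ν) :
    (∀ x ∈ D, 0 ≤ reDbar (fderiv ℝ m x)) ∧ ∀ s, MeasurableSet s → s ⊆ D →
      ν s = ∫⁻ x in s, ENNReal.ofReal (reDbar (fderiv ℝ m x) / (2 * Real.pi)) := by
  have hmd : ∀ x ∈ D, HasFDerivAt m (fderiv ℝ m x) x := fun x hx =>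
    ((hm.contDiffAt (hD.mem_nhds hx)).differentiableAt one_ne_zero).hasFDerivAt
  have hball := fun x (hx : x ∈ D) =>
    eventually_abs_measureReal_closedBall_sub_le hD hU hx (hmd x hx) (hν x)
  refine ⟨fun x hx => (hball x hx).1, fun s hs hsD => ?_⟩
  refine restrict_eq_withDensity_of_closedBall hD ?_ (fun x hx ε hε => ?_) hs hsD
  · have hc : ContinuousOn (fderiv ℝ m) D := hm.continuousOn_fderiv_of_isOpen hD le_rfl
    have h1 : ContinuousOn (fun x => fderiv ℝ m x 1) D := hc.clm_apply continuousOn_const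
    have h2 : ContinuousOn (fun x => fderiv ℝ m x Complex.I) D := hc.clm_apply continuousOn_const
    refine ContinuousOn.div_const ?_ _
    exact Complex.continuous_re.comp_continuousOn (h1.add (continuousOn_const.mul h2))
  · refine ((hball x hx).2 ε hε).mono fun r hr => ?_
    have hpi := Real.pi_ne_zero
    rwa [show reDbar (fderiv ℝ m x) / (2 * Real.pi) * Real.pi * r ^ 2 =
      reDbar (fderiv ℝ m x) / 2 * r ^ 2 by field_simp]

/-! ### Density of the limiting zero distribution -/

/-- The points with some slit passing through them lie on a line. -/
theorem exists_line_compl_subset_offSlit (t : ℂ) :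
    ∃ v : ℂ, v ≠ 0 ∧ ∀ z, (starRingEnd ℂ v * z).im ≠ 0 → z ∈ offSlit t := by
  -- For `β ≥ 0` the roots of `tβ` are real multiples of a root `v` of `t`, so all slits lie on `ℝ
  -- v`. For `t = 0` any line through the origin serves, since only `z = 0` has to be avoided.
  obtain ⟨v, hv, hvt⟩ : ∃ v : ℂ, v ≠ 0 ∧ (t = 0 ∨ v ^ 2 = t) := by
    by_cases ht : t = 0
    · exact ⟨1, one_ne_zero, Or.inl ht⟩
    · refine ⟨t ^ (1 / 2 : ℂ), fun h => ht ?_, Or.inr (sq_cpow_half t)⟩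
      rw [← sq_cpow_half t, h]; ring
  refine ⟨v, hv, fun z hz => ?_⟩
  have hz0 : z ≠ 0 := fun h => hz (by simp [h])
  refine ⟨hz0, fun β hβ => ?_⟩
  by_contra hslit
  rw [Complex.mem_slitPlane_iff, not_or, not_lt, not_not] at hslit
  set x := 1 - 4 * (t * β) / z ^ 2 with hx
  have hxr : x = ((x.re : ℝ) : ℂ) := Complex.ext rfl (by simpa using hslit.2)
  have h1 : 4 * (t * β) = ((1 - x.re : ℝ) : ℂ) * z ^ 2 := by
    push_cast
    rw [← hxr, hx]
    field_simp
    ring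
  have hpos : 0 < 1 - x.re := by linarith [hslit.1]
  have hposc : ((1 - x.re : ℝ) : ℂ) ≠ 0 := by exact_mod_cast hpos.ne'
  rcases hvt with ht | ht
  · rw [ht, zero_mul, mul_zero] at h1
    exact mul_ne_zero hposc (pow_ne_zero 2 hz0) h1.symm
  · set u := starRingEnd ℂ v * z with hu
    have h2 : ((1 - x.re : ℝ) : ℂ) * u ^ 2 = ((4 * β * ‖t‖ ^ 2 : ℝ) : ℂ) := by
      have e : starRingEnd ℂ t * t = ((‖t‖ ^ 2 : ℝ) : ℂ) := by
        rw [mul_comm, Complex.mul_conj, Complex.normSq_eq_norm_sq]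
      calc ((1 - x.re : ℝ) : ℂ) * u ^ 2
          = starRingEnd ℂ (v ^ 2) * (((1 - x.re : ℝ) : ℂ) * z ^ 2) := by
            rw [hu, map_pow]; ring
        _ = 4 * β * (starRingEnd ℂ t * t) := by rw [← h1, ht]; ring
        _ = _ := by rw [e]; push_cast; ring
    have him := congrArg Complex.im h2
    have hre := congrArg Complex.re h2
    rw [Complex.im_ofReal_mul, Complex.ofReal_im, sq, Complex.mul_im] at him
    rw [Complex.re_ofReal_mul, Complex.ofReal_re, sq, Complex.mul_re] at hre
    have h3 : u.re = 0 := by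
      have : u.re * u.im = 0 := by
        have := (mul_eq_zero.1 him).resolve_left hpos.ne'
        linarith
      exact (mul_eq_zero.1 this).resolve_right hz
    rw [h3] at hre
    have h4 : 0 < u.im * u.im := mul_self_pos.2 hz
    have h5 : 0 ≤ 4 * β * ‖t‖ ^ 2 := by have := hβ.1; positivity
    nlinarith

/-- Density of the limiting zero distribution on an open set where the exponential growth rate is
differentiable. -/
theorem limit_measure_eq_lintegral {Ω : Type*} [MeasurableSpace Ω] {P : Measure Ω}
    [IsProbabilityMeasure P] {ξ : ℕ → Ω → ℂ} {a : ℕ → ℕ → ℂ} {g : ℝ → ℝ} (hA1 : CondA1 P ξ)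
    (hA2 : CondA2 a g) {t : ℂ} {ν : Measure ℂ} (hν : IsLimitZeroDistribution P ξ a t ν)
    {D : Set ℂ} (hD : IsOpen D) {U : ℂ → ℝ} {m : ℂ → ℂ}
    (hU : ∀ x ∈ D, HasFDerivAt U (Complex.reCLM.comp (m x • ContinuousLinearMap.id ℝ ℂ)) x)
    (hm : ContDiffOn ℝ 1 m D)
    (hmax : ∀ z ∈ D, z ≠ 0 → (∀ β ∈ Icc (0 : ℝ) 1, g β + growth t β z ≤ U z) ∧
      ∃ β ∈ Icc (0 : ℝ) 1, U z = g β + growth t β z) :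
    (∀ x ∈ D, 0 ≤ reDbar (fderiv ℝ m x)) ∧ ∀ s, MeasurableSet s → s ⊆ D →
      ν s = ∫⁻ x in s, ENNReal.ofReal (reDbar (fderiv ℝ m x) / (2 * Real.pi)) := by
  have := hν.isProbabilityMeasure
  obtain ⟨v, hv, hvt⟩ := exists_line_compl_subset_offSlit t
  refine measure_eq_lintegral_reDbar hD hU hm fun c r r' hr hr' hc => ?_
  refine circleAverage_sub_circleAverage_eq hD
    (fun x hx => (hU x hx).continuousAt.continuousWithinAt) hv ?_ hr hr' hc
  intro z hz hzl z' s B hs hball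
  obtain ⟨-, β, hβ, hUβ⟩ := hmax z hz (hvt z hzl).1
  rw [hUβ]
  refine sub_le_integral_logKernelDiff hA1 hA2 hν hs (hvt z hzl) (fun x hx => ?_) hβ
    fun x hx γ hγ => ?_
  · exact hvt x (hball x (Metric.sphere_subset_closedBall hx)).2.1
  · obtain ⟨h1, h2, h3⟩ := hball x (Metric.sphere_subset_closedBall hx)
    exact ((hmax x h1 (hvt x h2).1).1 γ hγ).trans h3

/-! ### Maximizers at time `t` and at time `0` -/

theorem strictConcaveOn_profile {a : ℕ → ℕ → ℂ} {g : ℝ → ℝ} (hA2 : CondA2 a g) (hA3 : CondA3 g) :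
    StrictConcaveOn ℝ (Icc 0 1) g :=
  strictConcaveOn_of_deriv2_neg (convex_Icc 0 1) hA2.continuousOn fun x hx => by
    rw [interior_Icc] at hx
    exact hA3.deriv2_neg x hx

/-- A maximizer for the evolved problem at `z` is the unique maximizer of the initial problem at
the point `w` from which `z` is reached. -/
theorem lt_of_isMax_growth {g : ℝ → ℝ} (hg : StrictConcaveOn ℝ (Icc 0 1) g) {t z : ℂ} {α : ℝ}
    (hα : α ∈ Icc (0 : ℝ) 1) (hz : z ≠ 0) (hslit : 1 - 4 * (t * α) / z ^ 2 ∈ Complex.slitPlane)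
    (hmax : ∀ β ∈ Icc (0 : ℝ) 1, g β + growth t β z ≤ g α + growth t α z) {β : ℝ}
    (hβ : β ∈ Icc (0 : ℝ) 1) (hne : β ≠ α) :
    g β + β * Real.log ‖wFun t α z‖ < g α + α * Real.log ‖wFun t α z‖ := by
  set ℓ := Real.log ‖wFun t α z‖
  by_contra! hge
  -- If `β` did at least as well as `α`, strict concavity would make the midpoint better by a
  -- definite amount `κ`, and then the direction from `α` to `γ` improves the linearized problem at
  -- rate at least `κ`.
  set γ := (1 / 2 : ℝ) * α + (1 / 2 : ℝ) * β with hγ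
  have hγ1 : (1 / 2 : ℝ) * g α + 1 / 2 * g β < g γ := by
    have := hg.2 hα hβ hne.symm (by norm_num : (0 : ℝ) < 1 / 2) (by norm_num : (0 : ℝ) < 1 / 2)
      (by norm_num)
    simp only [smul_eq_mul] at this
    exact this
  have hγm : γ ∈ Icc (0 : ℝ) 1 := by
    obtain ⟨h1, h2⟩ := hα
    obtain ⟨h3, h4⟩ := hβ
    constructor <;> rw [hγ] <;> linarith
  set κ := g γ + γ * ℓ - (g α + α * ℓ) with hκ
  have hκ0 : 0 < κ := by
    rw [hκ]
    have : γ * ℓ = 1 / 2 * (α * ℓ) + 1 / 2 * (β * ℓ) := by rw [hγ]; ring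
    linarith
  have hlin : HasDerivAt (fun τ : ℝ => α + τ * (γ - α)) (γ - α) 0 := by
    simpa using ((hasDerivAt_id (0 : ℝ)).mul_const (γ - α)).const_add α
  have hgr : HasDerivAt (fun b : ℝ => growth t b z) ℓ (α + 0 * (γ - α)) := by
    rw [zero_mul, add_zero]; exact hasDerivAt_growth hz hslit
  have hder := (hgr.comp (0 : ℝ) hlin).tendsto_slope_zero_right
  -- One-sided slopes of `growth` from `α` towards `γ`: maximality bounds them by minus the slope of
  -- `g`, while their limit is `ℓ(γ - α)`. No derivative of `g` enters, so endpoint maximizers are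
  -- covered.
  have hle : ℓ * (γ - α) ≤ ℓ * (γ - α) - κ := by
    refine le_of_tendsto hder ?_
    have hsmall : ∀ᶠ τ in 𝓝[>] (0 : ℝ), τ < 1 :=
      (gt_mem_nhds one_pos).filter_mono nhdsWithin_le_nhds
    filter_upwards [hsmall, self_mem_nhdsWithin] with τ hτ1 hτ0
    have hτ0' : 0 < τ := hτ0
    have hmem : α + τ * (γ - α) ∈ Icc (0 : ℝ) 1 := by
      obtain ⟨h1, h2⟩ := hα
      obtain ⟨h3, h4⟩ := hγm
      constructor <;> nlinarith
    have hconc : (1 - τ) * g α + τ * g γ ≤ g (α + τ * (γ - α)) := by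
      have := hg.concaveOn.2 hα hγm (by linarith : 0 ≤ 1 - τ) hτ0'.le (by ring)
      simp only [smul_eq_mul] at this
      rwa [show (1 - τ) * α + τ * γ = α + τ * (γ - α) by ring] at this
    have h5 := hmax _ hmem
    simp only [Function.comp, zero_add, zero_mul, add_zero, smul_eq_mul]
    rw [inv_mul_le_iff₀ hτ0', hκ]
    nlinarith
  linarith

theorem le_of_isUniqueMaximizer {g : ℝ → ℝ} {t z : ℂ} {α : ℝ} (h : IsUniqueMaximizer g t z α)
    (hz : z ≠ 0) {β : ℝ} (hβ : β ∈ Icc (0 : ℝ) 1) :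
    g β + growth t β z ≤ g α + growth t α z := by
  by_cases hne : β = α
  · rw [hne]
  · have := h.2 β hβ hne
    rw [fFun_eq_growth g t hβ.1 hz, fFun_eq_growth g t h.1.1 hz, EReal.coe_lt_coe_iff] at this
    exact this.le

theorem alphaZero_eq {g : ℝ → ℝ} {w : ℂ} {α : ℝ} (h : IsUniqueMaximizer g 0 w α) :
    alphaZero g w = α := by
  have : {α | IsUniqueMaximizer g 0 w α} = {α} := by
    ext β
    simp only [mem_ofPred_eq, mem_singleton_iff]
    refine ⟨fun hβ => ?_, fun hβ => hβ ▸ h⟩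
    by_contra hne
    exact lt_asymm (h.2 β hβ.1 hne) (hβ.2 α h.1 (Ne.symm hne))
  rw [alphaZero, this, csSup_singleton]

theorem growth_zero_left (β : ℝ) (w : ℂ) : growth 0 β w = β * Real.log ‖w‖ := by
  simp [growth, wFun_zero_left]

theorem isUniqueMaximizer_zero_of_lt {g : ℝ → ℝ} {w : ℂ} (hw : w ≠ 0) {α : ℝ}
    (hα : α ∈ Icc (0 : ℝ) 1) (h : ∀ β ∈ Icc (0 : ℝ) 1, β ≠ α →
      g β + β * Real.log ‖w‖ < g α + α * Real.log ‖w‖) : IsUniqueMaximizer g 0 w α :=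
  ⟨hα, fun β hβ hne => by
    rw [fFun_eq_growth g 0 hβ.1 hw, fFun_eq_growth g 0 hα.1 hw, growth_zero_left,
      growth_zero_left, EReal.coe_lt_coe_iff]
    exact h β hβ hne⟩

/-! ### Jacobian identity and transport of measures -/

/-- `m = M ∘ w` and `id = w + t m` force the forms `dm ∧ dz` and `w^*(dM ∧ dw)` to agree. -/
theorem reDbar_comp {B N : ℂ →L[ℝ] ℂ} {t : ℂ} (h : ∀ v, v = B v + t * N (B v)) :
    reDbar (N.comp B) = B.det * reDbar N := by
  have hdet : B.det = (B 1).re * (B Complex.I).im - (B Complex.I).re * (B 1).im := by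
    rw [ContinuousLinearMap.det, ← LinearMap.det_toMatrix Complex.basisOneI, Matrix.det_fin_two]
    simp [LinearMap.toMatrix_apply]
  have hexp : ∀ p : ℂ, N p = p.re * N 1 + p.im * N Complex.I := fun p => by
    conv_lhs => rw [show p = p.re • (1 : ℂ) + p.im • Complex.I by simp [Complex.re_add_im]]
    rw [map_add, map_smul, map_smul, Complex.real_smul, Complex.real_smul]
  have h1 := h 1
  have hI := h Complex.I
  have key : N (B 1) + Complex.I * N (B Complex.I) =
      ((B.det : ℝ) : ℂ) * (N 1 + Complex.I * N Complex.I) := by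
    -- Inserting `v = B v + t N(B v)` for `v = 1, i`, the terms in `t` cancel by antisymmetry. What
    -- remains is a two-form pulled back by `B`, hence scaled by `det B` in `e2`.
    have e1 : N (B 1) * Complex.I - N (B Complex.I) * 1 =
        N (B 1) * B Complex.I - N (B Complex.I) * B 1 := by
      linear_combination N (B 1) * hI - N (B Complex.I) * h1
    have e2 : N (B 1) * B Complex.I - N (B Complex.I) * B 1 =
        ((B.det : ℝ) : ℂ) * (N 1 * Complex.I - N Complex.I) := by
      rw [hdet]
      push_cast
      linear_combination B Complex.I * hexp (B 1) - B 1 * hexp (B Complex.I) -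
        (((B 1).re : ℂ) * N 1 + (B 1).im * N Complex.I) * Complex.re_add_im (B Complex.I) +
        (((B Complex.I).re : ℂ) * N 1 + (B Complex.I).im * N Complex.I) * Complex.re_add_im (B 1)
    linear_combination (-Complex.I) * (e1.trans e2) +
      (N (B 1) - (B.det : ℂ) * N 1) * Complex.I_sq
  rw [reDbar, reDbar, ← Complex.re_ofReal_mul, ← key]
  rfl

/-- A left inverse of an injective immersion of an open subset of `ℂ` is continuously
differentiable on the (open) image. -/
theorem isOpen_image_and_contDiffOn_leftInverse {V : Set ℂ} (hV : IsOpen V) {w T : ℂ → ℂ}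
    (hw : ContDiffOn ℝ 1 w V) (hinj : ∀ z ∈ V, ∀ v, fderiv ℝ w z v = 0 → v = 0)
    (hT : ∀ z ∈ V, T (w z) = z) : IsOpen (w '' V) ∧ ContDiffOn ℝ 1 T (w '' V) := by
  have key : ∀ z ∈ V, w '' V ∈ 𝓝 (w z) ∧ ContDiffAt ℝ 1 T (w z) := fun z hz => by
    have hwz : ContDiffAt ℝ 1 w z := hw.contDiffAt (hV.mem_nhds hz)
    set e : ℂ ≃L[ℝ] ℂ := (LinearEquiv.ofInjectiveEndo (fderiv ℝ w z : ℂ →ₗ[ℝ] ℂ)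
      ((injective_iff_map_eq_zero _).2 (hinj z hz))).toContinuousLinearEquiv with he
    have hfd : HasFDerivAt w (e : ℂ →L[ℝ] ℂ) z := by
      have : (e : ℂ →L[ℝ] ℂ) = fderiv ℝ w z := by ext v; rfl
      rw [this]
      exact (hwz.differentiableAt one_ne_zero).hasFDerivAt
    have hcd := hwz.to_localInverse hfd one_ne_zero
    have hval : hwz.localInverse hfd one_ne_zero (w z) = z := hwz.localInverse_apply_image hfd
      one_ne_zero
    have hright := (hwz.hasStrictFDerivAt' hfd one_ne_zero).eventually_right_inverse
    have hmem : ∀ᶠ y in 𝓝 (w z), hwz.localInverse hfd one_ne_zero y ∈ V := by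
      refine hcd.continuousAt.eventually_mem ?_
      rw [hval]
      exact hV.mem_nhds hz
    refine ⟨?_, hcd.congr_of_eventuallyEq ?_⟩
    · filter_upwards [hright, hmem] with y h1 h2 using ⟨_, h2, h1⟩
    · filter_upwards [hright, hmem] with y h1 h2
      rw [← hT _ h2]
      exact congrArg T h1.symm
  refine ⟨isOpen_iff_mem_nhds.2 ?_, ?_⟩
  · rintro _ ⟨z, hz, rfl⟩
    exact (key z hz).1
  · rintro _ ⟨z, hz, rfl⟩
    exact (key z hz).2.contDiffWithinAt

/-- The derivative of the maximal value, given that the maximizer is critical. -/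
theorem hasFDerivAt_profile_add_growth {g : ℝ → ℝ} {t : ℂ} {A : ℂ → ℝ} {A' : ℂ →L[ℝ] ℝ}
    {w' : ℂ →L[ℝ] ℂ} {z : ℂ} (hz : z ≠ 0) (hA : HasFDerivAt A A' z)
    (hw : HasFDerivAt (fun y => wFun t (A y) y) w' z)
    (hcrit : HasFDerivAt (fun y => g (A y)) (-Real.log ‖wFun t (A z) z‖ • A') z) :
    HasFDerivAt (fun y => g (A y) + growth t (A y) y)
      (Complex.reCLM.comp ((A z / wFun t (A z) z : ℂ) • ContinuousLinearMap.id ℝ ℂ)) z := by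
  have hrel : ∀ᶠ y in 𝓝 z, id y = wFun t (A y) y + t * A y / wFun t (A y) y := by
    filter_upwards [isOpen_ne.mem_nhds hz] with y hy
    exact (wFun_add_div t (A y) hy).symm
  have := hcrit.add (hasFDerivAt_growth hA hw (hasFDerivAt_id z) (wFun_ne_zero t _ hz) hrel)
  refine this.congr_fderiv ?_
  ext v
  simp

/-- Change of variables: a diffeomorphism intertwining two densities transports the measures. -/
theorem restrict_eq_map_of_density {ν₀ ν₁ : Measure ℂ} {V : Set ℂ} (hV : IsOpen V)
    {w T : ℂ → ℂ} {ρ₀ ρ₁ : ℂ → ℝ} (hw : ContDiffOn ℝ 1 w V) (hT : ∀ z ∈ V, T (w z) = z)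
    (hW : IsOpen (w '' V)) (hTc : ContinuousOn T (w '' V))
    (h₁ : ∀ s, MeasurableSet s → s ⊆ V → ν₁ s = ∫⁻ x in s, ENNReal.ofReal (ρ₁ x))
    (h₀ : ∀ s, MeasurableSet s → s ⊆ w '' V → ν₀ s = ∫⁻ x in s, ENNReal.ofReal (ρ₀ x))
    (hρ : ∀ z ∈ V, |(fderiv ℝ w z).det| * ρ₀ (w z) = ρ₁ z) :
    ν₁.restrict V = (ν₀.restrict (w '' V)).map T := by
  have hinj : InjOn w V := fun x hx y hy hxy => by rw [← hT x hx, ← hT y hy, hxy]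
  ext B hB
  rw [Measure.map_apply_of_aemeasurable (hTc.aemeasurable hW.measurableSet) hB,
    Measure.restrict_apply' hW.measurableSet, Measure.restrict_apply hB]
  have hset : T ⁻¹' B ∩ w '' V = w '' (B ∩ V) := by
    ext y
    constructor
    · rintro ⟨hy, z, hz, rfl⟩
      exact ⟨z, ⟨by rwa [mem_preimage, hT z hz] at hy, hz⟩, rfl⟩
    · rintro ⟨z, ⟨hzB, hz⟩, rfl⟩
      exact ⟨by rwa [mem_preimage, hT z hz], z, hz, rfl⟩
  have hBV : MeasurableSet (B ∩ V) := hB.inter hV.measurableSet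
  have hinjB : InjOn w (B ∩ V) := hinj.mono inter_subset_right
  have himg : MeasurableSet (w '' (B ∩ V)) :=
    hBV.image_of_continuousOn_injOn (hw.continuousOn.mono inter_subset_right) hinjB
  rw [hset, h₀ _ himg (image_mono inter_subset_right), h₁ _ hBV inter_subset_right,
    lintegral_image_eq_lintegral_abs_det_fderiv_mul volume hBV (f' := fderiv ℝ w)
      (fun x hx => ((hw.contDiffAt (hV.mem_nhds hx.2)).differentiableAt
        one_ne_zero).hasFDerivAt.hasFDerivWithinAt) hinjB]
  refine setLIntegral_congr_fun hBV fun x hx => ?_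
  rw [← ENNReal.ofReal_mul (abs_nonneg _), hρ x hx.2]

/-- Transport of the limiting zero distribution along a smooth family of critical maximizers. -/
theorem restrict_eq_map_transport {Ω : Type*} [MeasurableSpace Ω] {P : Measure Ω}
    [IsProbabilityMeasure P] {ξ : ℕ → Ω → ℂ} {a : ℕ → ℕ → ℂ} {g : ℝ → ℝ} (hA1 : CondA1 P ξ)
    (hA2 : CondA2 a g) {t : ℂ} {ν₀ νt : Measure ℂ} (hν₀ : IsLimitZeroDistribution P ξ a 0 ν₀)
    (hνt : IsLimitZeroDistribution P ξ a t νt) {V : Set ℂ} (hV : IsOpen V) (hV0 : ∀ z ∈ V, z ≠ 0)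
    {A : ℂ → ℝ} (hA : ContDiffOn ℝ 1 A V) (hw : ContDiffOn ℝ 1 (fun z => wFun t (A z) z) V)
    (hmax : ∀ z ∈ V, IsUniqueMaximizer g t z (A z))
    (hmax₀ : ∀ z ∈ V, IsUniqueMaximizer g 0 (wFun t (A z) z) (A z))
    (hcrit : ∀ z ∈ V, HasFDerivAt (fun y => g (A y))
      (-Real.log ‖wFun t (A z) z‖ • fderiv ℝ A z) z)
    (hinj : ∀ z ∈ V, ∀ v, fderiv ℝ (fun z => wFun t (A z) z) z v = 0 → v = 0) :
    νt.restrict V = (ν₀.restrict ((fun z => wFun t (A z) z) '' V)).map (transport g t) := by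
  set w : ℂ → ℂ := fun z => wFun t (A z) z with hwdef
  set T := transport g t with hTdef
  have hw0 : ∀ z ∈ V, w z ≠ 0 := fun z hz => wFun_ne_zero t _ (hV0 z hz)
  have halpha : ∀ z ∈ V, alphaZero g (w z) = A z := fun z hz => alphaZero_eq (hmax₀ z hz)
  have hTw : ∀ z ∈ V, T (w z) = z := fun z hz => by
    rw [hTdef, transport, halpha z hz]
    exact wFun_add_div t (A z) (hV0 z hz)
  obtain ⟨hW, hTc⟩ := isOpen_image_and_contDiffOn_leftInverse hV hw hinj hTw
  have hmapsT : MapsTo T (w '' V) V := by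
    rintro _ ⟨z, hz, rfl⟩
    rwa [hTw z hz]
  have hdA : ∀ z ∈ V, HasFDerivAt A (fderiv ℝ A z) z := fun z hz =>
    ((hA.contDiffAt (hV.mem_nhds hz)).differentiableAt one_ne_zero).hasFDerivAt
  have hdw : ∀ z ∈ V, HasFDerivAt w (fderiv ℝ w z) z := fun z hz =>
    ((hw.contDiffAt (hV.mem_nhds hz)).differentiableAt one_ne_zero).hasFDerivAt
  set m : ℂ → ℂ := fun z => A z / w z with hmdef
  -- On the image of `V`, `M = m ∘ T` with `T` the `C¹` left inverse of `w`. This supplies the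
  -- regularity of `M` without a separate study of `alphaZero`.
  set M : ℂ → ℂ := fun y => alphaZero g y / y with hMdef
  have hm : ContDiffOn ℝ 1 m V :=
    (Complex.ofRealCLM.contDiff.comp_contDiffOn hA).mul (hw.inv hw0)
  have hMw : ∀ z ∈ V, M (w z) = m z := fun z hz => by simp only [hMdef, hmdef, halpha z hz]
  have hMT : ∀ y ∈ w '' V, M y = m (T y) := by
    rintro _ ⟨z, hz, rfl⟩
    rw [hTw z hz, hMw z hz]
  have hM : ContDiffOn ℝ 1 M (w '' V) := (hm.comp hTc hmapsT).congr hMT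
  obtain ⟨hpos₁, hint₁⟩ := limit_measure_eq_lintegral hA1 hA2 hνt hV
    (U := fun z => g (A z) + growth t (A z) z) (m := m)
    (fun z hz => hasFDerivAt_profile_add_growth (hV0 z hz) (hdA z hz) (hdw z hz) (hcrit z hz)) hm
    (fun z hz h0 => ⟨fun β hβ => le_of_isUniqueMaximizer (hmax z hz) h0 hβ,
      A z, (hmax z hz).1, rfl⟩)
  obtain ⟨hpos₀, hint₀⟩ := limit_measure_eq_lintegral hA1 hA2 hν₀ hW
    (U := fun y => g (alphaZero g y) + growth 0 (alphaZero g y) y) (m := M)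
    (by
      rintro _ ⟨z, hz, rfl⟩
      have hev : alphaZero g =ᶠ[𝓝 (w z)] A ∘ T := by
        filter_upwards [hW.mem_nhds ⟨z, hz, rfl⟩]
        rintro _ ⟨x, hx, rfl⟩
        rw [Function.comp, hTw x hx, halpha x hx]
      have hdT : HasFDerivAt T (fderiv ℝ T (w z)) (w z) :=
        ((hTc.contDiffAt (hW.mem_nhds ⟨z, hz, rfl⟩)).differentiableAt one_ne_zero).hasFDerivAt
      have hdA' : HasFDerivAt A (fderiv ℝ A z) (T (w z)) := by
        rw [hTw z hz]; exact hdA z hz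
      have hcrit' : HasFDerivAt (fun y => g (A y)) (-Real.log ‖w z‖ • fderiv ℝ A z) (T (w z)) := by
        rw [hTw z hz]; exact hcrit z hz
      have h := hasFDerivAt_profile_add_growth (t := 0) (g := g) (hw0 z hz)
        ((hdA'.comp (w z) hdT).congr_of_eventuallyEq hev)
        (w' := ContinuousLinearMap.id ℝ ℂ) (by
          simp only [wFun_zero_left]; exact hasFDerivAt_id _)
        (by
          simp only [wFun_zero_left]
          have := (hcrit'.comp (w z) hdT).congr_of_eventuallyEq
            (hev.mono fun y hy => congrArg g hy)
          rwa [ContinuousLinearMap.smul_comp] at this)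
      simpa only [wFun_zero_left] using h) hM
    (by
      rintro _ ⟨z, hz, rfl⟩ h0
      have hu : IsUniqueMaximizer g 0 (w z) (alphaZero g (w z)) := by
        rw [halpha z hz]; exact hmax₀ z hz
      exact ⟨fun β hβ => le_of_isUniqueMaximizer hu h0 hβ, _, hu.1, rfl⟩)
  refine restrict_eq_map_of_density hV hw hTw hW hTc.continuousOn hint₁ hint₀ fun z hz => ?_
  have hzW : w z ∈ w '' V := ⟨z, hz, rfl⟩
  have hdM : HasFDerivAt M (fderiv ℝ M (w z)) (w z) :=
    ((hM.contDiffAt (hW.mem_nhds hzW)).differentiableAt one_ne_zero).hasFDerivAt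
  have hdm : HasFDerivAt m ((fderiv ℝ M (w z)).comp (fderiv ℝ w z)) z :=
    (hdM.comp z (hdw z hz)).congr_of_eventuallyEq <| by
      filter_upwards [hV.mem_nhds hz] with x hx using (hMw x hx).symm
  -- The signed identity yields the one with `|det|` because both Laplacians, being densities of
  -- positive measures, are nonnegative. The sign of the Jacobian need not be known.
  have hdet : reDbar (fderiv ℝ m z) = (fderiv ℝ w z).det * reDbar (fderiv ℝ M (w z)) := by
    rw [hdm.fderiv]
    refine reDbar_comp (t := t) fun v => ?_
    have hid : HasFDerivAt (fun x : ℂ => x)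
        (fderiv ℝ w z + t • (fderiv ℝ M (w z)).comp (fderiv ℝ w z)) z := by
      refine ((hdw z hz).add (hdm.const_mul t)).congr_of_eventuallyEq ?_
      filter_upwards [hV.mem_nhds hz] with x hx
      have := wFun_add_div t (A x) (hV0 x hx)
      rw [mul_div_assoc] at this
      exact this.symm
    exact congrArg (fun L : ℂ →L[ℝ] ℂ => L v) ((hasFDerivAt_id z).unique hid)
  have h1 := hpos₁ z hz
  have h2 := hpos₀ _ hzW
  rw [← mul_div_assoc]
  congr 1
  calc |(fderiv ℝ w z).det| * reDbar (fderiv ℝ M (w z))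
      = |(fderiv ℝ w z).det * reDbar (fderiv ℝ M (w z))| := by rw [abs_mul, abs_of_nonneg h2]
    _ = reDbar (fderiv ℝ m z) := by rw [← hdet, abs_of_nonneg h1]

/-! ### The slit condition and the three kinds of regular domains -/

/-- Points off the slit `√(tα) [-2,2]` have `1 - 4tα/z²` in the slit plane. -/
theorem mem_slitPlane_of_forall_ne {z τ : ℂ}
    (h : ∀ x ∈ Icc (-2 : ℝ) 2, z ≠ (x : ℂ) * τ ^ (1 / 2 : ℂ)) :
    z ≠ 0 ∧ 1 - 4 * τ / z ^ 2 ∈ Complex.slitPlane := by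
  have hz : z ≠ 0 := by simpa using h 0 (by norm_num)
  refine ⟨hz, ?_⟩
  by_contra hslit
  rw [Complex.mem_slitPlane_iff, not_or, not_lt, not_not] at hslit
  set u := 1 - 4 * τ / z ^ 2 with hu
  have hur : u = ((u.re : ℝ) : ℂ) := Complex.ext rfl (by simpa using hslit.2)
  have h1 : 4 * τ = ((1 - u.re : ℝ) : ℂ) * z ^ 2 := by
    push_cast
    rw [← hur, hu]
    field_simp
    ring
  have hge : 1 ≤ 1 - u.re := by linarith [hslit.1]
  -- If `1 - 4τ/z²` were a nonpositive real, then `z² = 4τ/r²` with `r ≥ 1`, so `z = ±(2/r)√τ` would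
  -- lie on the slit.
  set r := Real.sqrt (1 - u.re) with hr
  have hr1 : 1 ≤ r := Real.one_le_sqrt.2 hge
  have hr0 : (r : ℂ) ≠ 0 := by exact_mod_cast (by linarith : r ≠ 0)
  have hrsq : (r : ℂ) ^ 2 = ((1 - u.re : ℝ) : ℂ) := by
    exact_mod_cast Real.sq_sqrt (by linarith : (0 : ℝ) ≤ 1 - u.re)
  have hle : 2 / r ≤ 2 := by
    rw [div_le_iff₀ (by linarith)]; linarith
  have hnn : 0 ≤ 2 / r := by positivity
  have hsq : z ^ 2 = (((2 / r : ℝ) : ℂ) * τ ^ (1 / 2 : ℂ)) ^ 2 := by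
    rw [mul_pow, sq_cpow_half]
    push_cast
    rw [div_pow, div_mul_eq_mul_div, eq_div_iff (pow_ne_zero 2 hr0), hrsq]
    linear_combination -h1
  rcases sq_eq_sq_iff_eq_or_eq_neg.1 hsq with h2 | h2
  · exact h _ ⟨by linarith, hle⟩ h2
  · refine h (-(2 / r)) ⟨by linarith, by linarith⟩ ?_
    rw [h2]; push_cast; ring

/-- No mass is created or present where the maximizer is `0`. -/
theorem limit_measure_eq_zero {Ω : Type*} [MeasurableSpace Ω] {P : Measure Ω}
    [IsProbabilityMeasure P] {ξ : ℕ → Ω → ℂ} {a : ℕ → ℕ → ℂ} {g : ℝ → ℝ} (hA1 : CondA1 P ξ)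
    (hA2 : CondA2 a g) {t : ℂ} {ν : Measure ℂ} (hν : IsLimitZeroDistribution P ξ a t ν)
    {V : Set ℂ} (hV : IsOpen V)
    (hmax : ∀ z ∈ V, z ≠ 0 → ∀ β ∈ Icc (0 : ℝ) 1, g β + growth t β z ≤ g 0) : ν V = 0 := by
  have h := (limit_measure_eq_lintegral hA1 hA2 hν hV (U := fun _ => g 0) (m := fun _ => 0)
    (fun x _ => 
      (hasFDerivAt_const (g 0) x).congr_fderiv (by ext v; simp)) contDiffOn_const
    (fun z hz h0 => ⟨hmax z hz h0, 0, by simp, by simp [growth]⟩)).2 V hV.measurableSet subset_rfl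
  rw [h]
  simp [reDbar]

/-- The derivative of `T_t⁻¹` is injective as soon as its kernel is contained in that of `dα`. -/
theorem eq_zero_of_fderiv_wFun_eq_zero {t : ℂ} {A : ℂ → ℝ} {A' : ℂ →L[ℝ] ℝ} {w' : ℂ →L[ℝ] ℂ}
    {z : ℂ} (hz : z ≠ 0) (hA : HasFDerivAt A A' z)
    (hw : HasFDerivAt (fun y => wFun t (A y) y) w' z) {v : ℂ} (hv : w' v = 0) (hAv : A' v = 0) :
    v = 0 := by
  -- Differentiating `w (z - w) = t α` in a direction where `dw` and `dα` both vanish leaves `w v =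
  -- 0`.
  have h1 : HasFDerivAt (fun y => wFun t (A y) y * (y - wFun t (A y) y)) _ z :=
    hw.mul ((hasFDerivAt_id z).sub hw)
  have h2 : HasFDerivAt (fun y => t * (A y : ℂ)) _ z :=
    ((Complex.ofRealCLM.hasFDerivAt (x := A z)).comp z hA).const_mul t
  have h3 : (fun y => wFun t (A y) y * (y - wFun t (A y) y)) =ᶠ[𝓝 z] fun y => t * (A y : ℂ) := by
    filter_upwards [isOpen_ne.mem_nhds hz] with y hy using wFun_mul_sub t (A y) hy
  have h4 := congrArg (fun L : ℂ →L[ℝ] ℂ => L v) (h1.unique (h2.congr_of_eventuallyEq h3))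
  have h5 : wFun t (A z) z * v = 0 := by simpa [hv, hAv] using h4
  exact (mul_eq_zero.1 h5).resolve_left (wFun_ne_zero t _ hz)

/-- Critical point equation for the initial problem. -/
theorem deriv_add_log_eq_zero {g : ℝ → ℝ} {α ℓ : ℝ} (hα : α ∈ Ioo (0 : ℝ) 1)
    (hg : DifferentiableAt ℝ g α)
    (h : ∀ β ∈ Icc (0 : ℝ) 1, β ≠ α → g β + β * ℓ < g α + α * ℓ) : deriv g α + ℓ = 0 := by
  have hmax : IsLocalMax (fun β => g β + β * ℓ) α := by
    filter_upwards [Icc_mem_nhds hα.1 hα.2] with β hβ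
    by_cases hne : β = α
    · rw [hne]
    · exact (h β hβ hne).le
  have hd : HasDerivAt (fun β => g β + β * ℓ) (deriv g α + ℓ) α := by
    have := hg.hasDerivAt.add ((hasDerivAt_id α).mul_const ℓ)
    rwa [one_mul] at this
  exact hmax.hasDerivAt_eq_zero hd

/-- In the region of interior maximizers the maximizer is determined by `log |w|` through
`g'(α) = -log |w|`, with nondegenerate dependence. -/
theorem hasFDerivAt_profile_and_ker_le {g : ℝ → ℝ} (hA3 : CondA3 g) {V : Set ℂ} (hV : IsOpen V)
    {A : ℂ → ℝ} {w : ℂ → ℂ} {A' : ℂ →L[ℝ] ℝ} {w' : ℂ →L[ℝ] ℂ} {z : ℂ} (hz : z ∈ V)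
    (hA01 : ∀ y ∈ V, A y ∈ Ioo (0 : ℝ) 1) (hA : HasFDerivAt A A' z) (hw : HasFDerivAt w w' z)
    (hw0 : w z ≠ 0)
    (hmax : ∀ y ∈ V, ∀ β ∈ Icc (0 : ℝ) 1, β ≠ A y →
      g β + β * Real.log ‖w y‖ < g (A y) + A y * Real.log ‖w y‖) :
    HasFDerivAt (fun y => g (A y)) (-Real.log ‖w z‖ • A') z ∧ ∀ v, w' v = 0 → A' v = 0 := by
  have hgd : ∀ α ∈ Ioo (0 : ℝ) 1, DifferentiableAt ℝ g α := fun α hα =>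
    (hA3.contDiffOn.contDiffAt (isOpen_Ioo.mem_nhds hα)).differentiableAt (by simp)
  have hcrit : ∀ y ∈ V, deriv g (A y) + Real.log ‖w y‖ = 0 := fun y hy =>
    deriv_add_log_eq_zero (hA01 y hy) (hgd _ (hA01 y hy)) (hmax y hy)
  constructor
  · have := (hgd _ (hA01 z hz)).hasDerivAt.comp_hasFDerivAt z hA
    rwa [eq_neg_of_add_eq_zero_left (hcrit z hz)] at this
  · intro v hv
    have hdd : DifferentiableAt ℝ (deriv g) (A z) :=
      ((hA3.contDiffOn.deriv_of_isOpen (m := 1) isOpen_Ioo (by norm_cast)).contDiffAt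
        (isOpen_Ioo.mem_nhds (hA01 z hz))).differentiableAt one_ne_zero
    -- Differentiating `g'(A) + log|w| = 0` gives `g''(A) dA = -Re(dw/w)`, and `g'' ≠ 0` turns `dw v
    -- = 0` into `dA v = 0`.
    have h1 : HasFDerivAt (fun y => deriv g (A y) + Real.log ‖w y‖) _ z :=
      (hdd.hasDerivAt.comp_hasFDerivAt z hA).add (hasFDerivAt_log_norm hw hw0)
    have h2 : HasFDerivAt (fun y => deriv g (A y) + Real.log ‖w y‖) (0 : ℂ →L[ℝ] ℝ) z :=
      (hasFDerivAt_const (0 : ℝ) z).congr_of_eventuallyEq <| by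
        filter_upwards [hV.mem_nhds hz] with y hy using hcrit y hy
    have h3 := congrArg (fun L : ℂ →L[ℝ] ℝ => L v) (h1.unique h2)
    have h4 : deriv (deriv g) (A z) * A' v = 0 := by simpa [hv] using h3
    exact (mul_eq_zero.1 h4).resolve_left (hA3.deriv2_neg _ (hA01 z hz)).ne

end HeatZeros

/-! ### The transport theorem -/

open HeatZeros

theorem theorem3p11 {Ω : Type*} [MeasurableSpace Ω] (P : MeasureTheory.Measure Ω)
    [MeasureTheory.IsProbabilityMeasure P]
    (ξ : ℕ → Ω → ℂ) (a : ℕ → ℕ → ℂ) (g : ℝ → ℝ)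
    (hA1 : HeatZeros.CondA1 P ξ) (hA2 : HeatZeros.CondA2 a g) (hA3 : HeatZeros.CondA3 g)
    (D : Set (ℂ × ℂ)) (α : ℂ × ℂ → ℝ) (hD : HeatZeros.IsRegularDomain g D α) (t : ℂ)
    (ν₀ νt : MeasureTheory.Measure ℂ)
    (hν₀ : HeatZeros.IsLimitZeroDistribution P ξ a 0 ν₀)
    (hνt : HeatZeros.IsLimitZeroDistribution P ξ a t νt) :
    νt.restrict (HeatZeros.slice D t) =
      (ν₀.restrict (HeatZeros.transportInv α t '' HeatZeros.slice D t)).map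
        (HeatZeros.transport g t) := by
  have hg := strictConcaveOn_profile hA2 hA3
  have hV : IsOpen (slice D t) := hD.isOpen.preimage (Continuous.prodMk_left t)
  have hmax : ∀ z ∈ slice D t, IsUniqueMaximizer g t z (α (z, t)) := fun z hz =>
    hD.maximizer _ hz
  have hle : ∀ z ∈ slice D t, z ≠ 0 → ∀ β ∈ Icc (0 : ℝ) 1,
      g β + growth t β z ≤ g (α (z, t)) + growth t (α (z, t)) z := fun z hz h0 β hβ =>
    le_of_isUniqueMaximizer (hmax z hz) h0 hβ
  have hlt : ∀ z ∈ slice D t, z ≠ 0 →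
      1 - 4 * (t * α (z, t)) / z ^ 2 ∈ Complex.slitPlane → ∀ β ∈ Icc (0 : ℝ) 1, β ≠ α (z, t) →
      g β + β * Real.log ‖wFun t (α (z, t)) z‖ <
        g (α (z, t)) + α (z, t) * Real.log ‖wFun t (α (z, t)) z‖ :=
    fun z hz h0 hs β hβ hne => lt_of_isMax_growth hg (hmax z hz).1 h0 hs (hle z hz h0) hβ hne
  -- This case is separate because `z = 0` may belong to the slice, where the branch analysis fails.
  -- Here `U` is constant, the branch is the identity, and both restricted measures vanish.
  by_cases hzero : ∀ p ∈ D, α p = 0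
  · have himg : transportInv α t '' slice D t = slice D t := by
      refine (image_congr fun z hz => ?_).trans (image_id _)
      change wFun t (α (z, t)) z = z
      rw [hzero _ hz, wFun_zero_right]
    have h1 : νt (slice D t) = 0 := limit_measure_eq_zero hA1 hA2 hνt hV fun z hz h0 β hβ => by
      simpa [hzero _ hz, growth] using hle z hz h0 β hβ
    have h2 : ν₀ (slice D t) = 0 := limit_measure_eq_zero hA1 hA2 hν₀ hV fun z hz h0 β hβ => by
      rw [growth_zero_left]
      by_cases hne : β = 0
      · simp [hne]
      · have := hlt z hz h0 (by simp [hzero _ hz]) β hβ (by rwa [hzero _ hz])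
        rw [hzero _ hz, wFun_zero_right, zero_mul, add_zero] at this
        exact this.le
    rw [himg, Measure.restrict_eq_zero.2 h1, Measure.restrict_eq_zero.2 h2, Measure.map_zero]
  have hne : ∀ p ∈ D, α p ≠ 0 := fun p hp => by
    rcases hD.cases with h | h | h
    · exact absurd h hzero
    · rw [h p hp]; exact one_ne_zero
    · exact (h p hp).1.ne'
  have hslit : ∀ z ∈ slice D t, z ≠ 0 ∧ 1 - 4 * (t * α (z, t)) / z ^ 2 ∈ Complex.slitPlane :=
    fun z hz => mem_slitPlane_of_forall_ne ((hD.off_slit _ hz).resolve_left (hne _ hz))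
  have hV0 : ∀ z ∈ slice D t, z ≠ 0 := fun z hz => (hslit z hz).1
  have hlt' := fun z hz => hlt z hz (hV0 z hz) (hslit z hz).2
  have hA : ContDiffOn ℝ 1 (fun z => α (z, t)) (slice D t) :=
    (hD.smooth.of_le (by exact_mod_cast le_top)).comp
      (contDiff_prodMk_left t).contDiffOn fun z hz => hz
  have hw : ContDiffOn ℝ 1 (fun z => wFun t (α (z, t)) z) (slice D t) := fun z hz =>
    (contDiffAt_wFun (n := 1) (hA.contDiffAt (hV.mem_nhds hz)) contDiffAt_id (hV0 z hz)
      (hslit z hz).2).contDiffWithinAt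
  have hdA : ∀ z ∈ slice D t, HasFDerivAt (fun z => α (z, t))
      (fderiv ℝ (fun z => α (z, t)) z) z := fun z hz =>
    ((hA.contDiffAt (hV.mem_nhds hz)).differentiableAt one_ne_zero).hasFDerivAt
  have hdw : ∀ z ∈ slice D t, HasFDerivAt (fun z => wFun t (α (z, t)) z)
      (fderiv ℝ (fun z => wFun t (α (z, t)) z) z) z := fun z hz =>
    ((hw.contDiffAt (hV.mem_nhds hz)).differentiableAt one_ne_zero).hasFDerivAt
  have hcrit : ∀ z ∈ slice D t, HasFDerivAt (fun y => g (α (y, t)))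
      (-Real.log ‖wFun t (α (z, t)) z‖ • fderiv ℝ (fun z => α (z, t)) z) z ∧
      ∀ v, fderiv ℝ (fun z => wFun t (α (z, t)) z) z v = 0 →
        fderiv ℝ (fun z => α (z, t)) z v = 0 := fun z hz => by
    rcases hD.cases with h | h | h
    · exact absurd h hzero
    -- For `α ≡ 1` there is no critical point equation, nor is `g` differentiable at `1` from both
    -- sides in general. Local constancy of `α` makes both claims trivial.
    · have hone : (fun y => α (y, t)) =ᶠ[𝓝 z] fun _ => 1 := by
        filter_upwards [hV.mem_nhds hz] with y hy using h _ hy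
      have hd0 : fderiv ℝ (fun z => α (z, t)) z = 0 := by
        rw [hone.fderiv_eq]; simp
      rw [hd0, smul_zero]
      exact ⟨(hasFDerivAt_const (g 1) z).congr_of_eventuallyEq (hone.fun_comp g),
        fun _ _ => rfl⟩
    · exact hasFDerivAt_profile_and_ker_le hA3 hV (w := fun z => wFun t (α (z, t)) z) hz
        (fun y hy => h _ hy) (hdA z hz) (hdw z hz) (wFun_ne_zero t _ (hV0 z hz)) hlt'
  exact restrict_eq_map_transport hA1 hA2 hν₀ hνt hV hV0 hA hw hmax
    (fun z hz => isUniqueMaximizer_zero_of_lt (wFun_ne_zero t _ (hV0 z hz)) (hmax z hz).1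
      (hlt' z hz)) (fun z hz => (hcrit z hz).1)
    fun z hz v hv => eq_zero_of_fderiv_wFun_eq_zero (hV0 z hz) (hdA z hz) (hdw z hz) hv
      ((hcrit z hz).2 v hv)
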